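/- Let $\eta=\mathrm{diag}(-1,1,1,1)$ be the Minkowski metric on $\mathbb R^4$. For a metric $g$ let $R^{\alpha}{}_{\beta\gamma\delta}=\partial_\gamma\Gamma^\alpha_{\beta\delta}+\Gamma^\alpha_{\gamma\lambda}\Gamma^\lambda_{\beta\delta}-(\gamma\leftrightarrow\delta)$, $R_{\mu\nu}=R^\alpha{}_{\mu\alpha\nu}$, $K_{\mu\nu}=\frac12\big(R_{\mu\nu}-\frac16 g_{\mu\nu}R\big)$, let $W_{\alpha\beta\gamma\delta}$ be the Weyl tensor, let $C_{\alpha\beta\gamma}=K_{\beta\alpha;\gamma}-K_{\gamma\alpha;\beta}$ be the Cotton tensor, and let $$B_{\alpha\beta}=-2\big(g^{\gamma\delta}C_{\alpha\beta\gamma;\delta}+K^{\gamma\delta}W_{\alpha\gamma\beta\delta}\big)$$ be the Bach tensor. For a real number $\alpha$ and two smooth symmetric tensor fields $h^1_{\mu\nu},h^2_{\mu\nu}$ on $\mathbb R^4$, put $g=\eta+\alpha h^1$ and, where $\det g<0$, $$S_\alpha[h^1,h^2]=\int d^4x\,\sqrt{-g}\;h^2_{\mu\nu}\,B^{\mu\nu}[g].$$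 For smooth compactly supported covector fields $\xi^1_\mu,\xi^2_\mu$ and functions $\varphi^1,\varphi^2$ define, with covariant derivatives $;$ and index raising by $g$, $$\delta h^1_{\mu\nu}=\tfrac1\alpha\,\delta g_{\mu\nu}=\xi^1_{\mu;\nu}+\xi^1_{\nu;\mu}+2\varphi^1 g_{\mu\nu},$$ $$\delta h^2_{\mu\nu}=\alpha\,\mathcal L_{\xi^1}h^2_{\mu\nu}+2\alpha\varphi^1h^2_{\mu\nu}+\xi^2_{\mu;\nu}+\xi^2_{\nu;\mu}+2\varphi^2 g_{\mu\nu}$$ (for $\alpha=0$ the outer expressions are the definition). Then $S_\alpha$ defines a consistent theory with genuine cross-interactions between two Weyl gravitons whose internal metric is $k_{ab}=\begin{pmatrix}0&1\\1&0\end{pmatrix}$, in the following sense. 1. (Gauge invariance.) Let $\det g<0$ everywhere, and let $U\subseteq\mathbb R^4$ be any measurable region that contains the supports of $\xi^a,\varphi^a$ and over which the Lagrangian density of $(h^1,h^2)$ is integrable (for instance any compact such region, or $\mathbb R^4$ when the action converges). Then for all small $\varepsilon$ the Lagrangian density of $h+\varepsilon\,\delta h$ is integrable over $U$, and the action over $U$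 satisfies $\frac{d}{d\varepsilon}\big|_{\varepsilon=0}S_{\alpha,U}[h+\varepsilon\,\delta h]=0$. 2. (Free limit of the action.) For smooth compactly supported symmetric $h^1,h^2$, $$\lim_{\alpha\to0,\ \alpha\neq0}\frac1\alpha S_\alpha[h^1,h^2]=\frac12\sum_{a,b}k_{ab}\int d^4x\;\mathcal W^a_{\alpha\beta\gamma\delta}\mathcal W^{b\,\alpha\beta\gamma\delta},$$ where $\mathcal W^a$ is the linearized Weyl tensor of $h^a$. 3. (Free limit of the gauge transformations.) As $\alpha\to0$, the transformations converge pointwise to the linear ones $\delta h^a_{\mu\nu}=\partial_\mu\xi^a_\nu+\partial_\nu\xi^a_\mu+2\varphi^a\eta_{\mu\nu}$, $a=1,2$. 4. (Genuine cross-interactions.) For $\alpha\ne0$ no change of basis in the internal space decouples the two fields: there are no invertible real $2\times2$ matrix $M$ and functionals $F,G$ such that $S_\alpha[Mu]=F[u^1]+G[u^2]$, where $(Mu)^a=\sum_b M^a{}_b u^b$, for all smooth compactly supported symmetric $u^1,u^2$ for which the metric $\eta+\alpha (Mu)^1$ has negative determinant everywhere. -/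

import Mathlib

open MeasureTheory Filter Topology
open scoped ContDiff Matrix

noncomputable section

namespace WeylGravitons

/-- Spacetime `ℝ⁴` with coordinates `x⁰, x¹, x², x³` and Lebesgue measure. -/
abbrev Spacetime := Fin 4 → ℝ

/-- Scalar fields on spacetime. -/
abbrev ScalarField := Spacetime → ℝ

/-- Covector fields `ξ_μ`, given by their components. -/
abbrev CovectorField := Spacetime → Fin 4 → ℝ

/-- Covariant tensor fields `t_{μν}` of rank two, given by their components. -/
abbrev TensorField := Spacetime → Matrix (Fin 4) (Fin 4) ℝ

/-- Smooth symmetric rank-two tensor fields. -/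
structure IsSymmField (t : TensorField) : Prop where
  smooth : ∀ μ ν, ContDiff ℝ ∞ (fun x => t x μ ν)
  symm : ∀ x, (t x).IsSymm

/-- The partial derivative `∂_μ f`. -/
def pd (μ : Fin 4) (f : ScalarField) : ScalarField :=
  fun x => fderiv ℝ f x (Pi.single μ 1)

/-- The Minkowski metric `diag(-1, 1, 1, 1)`; it is its own inverse. -/
def mink : Matrix (Fin 4) (Fin 4) ℝ := Matrix.diagonal ![-1, 1, 1, 1]

/-! ### Curvature of a metric `g` in coordinates -/

/-- The inverse metric `g^{μν}`. -/
def inv (g : TensorField) (μ ν : Fin 4) : ScalarField := fun x => (g x)⁻¹ μ ν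

/-- Christoffel symbols `Γ^a_{bc}`. -/
def christoffel (g : TensorField) (a b c : Fin 4) : ScalarField := fun x =>
  (1 / 2) * ∑ d, inv g a d x *
    (pd b (fun y => g y d c) x + pd c (fun y => g y d b) x - pd d (fun y => g y b c) x)

/-- Riemann tensor
`R^a_{bcd} = ∂_c Γ^a_{bd} + Γ^a_{ce} Γ^e_{bd} - (c ↔ d)`. -/
def riemann (g : TensorField) (a b c d : Fin 4) : ScalarField := fun x =>
  (pd c (christoffel g a b d) x + ∑ e, christoffel g a c e x * christoffel g e b d x)
    - (pd d (christoffel g a b c) x + ∑ e, christoffel g a d e x * christoffel g e b c x)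

/-- Ricci tensor `R_{ab} = R^c_{acb}`. -/
def ricci (g : TensorField) (a b : Fin 4) : ScalarField := fun x =>
  ∑ c, riemann g c a c b x

/-- Scalar curvature `R = g^{ab} R_{ab}`. -/
def scalarCurv (g : TensorField) : ScalarField := fun x =>
  ∑ a, ∑ b, inv g a b x * ricci g a b x

/-- The Schouten tensor in dimension four, `K_{ab} = ½ (R_{ab} - (1/6) g_{ab} R)`. -/
def schouten (g : TensorField) (a b : Fin 4) : ScalarField := fun x =>
  (1 / 2) * (ricci g a b x - (1 / 6) * g x a b * scalarCurv g x)

/-- The Weyl tensor, first index raised: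
`W^a_{bcd} = R^a_{bcd} - (δ^a_c K_{db} - δ^a_d K_{cb} - g_{bc} K_d^a + g_{bd} K_c^a)`. -/
def weyl (g : TensorField) (a b c d : Fin 4) : ScalarField := fun x =>
  riemann g a b c d x -
    ((if a = c then 1 else 0) * schouten g d b x
      - (if a = d then 1 else 0) * schouten g c b x
      - g x b c * (∑ e, inv g a e x * schouten g d e x)
      + g x b d * (∑ e, inv g a e x * schouten g c e x))

/-- The Weyl tensor with all indices down, `W_{abcd} = g_{ae} W^e_{bcd}`. -/
def weylLow (g : TensorField) (a b c d : Fin 4) : ScalarField := fun x =>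
  ∑ e, g x a e * weyl g e b c d x

/-- Covariant derivative of a covector field, `ξ_{a;c} = ∇_c ξ_a`. -/
def cov1 (g : TensorField) (ξ : Fin 4 → ScalarField) (c a : Fin 4) : ScalarField := fun x =>
  pd c (ξ a) x - ∑ e, christoffel g e c a x * ξ e x

/-- Covariant derivative of a covariant rank-two tensor, `∇_c t_{ab}`. -/
def cov2 (g : TensorField) (t : Fin 4 → Fin 4 → ScalarField) (c a b : Fin 4) :
    ScalarField := fun x =>
  pd c (t a b) x - (∑ e, christoffel g e c a x * t e b x)
    - (∑ e, christoffel g e c b x * t a e x)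

/-- Covariant derivative of a covariant rank-three tensor, `∇_d t_{abc}`. -/
def cov3 (g : TensorField) (t : Fin 4 → Fin 4 → Fin 4 → ScalarField) (d a b c : Fin 4) :
    ScalarField := fun x =>
  pd d (t a b c) x - (∑ e, christoffel g e d a x * t e b c x)
    - (∑ e, christoffel g e d b x * t a e c x)
    - (∑ e, christoffel g e d c x * t a b e x)

/-- The Cotton tensor `C_{abc} = ∇_c K_{ba} - ∇_b K_{ca}`. -/
def cotton (g : TensorField) (a b c : Fin 4) : ScalarField := fun x =>
  cov2 g (schouten g) c b a x - cov2 g (schouten g) b c a x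

/-- The Bach tensor `B_{ab} = -2 (∇^c C_{abc} + K^{cd} W_{acbd})`. The factor `-2` is the
normalisation for which `√-g B^{ab}` is the variational derivative of `½ ∫ √-g W²`. -/
def bachLow (g : TensorField) (a b : Fin 4) : ScalarField := fun x =>
  -2 * ((∑ c, ∑ d, inv g c d x * cov3 g (cotton g) d a b c x)
    + ∑ c, ∑ d, ∑ p, ∑ q,
        inv g c p x * inv g d q x * schouten g p q x * weylLow g a c b d x)

/-- The Bach tensor with indices up, `B^{μν} = g^{μa} g^{νb} B_{ab}`. -/
def bach (g : TensorField) (μ ν : Fin 4) : ScalarField := fun x =>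
  ∑ a, ∑ b, inv g μ a x * inv g ν b x * bachLow g a b x

/-- The Lie derivative of a covariant rank-two tensor `t` along the vector field
`v^ρ = g^{ρσ} ξ_σ`: `v^ρ ∂_ρ t_{μν} + t_{ρν} ∂_μ v^ρ + t_{μρ} ∂_ν v^ρ`. -/
def lieD (g : TensorField) (ξ : CovectorField) (t : TensorField) (μ ν : Fin 4) :
    ScalarField := fun x =>
  let v : Fin 4 → ScalarField := fun ρ y => ∑ σ, inv g ρ σ y * ξ y σ
  ∑ ρ, (v ρ x * pd ρ (fun y => t y μ ν) x + pd μ (v ρ) x * t x ρ ν + pd ν (v ρ) x * t x μ ρ)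

/-! ### The theory of two Weyl fields `h¹ = h 0`, `h² = h 1` -/

/-- The metric `g = η + α h¹`. -/
def metric (α : ℝ) (h : Fin 2 → TensorField) : TensorField := fun x => mink + α • h 0 x

/-- The Lagrangian density `√-g h²_{μν} B^{μν}[g]`. -/
def lagrangian (α : ℝ) (h : Fin 2 → TensorField) : ScalarField := fun x =>
  Real.sqrt (-(metric α h x).det) * ∑ μ, ∑ ν, h 1 x μ ν * bach (metric α h) μ ν x

/-- The action over a region `U` of spacetime. -/
def action (α : ℝ) (U : Set Spacetime) (h : Fin 2 → TensorField) : ℝ :=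
  ∫ x in U, lagrangian α h x

/-- A smooth symmetric pair of fields for which `g = η + α h¹` is a nondegenerate metric with
`det g < 0` everywhere, so that the action makes sense. -/
structure Admissible (α : ℝ) (h : Fin 2 → TensorField) : Prop where
  field : ∀ a, IsSymmField (h a)
  det_neg : ∀ x, (metric α h x).det < 0

/-- Gauge parameters: two covector fields `ξ^a_μ` and two scalar fields `φ^a`, smooth and
compactly supported. -/
structure IsGaugeParam (ξ : Fin 2 → CovectorField) (φ : Fin 2 → ScalarField) : Prop where
  smooth_ξ : ∀ a, ContDiff ℝ ∞ (ξ a)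
  smooth_φ : ∀ a, ContDiff ℝ ∞ (φ a)
  supp_ξ : ∀ a, HasCompactSupport (ξ a)
  supp_φ : ∀ a, HasCompactSupport (φ a)

/-- `ξ_{μ;ν} + ξ_{ν;μ} + 2 φ g_{μν}`. -/
def gaugeBase (g : TensorField) (ξ : CovectorField) (φ : ScalarField) : TensorField :=
  fun x => Matrix.of fun μ ν =>
    cov1 g (fun σ y => ξ y σ) ν μ x + cov1 g (fun σ y => ξ y σ) μ ν x + 2 * φ x * g x μ ν

/-- The nonlinear gauge transformations
`δh¹_{μν} = (1/α) δg_{μν} = ξ¹_{μ;ν} + ξ¹_{ν;μ} + 2 φ¹ g_{μν}` and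
`δh²_{μν} = α ℒ_{ξ¹} h²_{μν} + 2 α φ¹ h²_{μν} + ξ²_{μ;ν} + ξ²_{ν;μ} + 2 φ² g_{μν}`,
covariant derivatives being those of `g = η + α h¹`. -/
def gaugeVar (α : ℝ) (h : Fin 2 → TensorField) (ξ : Fin 2 → CovectorField)
    (φ : Fin 2 → ScalarField) : Fin 2 → TensorField :=
  ![gaugeBase (metric α h) (ξ 0) (φ 0),
    fun x => Matrix.of fun μ ν =>
      α * lieD (metric α h) (ξ 0) (h 1) μ ν x + 2 * α * φ 0 x * h 1 x μ ν
        + gaugeBase (metric α h) (ξ 1) (φ 1) x μ ν]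

/-! ### The free theory -/

/-- Linearised Riemann tensor
`-½ (∂_a∂_c h_{bd} + ∂_b∂_d h_{ac} - ∂_a∂_d h_{bc} - ∂_b∂_c h_{ad})`. -/
def linRiemann (h : TensorField) (a b c d : Fin 4) : ScalarField := fun x =>
  -(1 / 2) * (pd a (pd c fun y => h y b d) x + pd b (pd d fun y => h y a c) x
    - pd a (pd d fun y => h y b c) x - pd b (pd c fun y => h y a d) x)

/-- Linearised Ricci tensor `η^{cd} R_{dacb}`. -/
def linRicci (h : TensorField) (a b : Fin 4) : ScalarField := fun x =>
  ∑ c, ∑ d, mink c d * linRiemann h d a c b x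

/-- Linearised scalar curvature. -/
def linScalar (h : TensorField) : ScalarField := fun x =>
  ∑ a, ∑ b, mink a b * linRicci h a b x

/-- Linearised Schouten tensor. -/
def linSchouten (h : TensorField) (a b : Fin 4) : ScalarField := fun x =>
  (1 / 2) * (linRicci h a b x - (1 / 6) * mink a b * linScalar h x)

/-- Linearised Weyl tensor
`R_{abcd} - (η_{ac} K_{db} - η_{ad} K_{cb} - η_{bc} K_{da} + η_{bd} K_{ca})`. -/
def linWeyl (h : TensorField) (a b c d : Fin 4) : ScalarField := fun x =>
  linRiemann h a b c d x -
    (mink a c * linSchouten h d b x - mink a d * linSchouten h c b x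
      - mink b c * linSchouten h d a x + mink b d * linSchouten h c a x)

/-- The full `η`-contraction `W[h]_{abcd} W[h']^{abcd}`; the indices are raised with the
diagonal matrix `η`. -/
def weylContract (h h' : TensorField) : ScalarField := fun x =>
  ∑ a, ∑ b, ∑ c, ∑ d, mink a a * mink b b * mink c c * mink d d *
    (linWeyl h a b c d x * linWeyl h' a b c d x)

/-- The off-diagonal metric `k_{ab}` in the internal space of the two fields. -/
def internalMetric : Matrix (Fin 2) (Fin 2) ℝ := !![0, 1; 1, 0]

/-- The free action `½ k_{ab} ∫ W^a_{αβγδ} W^{b αβγδ}`. -/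
def freeAction (k : Matrix (Fin 2) (Fin 2) ℝ) (h : Fin 2 → TensorField) : ℝ :=
  (1 / 2) * ∑ a, ∑ b, k a b * ∫ x, weylContract (h a) (h b) x

/-- The linear gauge transformations
`δh^a_{μν} = ∂_μ ξ^a_ν + ∂_ν ξ^a_μ + 2 φ^a η_{μν}` of the free theory. -/
def freeGaugeVar (ξ : Fin 2 → CovectorField) (φ : Fin 2 → ScalarField) :
    Fin 2 → TensorField := fun a x => Matrix.of fun μ ν =>
  pd μ (fun y => ξ a y ν) x + pd ν (fun y => ξ a y μ) x + 2 * φ a x * mink μ ν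

/-! ### Cross-interactions -/

/-- Change of basis in the internal space: `h^a = M^a_b u^b`. -/
def mix (M : Matrix (Fin 2) (Fin 2) ℝ) (u : Fin 2 → TensorField) : Fin 2 → TensorField :=
  fun a x => ∑ b, M a b • u b x

/-- The theory with coupling `α` decouples in the internal basis given by `M`: on compactly
supported fields the action is a sum of two functionals of one field each. -/
def DecouplesIn (α : ℝ) (M : Matrix (Fin 2) (Fin 2) ℝ) : Prop :=
  ∃ F G : TensorField → ℝ, ∀ u : Fin 2 → TensorField,
    (∀ a, IsSymmField (u a)) → (∀ a, HasCompactSupport (u a)) → Admissible α (mix M u) →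
      action α Set.univ (mix M u) = F (u 0) + G (u 1)

end WeylGravitons

end

/-!
The theory is the formal derivative of Weyl gravity. On metrics `g` the functional
`4 ∫ √-g (K_{ab} K^{ab} - κ²)`, with `κ = g^{ab} K_{ab}`, differs from the Weyl action
`½ ∫ √-g W²` only by the Gauss–Bonnet term, and its first variation in the direction `h²` is
`∫ √-g h²_{ab} B^{ab}`. So `S_α[h¹, h²]` is the derivative at `t = 0` of that functional along
`g_t = η + α h¹ + t h²`, and each assertion is read off from this.

*First variation.* The identity `4 δ(√-g (|K|² - κ²)) = √-g h_{ab} B^{ab} + ∂_a J^a` is purely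
algebraic. It is proved in `Variation.first_variation` for a `Geom`, a metric geometry over a
commutative ring with four commuting derivations, where all tensor identities are polynomial
identities. The currents `J` are linear in `h` and its derivatives, which is recorded by
membership in differential ideals; for smooth functions the ideal consists of the functions
vanishing outside a compact set, and exact elements integrate to zero (`integral_exact`).

*Gauge invariance.* The variation `δh` is the action of one family of infinitesimal
diffeomorphisms and Weyl rescalings, with parameters `α ξ¹ + t ξ²` and `α φ¹ + t φ²`, on the line
`g_t`. Deform that line to a two-parameter family `g_{s,t}` whose `s`-derivative at `s = 0` is this
transformation, for every `t`. The derivative of the action is then the mixed derivative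
`∂_s ∂_t` of the functional; taking `∂_s` first gives zero for every `t`, because the Lagrangian
is a scalar density (`Variation.lag'_lie`) and the Bach tensor is trace free (`Geom.bac_trace`).
The parameters enter only through `r sin(s / r)`, which keeps the whole family nondegenerate. The
statement over a region `U` follows by cutting off `h²` outside the supports of the gauge
parameters (`gauge_invariance`).

*Free limit.* Along `η + s h¹ + t h²` the curvature vanishes at `s = t = 0`, so the mixed derivative
there is `8 ∫ (K¹_{ab} K^{2 ab} - κ¹ κ²)` in the linearised Schouten tensors. That equals
`∫ W¹ · W²`, since the linearised Gauss–Bonnet density is a total derivative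
(`gaussBonnet_exact`, `integral_weylContract`).

*Cross-interactions.* Suppose that the theory decouples in the basis `M = (a b; c d)`, and let `v`
be a field with `∫ W[v] · W[v] ≠ 0` (`exists_weylContract_ne_zero`). The mixed terms of second
order on the background `η` give `a d + b c = 0`, so no entry of `M` vanishes. On a background
which is conformally flat and equal to `2 η` on the support of `v`, the quadratic action of `v` is
known from the weight of the Bach tensor under constant rescalings and from its trace-freeness;
as a decoupled theory cannot notice the background produced by the other field, comparison with
the background `η` gives `(d - b c / (2 a)) / 4 = d`, hence `d = 0`, a contradiction.
-/

set_option linter.unusedSectionVars false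

noncomputable section

namespace WeylGravitons

section

/-! ### Metric geometry over a differential ring -/

theorem sum_comm21 {B : Type*} [AddCommMonoid B] (f : Fin 4 → Fin 4 → Fin 4 → B) :
    ∑ a, ∑ b, ∑ c, f a b c = ∑ c, ∑ a, ∑ b, f a b c :=
  (Finset.sum_congr rfl fun _ _ => Finset.sum_comm).trans Finset.sum_comm

theorem sum_comm22 {B : Type*} [AddCommMonoid B] (f : Fin 4 → Fin 4 → Fin 4 → Fin 4 → B) :
    ∑ a, ∑ b, ∑ c, ∑ d, f a b c d = ∑ c, ∑ d, ∑ a, ∑ b, f a b c d :=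
  (sum_comm21 _).trans (Finset.sum_congr rfl fun _ _ => sum_comm21 _)

variable {A : Type*} [CommRing A] [Algebra ℝ A] {D : Fin 4 → Derivation ℝ A A}

/-- `∇_c w_a`. -/
def nab1 (D : Fin 4 → Derivation ℝ A A) (Γ : Fin 4 → Fin 4 → Fin 4 → A) (w : Fin 4 → A)
    (c a : Fin 4) : A :=
  D c (w a) - ∑ e, Γ e c a * w e

/-- `∇_c t_{ab}`. -/
def nab2 (D : Fin 4 → Derivation ℝ A A) (Γ : Fin 4 → Fin 4 → Fin 4 → A) (t : Fin 4 → Fin 4 → A)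
    (c a b : Fin 4) : A :=
  D c (t a b) - (∑ e, Γ e c a * t e b) - ∑ e, Γ e c b * t a e

/-- `∇_d t_{abc}`. -/
def nab3 (D : Fin 4 → Derivation ℝ A A) (Γ : Fin 4 → Fin 4 → Fin 4 → A)
    (t : Fin 4 → Fin 4 → Fin 4 → A) (d a b c : Fin 4) : A :=
  D d (t a b c) - (∑ e, Γ e d a * t e b c) - (∑ e, Γ e d b * t a e c) - ∑ e, Γ e d c * t a b e

/-- `∇_c k^{ab}`. -/
def nabUp (D : Fin 4 → Derivation ℝ A A) (Γ : Fin 4 → Fin 4 → Fin 4 → A) (k : Fin 4 → Fin 4 → A)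
    (c a b : Fin 4) : A :=
  D c (k a b) + (∑ e, Γ a c e * k e b) + ∑ e, Γ b c e * k a e

/-- The Riemann tensor `R^a_{bcd}` of the connection `Γ`. -/
def riemD (D : Fin 4 → Derivation ℝ A A) (Γ : Fin 4 → Fin 4 → Fin 4 → A) (a b c d : Fin 4) : A :=
  (D c (Γ a b d) + ∑ e, Γ a c e * Γ e b d) - (D d (Γ a b c) + ∑ e, Γ a d e * Γ e b c)

/-- The Ricci tensor of the connection `Γ`. -/
def ricD (D : Fin 4 → Derivation ℝ A A) (Γ : Fin 4 → Fin 4 → Fin 4 → A) (a b : Fin 4) : A :=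
  ∑ c, riemD D Γ c a c b

/-- The full contraction `G^{ab} t_{ab}`. -/
def tr2 (G t : Fin 4 → Fin 4 → A) : A := ∑ a, ∑ b, G a b * t a b

/-- Both indices raised: `t^{ab} = G^{ap} G^{bq} t_{pq}`. -/
def up2 (G t : Fin 4 → Fin 4 → A) (a b : Fin 4) : A := ∑ p, ∑ q, G a p * G b q * t p q

/-- A metric geometry in a commutative ring with four commuting derivations `D a`, presented by
its characteristic properties: the metric `g` and its inverse `G`, the torsion-free metric
connection `Γ`, the Schouten tensor `K`, determined by `R_{ab} = 2 K_{ab} + κ g_{ab}` with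
`κ = G^{ab} K_{ab}`, and the volume density `s`. No division is needed in this form. Indices of
`Γ a b c` are as in `Γ^a_{bc}`, and `D a s = s Γ^e_{ea}` is the logarithmic derivative of `√-g`. -/
structure Geom (D : Fin 4 → Derivation ℝ A A) where
  g : Fin 4 → Fin 4 → A
  G : Fin 4 → Fin 4 → A
  Γ : Fin 4 → Fin 4 → Fin 4 → A
  K : Fin 4 → Fin 4 → A
  s : A
  comm : ∀ a b x, D a (D b x) = D b (D a x)
  g_symm : ∀ a b, g a b = g b a
  G_symm : ∀ a b, G a b = G b a
  gG : ∀ a b, ∑ e, g a e * G e b = if a = b then 1 else 0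
  Γ_symm : ∀ a b c, Γ a b c = Γ a c b
  compat : ∀ c a b, D c (g a b) = (∑ e, Γ e c a * g e b) + ∑ e, Γ e c b * g a e
  schout : ∀ a b, ricD D Γ a b = 2 * K a b + tr2 G K * g a b
  Ds : ∀ a, D a s = s * ∑ e, Γ e e a
  s_unit : IsUnit s

namespace Geom

theorem two_unit : IsUnit (2 : A) := by
  have : (2 : A) = algebraMap ℝ A 2 := (map_ofNat _ 2).symm
  rw [this]
  exact (IsUnit.mk0 (2 : ℝ) two_ne_zero).map _

theorem two_cancel {x y : A} (h : 2 * x = 2 * y) : x = y := two_unit.mul_left_cancel h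

theorem D_ofNat (d : Derivation ℝ A A) (n : ℕ) [n.AtLeastTwo] :
    d (OfNat.ofNat n : A) = 0 := d.map_natCast n

theorem D_two (d : Derivation ℝ A A) : d (2 : A) = 0 := D_ofNat d 2

theorem D_four (d : Derivation ℝ A A) : d (4 : A) = 0 := D_ofNat d 4

theorem D_six (d : Derivation ℝ A A) : d (6 : A) = 0 := D_ofNat d 6

variable (S : Geom D)

/-- The trace `κ = G^{ab} K_{ab}`. -/
def κ : A := tr2 S.G S.K

theorem Gg (a b : Fin 4) : ∑ e, S.G a e * S.g e b = if a = b then 1 else 0 := by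
  have := S.gG b a
  rw [show (if a = b then (1 : A) else 0) = if b = a then 1 else 0 by simp [eq_comm], ← this]
  exact Finset.sum_congr rfl fun e _ => by rw [S.G_symm, S.g_symm, mul_comm]

/-- Lowering a raised index. -/
theorem lower_raise (w : Fin 4 → A) (a : Fin 4) : ∑ e, S.g a e * ∑ f, S.G e f * w f = w a := by
  simp only [Finset.mul_sum, ← mul_assoc]
  rw [Finset.sum_comm]
  simp only [← Finset.sum_mul, S.gG]
  simp

/-- Raising a lowered index. -/
theorem raise_lower (w : Fin 4 → A) (a : Fin 4) : ∑ e, S.G a e * ∑ f, S.g e f * w f = w a := by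
  simp only [Finset.mul_sum, ← mul_assoc]
  rw [Finset.sum_comm]
  simp only [← Finset.sum_mul, S.Gg]
  simp

/-- Metric compatibility for the inverse metric. -/
theorem compat_inv (c a b : Fin 4) :
    D c (S.G a b) = -(∑ e, S.Γ a c e * S.G e b) - ∑ e, S.Γ b c e * S.G a e := by
  -- differentiate `G^{ae} g_{ef} = δ^a_f` and contract with `G^{fb}`
  have h1 : ∀ f, ∑ e, S.g f e * D c (S.G a e) = -∑ e, S.G a e * D c (S.g e f) := by
    intro f
    have := congrArg (D c) (S.Gg a f)
    rw [map_sum] at this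
    have h0 : D c (if a = f then (1 : A) else 0) = 0 := by split_ifs <;> simp
    rw [h0] at this
    simp only [Derivation.leibniz, smul_eq_mul, Finset.sum_add_distrib] at this
    rw [← sub_eq_zero, sub_neg_eq_add, ← this, add_comm]
    simp only [S.g_symm f]
  rw [← S.raise_lower (fun e => D c (S.G a e)) b]
  simp only [h1, S.compat]
  have h2 := fun x => S.Gg a x
  have h3 := fun x => S.gG x b
  have e1 : ∀ f, ∑ e, S.G a e * ((∑ x, S.Γ x c e * S.g x f) + ∑ x, S.Γ x c f * S.g e x)
      = (∑ x, S.g f x * ∑ e, S.Γ x c e * S.G e a) + S.Γ a c f := by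
    intro f
    have : S.Γ a c f = ∑ x, (∑ e, S.G a e * S.g e x) * S.Γ x c f := by simp [h2]
    rw [this]
    simp only [Fin.sum_univ_four, S.g_symm f, S.G_symm _ a]
    ring
  simp only [e1]
  simp only [neg_add, mul_add, Finset.sum_add_distrib, mul_neg, Finset.sum_neg_distrib]
  rw [S.raise_lower (fun x => ∑ e, S.Γ x c e * S.G e a)]
  simp only [S.G_symm _ b, S.G_symm _ a, mul_comm]
  ring

theorem nab2_g (c a b : Fin 4) : nab2 D S.Γ S.g c a b = 0 := by
  rw [nab2, S.compat]; ring

theorem Γ_trace_symm (a b : Fin 4) : D a (∑ e, S.Γ e e b) = D b (∑ e, S.Γ e e a) := by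
  have h := S.comm a b S.s
  rw [S.Ds, S.Ds, Derivation.leibniz, Derivation.leibniz, S.Ds, S.Ds] at h
  simp only [smul_eq_mul] at h
  apply S.s_unit.mul_left_cancel
  linear_combination h

theorem ric_symm (a b : Fin 4) : ricD D S.Γ a b = ricD D S.Γ b a := by
  have h := S.Γ_trace_symm a b
  simp only [map_sum] at h
  have key : ∀ x y, ricD D S.Γ x y = (∑ c, D c (S.Γ c x y)) - (∑ e, D y (S.Γ e e x))
      + (∑ e, (∑ c, S.Γ c c e) * S.Γ e x y) - ∑ c, ∑ e, S.Γ c y e * S.Γ e x c := by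
    intro x y
    simp only [ricD, riemD, Finset.sum_sub_distrib, Finset.sum_add_distrib, Finset.sum_mul]
    rw [Finset.sum_comm (f := fun e c => S.Γ c c e * S.Γ e x y)]
    simp only [S.Γ_symm _ x]
    ring
  rw [key, key, h]
  have e1 : ∑ c, ∑ e, S.Γ c b e * S.Γ e a c = ∑ c, ∑ e, S.Γ c a e * S.Γ e b c := by
    rw [Finset.sum_comm]
    exact Finset.sum_congr rfl fun _ _ => Finset.sum_congr rfl fun _ _ => mul_comm _ _
  rw [e1]
  simp only [S.Γ_symm _ a b]

theorem K_symm (a b : Fin 4) : S.K a b = S.K b a := by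
  have h := S.ric_symm a b
  rw [S.schout, S.schout, S.g_symm a b] at h
  exact two_cancel (by linear_combination h)

theorem riem_antisymm_last (a b c d : Fin 4) : riemD D S.Γ a b c d = -riemD D S.Γ a b d c := by
  simp only [riemD]; ring

theorem riem_antisymm_first (a b c d : Fin 4) :
    ∑ e, S.g a e * riemD D S.Γ e b c d = -∑ e, S.g b e * riemD D S.Γ e a c d := by
  have h := S.comm c d (S.g a b)
  rw [S.compat, S.compat] at h
  simp only [map_add, map_sum, Derivation.leibniz, smul_eq_mul, S.compat] at h
  simp only [riemD]
  simp only [Fin.sum_univ_four, S.g_symm 1 0, S.g_symm 2 0, S.g_symm 3 0, S.g_symm 2 1,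
    S.g_symm 3 1, S.g_symm 3 2, S.g_symm a, S.g_symm b, S.Γ_symm _ a, S.Γ_symm _ b] at h ⊢
  linear_combination h

theorem sum_ite_trace : ∑ a, ∑ b, S.G a b * S.g a b = 4 := by
  have : ∀ a, ∑ b, S.G a b * S.g a b = 1 := fun a => by
    have := S.Gg a a
    simpa [S.g_symm] using this
  simp [this]

/-- The trace of a covariant derivative is the covariant derivative of the trace. -/
theorem tr2_nab2 (t : Fin 4 → Fin 4 → A) (c : Fin 4) :
    ∑ a, ∑ b, S.G a b * nab2 D S.Γ t c a b = D c (tr2 S.G t) := by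
  simp only [tr2, map_sum, Derivation.leibniz, smul_eq_mul, S.compat_inv, nab2]
  simp only [Fin.sum_univ_four]
  ring

/-- The trace of a covariant derivative over the first two indices of a rank-three tensor. -/
theorem tr_nab3 (t : Fin 4 → Fin 4 → Fin 4 → A) (d c : Fin 4) :
    ∑ a, ∑ b, S.G a b * nab3 D S.Γ t d a b c
      = nab1 D S.Γ (fun c => ∑ a, ∑ b, S.G a b * t a b c) d c := by
  simp only [nab1, map_sum, Derivation.leibniz, smul_eq_mul, S.compat_inv, nab3]
  simp only [Fin.sum_univ_four]
  ring

/-! ### Bianchi identities and the Bach tensor -/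

set_option maxRecDepth 4000 in
/-- The second Bianchi identity, differentiating only the matrix indices of the curvature
(the remaining Christoffel terms cancel in the cyclic sum). -/
theorem bianchi (a b c d e : Fin 4) :
    let R := riemD D S.Γ
    (D e (R a b c d) + (∑ f, S.Γ a e f * R f b c d) - ∑ f, S.Γ f e b * R a f c d)
    + (D c (R a b d e) + (∑ f, S.Γ a c f * R f b d e) - ∑ f, S.Γ f c b * R a f d e)
    + (D d (R a b e c) + (∑ f, S.Γ a d f * R f b e c) - ∑ f, S.Γ f d b * R a f e c) = 0 := by
  intro R
  simp only [R, riemD, map_add, map_sub, map_sum, Derivation.leibniz, smul_eq_mul,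
    S.comm e c, S.comm e d, S.comm c d]
  simp only [Fin.sum_univ_four, S.Γ_symm]
  ring

/-- The once contracted Bianchi identity `∇_e R_{bd} - ∇_d R_{be} + ∇_a R^a_{bde} = 0`. -/
theorem bianchi_contracted (b d e : Fin 4) :
    let R := riemD D S.Γ
    nab2 D S.Γ (ricD D S.Γ) e b d - nab2 D S.Γ (ricD D S.Γ) d b e
      + ∑ a, (D a (R a b d e) + (∑ f, S.Γ a a f * R f b d e) - (∑ f, S.Γ f a b * R a f d e)
        - (∑ f, S.Γ f a d * R a b f e) - ∑ f, S.Γ f a e * R a b d f) = 0 := by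
  intro R
  have h := Finset.sum_congr rfl fun a (_ : a ∈ Finset.univ) => S.bianchi a b a d e
  rw [Finset.sum_const_zero] at h
  have hR : ∀ x y z w, riemD D S.Γ x y z w = R x y z w := fun _ _ _ _ => rfl
  have hR' : ∀ x y z w, R x y w z = - R x y z w := fun _ _ _ _ => S.riem_antisymm_last _ _ _ _
  simp only [hR, nab2, ricD, map_sum] at h ⊢
  simp only [Fin.sum_univ_four, hR' _ _ 0 e, hR' _ _ 1 e, hR' _ _ 2 e,
    hR' _ _ 3 e, hR' _ _ 0 d, hR' _ _ 1 d, hR' _ _ 2 d, hR' _ _ 3 d, map_neg,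
    S.Γ_symm] at h ⊢
  linear_combination h

/-- The trace `g^{bd} R^a_{bde} = -R^a_e`, from the antisymmetry of the first index pair. -/
theorem riem_trace (a e : Fin 4) :
    ∑ b, ∑ d, S.G b d * riemD D S.Γ a b d e = -∑ c, S.G a c * ricD D S.Γ c e := by
  have h1 : ∀ b d, riemD D S.Γ a b d e
      = -∑ c, S.G a c * ∑ f, S.g b f * riemD D S.Γ f c d e := by
    intro b d
    rw [← S.raise_lower (fun f => riemD D S.Γ f b d e) a]
    simp only [S.riem_antisymm_first _ b, mul_neg, Finset.sum_neg_distrib]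
  have h2 : ∀ c, ricD D S.Γ c e
      = ∑ b, ∑ d, S.G b d * ∑ f, S.g b f * riemD D S.Γ f c d e := by
    intro c
    rw [Finset.sum_comm]
    refine Finset.sum_congr rfl fun d _ => ?_
    rw [← S.raise_lower (fun f => riemD D S.Γ f c d e) d]
    simp only [S.G_symm d]
  simp only [h1, h2]
  generalize (fun b c d => ∑ f, S.g b f * riemD D S.Γ f c d e) = Q
  simp only [Fin.sum_univ_four]
  ring

theorem trace_div_riem (a e : Fin 4) :
    ∑ b, ∑ d, S.G b d * (D a (riemD D S.Γ a b d e)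
        + (∑ f, S.Γ a a f * riemD D S.Γ f b d e)
        - (∑ f, S.Γ f a b * riemD D S.Γ a f d e)
        - (∑ f, S.Γ f a d * riemD D S.Γ a b f e) - ∑ f, S.Γ f a e * riemD D S.Γ a b d f)
      = -(D a (∑ c, S.G a c * ricD D S.Γ c e)
        + (∑ f, S.Γ a a f * ∑ c, S.G f c * ricD D S.Γ c e)
        - ∑ f, S.Γ f a e * ∑ c, S.G a c * ricD D S.Γ c f) := by
  have h := fun a e => S.riem_trace a e
  generalize riemD D S.Γ = R at *
  have h' : ∀ a e, ∑ c, S.G a c * ricD D S.Γ c e = -∑ b, ∑ d, S.G b d * R a b d e :=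
    fun a e => by rw [h, neg_neg]
  simp only [h', map_neg, map_sum, Derivation.leibniz, smul_eq_mul, S.compat_inv]
  simp only [Fin.sum_univ_four]
  ring

theorem div_ric_mixed (e : Fin 4) :
    ∑ a, (D a (∑ c, S.G a c * ricD D S.Γ c e)
        + (∑ f, S.Γ a a f * ∑ c, S.G f c * ricD D S.Γ c e)
        - ∑ f, S.Γ f a e * ∑ c, S.G a c * ricD D S.Γ c f)
      = ∑ b, ∑ d, S.G b d * nab2 D S.Γ (ricD D S.Γ) d b e := by
  generalize ricD D S.Γ = R
  simp only [nab2, map_sum, Derivation.leibniz, smul_eq_mul, S.compat_inv]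
  simp only [Fin.sum_univ_four, S.G_symm, S.Γ_symm]
  ring

/-- Twice the divergence of the Ricci tensor is the gradient of the scalar curvature. -/
theorem div_ric (e : Fin 4) :
    2 * ∑ b, ∑ d, S.G b d * nab2 D S.Γ (ricD D S.Γ) d b e = D e (tr2 S.G (ricD D S.Γ)) := by
  have h3 := Finset.sum_congr rfl fun a (_ : a ∈ Finset.univ) => S.trace_div_riem a e
  rw [Finset.sum_neg_distrib, S.div_ric_mixed] at h3
  have h4 : ∑ b, ∑ d, S.G b d * (nab2 D S.Γ (ricD D S.Γ) d b e - nab2 D S.Γ (ricD D S.Γ) e b d)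
      = -∑ b, ∑ d, S.G b d * nab2 D S.Γ (ricD D S.Γ) d b e := by
    rw [← h3, eq_comm, Finset.sum_comm]
    refine Finset.sum_congr rfl fun b _ => ?_
    rw [Finset.sum_comm]
    refine Finset.sum_congr rfl fun d _ => ?_
    rw [← Finset.mul_sum]
    congr 1
    linear_combination S.bianchi_contracted b d e
  simp only [mul_sub, Finset.sum_sub_distrib, S.tr2_nab2] at h4
  linear_combination h4

/-- The contracted Bianchi identity `∇^b K_{bc} = ∂_c κ`. -/
theorem div_schouten (c : Fin 4) :
    ∑ a, ∑ b, S.G a b * nab2 D S.Γ S.K b a c = D c S.κ := by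
  have h := S.div_ric c
  have h1 : tr2 S.G (ricD D S.Γ) = 6 * S.κ := by
    have := S.sum_ite_trace
    simp only [tr2, S.schout, mul_add, Finset.sum_add_distrib, mul_left_comm _ (2 : A),
      mul_left_comm _ (∑ a, ∑ b, S.G a b * S.K a b), ← Finset.mul_sum, this, κ]
    ring
  have h2 : ∀ d b, nab2 D S.Γ (ricD D S.Γ) d b c
      = 2 * nab2 D S.Γ S.K d b c + D d S.κ * S.g b c := by
    intro d b
    have := S.nab2_g d b c
    have e : ∀ x y, ricD D S.Γ x y = 2 * S.K x y + S.κ * S.g x y := S.schout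
    simp only [nab2, e, map_add, Derivation.leibniz, smul_eq_mul, D_two,
      Fin.sum_univ_four] at this ⊢
    linear_combination S.κ * this
  have h3 : ∑ b, ∑ d, S.G b d * (D d S.κ * S.g b c) = D c S.κ := by
    rw [Finset.sum_comm]
    have : ∀ d, ∑ b, S.G b d * (D d S.κ * S.g b c) = D d S.κ * ∑ b, S.G d b * S.g b c := by
      intro d
      rw [Finset.mul_sum]
      exact Finset.sum_congr rfl fun b _ => by rw [S.G_symm b d]; ring
    simp [this, S.Gg]
  simp only [h1, h2, mul_add, Finset.sum_add_distrib, h3, mul_left_comm _ (2 : A),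
    ← Finset.mul_sum, Derivation.leibniz, smul_eq_mul, D_six] at h
  apply two_cancel
  apply two_cancel
  linear_combination h

/-- The Cotton tensor `C_{abc} = ∇_c K_{ba} - ∇_b K_{ca}`. -/
def cot (a b c : Fin 4) : A := nab2 D S.Γ S.K c b a - nab2 D S.Γ S.K b c a

theorem nab2_K_symm (c a b : Fin 4) : nab2 D S.Γ S.K c a b = nab2 D S.Γ S.K c b a := by
  simp only [nab2, Fin.sum_univ_four, S.K_symm]
  ring

theorem cot_trace (c : Fin 4) : ∑ a, ∑ b, S.G a b * S.cot a b c = 0 := by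
  have h2 := S.div_schouten c
  have h1 : ∑ a, ∑ b, S.G a b * nab2 D S.Γ S.K c b a = D c S.κ := by
    rw [κ, ← S.tr2_nab2]
    exact Finset.sum_congr rfl fun a _ => Finset.sum_congr rfl fun b _ => by
      rw [S.nab2_K_symm]
  have h3 : ∑ a, ∑ b, S.G a b * nab2 D S.Γ S.K b c a = D c S.κ := by
    rw [← h2]
    exact Finset.sum_congr rfl fun a _ => Finset.sum_congr rfl fun b _ => by
      rw [S.nab2_K_symm]
  simp only [cot, mul_sub, Finset.sum_sub_distrib, h1, h3, sub_self]

/-- The Weyl tensor, first index raised. -/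
def wey (a b c d : Fin 4) : A :=
  riemD D S.Γ a b c d -
    ((if a = c then 1 else 0) * S.K d b - (if a = d then 1 else 0) * S.K c b
      - S.g b c * (∑ e, S.G a e * S.K d e) + S.g b d * (∑ e, S.G a e * S.K c e))

/-- The Weyl tensor, all indices down. -/
def weyLow (a b c d : Fin 4) : A := ∑ e, S.g a e * S.wey e b c d

/-- The Bach tensor. -/
def bac (a b : Fin 4) : A :=
  -2 * ((∑ c, ∑ d, S.G c d * nab3 D S.Γ S.cot d a b c)
    + ∑ c, ∑ d, ∑ p, ∑ q, S.G c p * S.G d q * S.K p q * S.weyLow a c b d)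

theorem wey_trace (b d : Fin 4) : ∑ a, S.wey a b a d = 0 := by
  have h := S.schout b d
  simp only [ricD] at h
  simp only [wey, Finset.sum_sub_distrib, Finset.sum_add_distrib, h]
  have h1 : ∑ a, S.g b a * ∑ e, S.G a e * S.K d e = S.K d b := S.lower_raise _ _
  have h2 : ∑ a, S.g b d * ∑ e, S.G a e * S.K a e = S.g b d * S.κ := by
    rw [← Finset.mul_sum]; rfl
  rw [h1, h2]
  simp only [if_true, one_mul, Finset.sum_const, Finset.card_univ, Fintype.card_fin, ite_mul,
    zero_mul, Finset.sum_ite_eq', Finset.mem_univ, S.K_symm d b, κ, nsmul_eq_mul]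
  push_cast
  ring

/-- The Bach tensor is trace-free. -/
theorem bac_trace : ∑ a, ∑ b, S.G a b * S.bac a b = 0 := by
  have h1 : ∑ a, ∑ b, S.G a b * ∑ c, ∑ d, S.G c d * nab3 D S.Γ S.cot d a b c = 0 := by
    have : ∑ a, ∑ b, S.G a b * ∑ c, ∑ d, S.G c d * nab3 D S.Γ S.cot d a b c
        = ∑ c, ∑ d, S.G c d * ∑ a, ∑ b, S.G a b * nab3 D S.Γ S.cot d a b c := by
      simp only [Finset.mul_sum]
      rw [sum_comm22]
      simp only [mul_left_comm]
    rw [this]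
    simp [S.tr_nab3, S.cot_trace, nab1]
  have h2 : ∀ c d, ∑ a, ∑ b, S.G a b * S.weyLow a c b d = 0 := by
    intro c d
    rw [Finset.sum_comm]
    have : ∀ b, ∑ a, S.G a b * S.weyLow a c b d = S.wey b c b d := fun b => by
      simp only [S.G_symm _ b, weyLow, S.raise_lower (fun e => S.wey e c b d)]
    simp [this, S.wey_trace]
  have h3 : ∑ a, ∑ b, S.G a b * ∑ c, ∑ d, ∑ p, ∑ q, S.G c p * S.G d q * S.K p q * S.weyLow a c b d
      = 0 := by
    have : ∑ a, ∑ b, S.G a b * ∑ c, ∑ d, ∑ p, ∑ q, S.G c p * S.G d q * S.K p q * S.weyLow a c b d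
        = ∑ c, ∑ d, (∑ p, ∑ q, S.G c p * S.G d q * S.K p q) * ∑ a, ∑ b, S.G a b * S.weyLow a c b d := by
      simp only [← Finset.sum_mul]
      generalize hU : (fun c d => ∑ p, ∑ q, S.G c p * S.G d q * S.K p q) = U
      replace hU : ∀ c d, ∑ p, ∑ q, S.G c p * S.G d q * S.K p q = U c d := fun c d => by rw [← hU]
      simp only [hU, Finset.mul_sum]
      rw [sum_comm22]
      simp only [mul_left_comm]
    simp [this, h2]
  have : ∀ a b, S.G a b * S.bac a b = -2 * (S.G a b * (∑ c, ∑ d, S.G c d * nab3 D S.Γ S.cot d a b c)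
      + S.G a b * ∑ c, ∑ d, ∑ p, ∑ q, S.G c p * S.G d q * S.K p q * S.weyLow a c b d) := by
    intro a b; rw [bac]; ring
  simp only [this, ← Finset.mul_sum _ _ (-2 : A), Finset.sum_add_distrib, h1, h3]
  simp

end Geom

end

section

variable {A : Type*} [CommRing A] [Algebra ℝ A] {D : Fin 4 → Derivation ℝ A A}

namespace Geom

variable (S : Geom D)

/-! ### Commuting covariant derivatives -/

set_option maxRecDepth 4000 in
/-- The Ricci identity for a covariant rank-two tensor. -/
theorem ricci_identity (t : Fin 4 → Fin 4 → A) (d a c b : Fin 4) :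
    nab3 D S.Γ (nab2 D S.Γ t) d a c b - nab3 D S.Γ (nab2 D S.Γ t) a d c b
      = -(∑ e, riemD D S.Γ e c d a * t e b) - ∑ e, riemD D S.Γ e b d a * t c e := by
  simp only [nab3, nab2, riemD, map_sub, map_sum, Derivation.leibniz, smul_eq_mul, S.comm d a]
  simp only [Fin.sum_univ_four, S.Γ_symm]
  ring

theorem schout' (a b : Fin 4) : ricD D S.Γ a b = 2 * S.K a b + S.κ * S.g a b := S.schout a b

/-- The square `(K²)_{ab} = G^{cd} K_{ac} K_{bd}` of the Schouten tensor. -/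
def KK (a b : Fin 4) : A := ∑ c, ∑ d, S.G c d * S.K a c * S.K b d

/-- The norm square `K_{ab} K^{ab}`. -/
def normK : A := tr2 (up2 S.G S.K) S.K

theorem normK_eq : S.normK = tr2 S.G S.KK := by
  simp only [normK, tr2, up2, KK, Finset.mul_sum, Finset.sum_mul]
  refine Finset.sum_congr rfl fun a _ => ?_
  rw [Finset.sum_comm]
  exact Finset.sum_congr rfl fun b _ => Finset.sum_congr rfl fun c _ =>
    Finset.sum_congr rfl fun d _ => by ring

theorem riem_eq_wey (a b c d : Fin 4) : riemD D S.Γ a b c d = S.wey a b c d +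
    ((if a = c then 1 else 0) * S.K d b - (if a = d then 1 else 0) * S.K c b
      - S.g b c * (∑ e, S.G a e * S.K d e) + S.g b d * (∑ e, S.G a e * S.K c e)) := by
  rw [wey]; ring

/-- Commuting the derivatives in `∇^c ∇_a K_{cb}`. -/
theorem div_nab_schouten (a b : Fin 4) :
    ∑ c, ∑ d, S.G c d * nab3 D S.Γ (nab2 D S.Γ S.K) d a c b
      = nab1 D S.Γ (fun c => D c S.κ) a b + 4 * S.KK a b - S.g a b * S.normK
        - ∑ c, ∑ d, S.G c d * ∑ e, S.K c e * S.wey e b d a := by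
  have h1 : ∑ c, ∑ d, S.G c d * nab3 D S.Γ (nab2 D S.Γ S.K) a d c b
      = nab1 D S.Γ (fun c => D c S.κ) a b := by
    simp only [← S.div_schouten]
    rw [← S.tr_nab3]
    exact Finset.sum_congr rfl fun d _ => Finset.sum_congr rfl fun c _ => by
      simp only [nab3]; ring
  have h2 : ∀ c d, nab3 D S.Γ (nab2 D S.Γ S.K) d a c b = nab3 D S.Γ (nab2 D S.Γ S.K) a d c b
      - (∑ e, riemD D S.Γ e c d a * S.K e b) - ∑ e, riemD D S.Γ e b d a * S.K c e := by
    intro c d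
    linear_combination S.ricci_identity S.K d a c b
  simp only [h2, mul_sub, Finset.sum_sub_distrib, h1]
  have h3 : ∑ c, ∑ d, S.G c d * ∑ e, riemD D S.Γ e c d a * S.K e b
      = -(2 * S.KK a b + S.κ * S.K a b) := by
    simp only [Finset.mul_sum, ← mul_assoc]
    rw [sum_comm21]
    simp only [← Finset.sum_mul, S.riem_trace]
    have : ∀ e, ∑ c, S.G e c * ricD D S.Γ c a
        = 2 * (∑ c, S.G e c * S.K c a) + S.κ * (if e = a then 1 else 0) := by
      intro e
      rw [← S.Gg]
      simp only [S.schout', Finset.mul_sum, ← Finset.sum_add_distrib]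
      exact Finset.sum_congr rfl fun c _ => by ring
    simp only [this]
    simp only [neg_mul, add_mul, Finset.sum_neg_distrib, Finset.sum_add_distrib, mul_ite, mul_one,
      mul_zero, ite_mul, zero_mul, Finset.sum_ite_eq', Finset.mem_univ, if_true]
    simp only [KK, Fin.sum_univ_four, S.G_symm, S.K_symm]
    ring
  have h4 : ∑ c, ∑ d, S.G c d * ∑ e, riemD D S.Γ e b d a * S.K c e
      = (∑ c, ∑ d, S.G c d * ∑ e, S.K c e * S.wey e b d a) + S.κ * S.K a b - 2 * S.KK a b
        + S.g a b * S.normK := by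
    have e1 : ∑ c, ∑ d, S.G c d * ∑ e, (if e = d then 1 else 0) * S.K a b * S.K c e
        = S.κ * S.K a b := by
      simp only [ite_mul, one_mul, zero_mul, Finset.sum_ite_eq', Finset.mem_univ, if_true, κ, tr2,
        Finset.sum_mul]
      exact Finset.sum_congr rfl fun c _ => Finset.sum_congr rfl fun d _ => by ring
    have e2 : ∑ c, ∑ d, S.G c d * ∑ e, (if e = a then 1 else 0) * S.K d b * S.K c e
        = S.KK a b := by
      simp only [ite_mul, one_mul, zero_mul, Finset.sum_ite_eq', Finset.mem_univ, if_true, KK]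
      exact Finset.sum_congr rfl fun c _ => Finset.sum_congr rfl fun d _ => by
        rw [S.K_symm c a, S.K_symm d b]; ring
    have e3 : ∑ c, ∑ d, S.G c d * ∑ e, S.g b d * (∑ f, S.G e f * S.K a f) * S.K c e
        = S.KK a b := by
      have : ∀ c d, S.G c d * ∑ e, S.g b d * (∑ f, S.G e f * S.K a f) * S.K c e
          = S.G c d * S.g d b * ∑ e, (∑ f, S.G e f * S.K a f) * S.K c e := by
        intro c d
        rw [Finset.mul_sum, Finset.mul_sum, S.g_symm]
        exact Finset.sum_congr rfl fun e _ => by ring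
      simp only [this, ← Finset.sum_mul, S.Gg, ite_mul, one_mul, zero_mul, Finset.sum_ite_eq',
        Finset.mem_univ, if_true, KK]
      rw [Finset.sum_comm]
      simp only [Finset.sum_mul]
      exact Finset.sum_congr rfl fun c _ => Finset.sum_congr rfl fun d _ => by
        rw [S.G_symm]
    have e4 : ∑ c, ∑ d, S.G c d * ∑ e, S.g b a * (∑ f, S.G e f * S.K d f) * S.K c e
        = S.g a b * S.normK := by
      rw [S.normK_eq, tr2, Finset.mul_sum]
      refine Finset.sum_congr rfl fun c _ => ?_
      rw [Finset.mul_sum]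
      refine Finset.sum_congr rfl fun d _ => ?_
      rw [S.g_symm b a, KK]
      simp only [Finset.mul_sum, Finset.sum_mul]
      exact Finset.sum_congr rfl fun c _ => Finset.sum_congr rfl fun d _ => by ring
    simp only [S.riem_eq_wey, add_mul, sub_mul, Finset.sum_add_distrib, Finset.sum_sub_distrib,
      mul_add, mul_sub, e1, e2, e3, e4]
    have e5 : ∀ c d, ∑ e, S.wey e b d a * S.K c e = ∑ e, S.K c e * S.wey e b d a :=
      fun c d => Finset.sum_congr rfl fun e _ => mul_comm _ _
    simp only [e5]
    ring
  rw [h3, h4]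
  ring

theorem weyLow_eq (a b c d : Fin 4) : S.weyLow a b c d = ∑ e, S.g a e * riemD D S.Γ e b c d
    - (S.g a c * S.K d b - S.g a d * S.K c b - S.g b c * S.K d a + S.g b d * S.K c a) := by
  have h1 := S.lower_raise (fun e => S.K d e) a
  have h2 := S.lower_raise (fun e => S.K c e) a
  have h3 : ∀ c, ∑ e, S.g a e * (if e = c then (1 : A) else 0) = S.g a c := by intro c; simp
  simp only [weyLow, wey, mul_sub, mul_add, Finset.sum_sub_distrib, Finset.sum_add_distrib,
    mul_left_comm (S.g a _) (S.g b _), ← mul_assoc (S.g a _) _ (S.K _ _), ← Finset.mul_sum,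
    ← Finset.sum_mul, h1, h2, h3]

theorem weyLow_antisymm_first (a b c d : Fin 4) : S.weyLow a b c d = -S.weyLow b a c d := by
  rw [weyLow_eq, weyLow_eq, S.riem_antisymm_first]; ring

theorem weyLow_antisymm_last (a b c d : Fin 4) : S.weyLow a b c d = -S.weyLow a b d c := by
  rw [weyLow_eq, weyLow_eq]
  simp only [S.riem_antisymm_last _ _ c d, mul_neg, Finset.sum_neg_distrib]
  ring

end Geom

/-! ### Total derivatives -/

/-- The elements `∑_a ∂_a J^a` with all `J^a` in the ideal `I`. -/
def Exact (D : Fin 4 → Derivation ℝ A A) (I : Ideal A) : Submodule ℝ A where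
  carrier := {f | ∃ J : Fin 4 → A, (∀ a, J a ∈ I) ∧ f = ∑ a, D a (J a)}
  add_mem' := by
    rintro _ _ ⟨J, hJ, rfl⟩ ⟨J', hJ', rfl⟩
    exact ⟨J + J', fun a => I.add_mem (hJ a) (hJ' a), by simp [Finset.sum_add_distrib]⟩
  zero_mem' := ⟨0, fun _ => I.zero_mem, by simp⟩
  smul_mem' := by
    rintro c _ ⟨J, hJ, rfl⟩
    exact ⟨c • J, fun a => Submodule.smul_of_tower_mem I c (hJ a), by simp [Finset.smul_sum]⟩

namespace Geom

variable (S : Geom D)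

/-- The covariant divergence of a covector field is a total derivative, `s` being the volume
density. -/
theorem exact_div {I : Ideal A} (w : Fin 4 → A) (hw : ∀ a, w a ∈ I) :
    S.s * ∑ p, ∑ b, S.G p b * nab1 D S.Γ w b p ∈ Exact D I := by
  refine ⟨fun b => S.s * ∑ p, S.G p b * w p, fun b => I.mul_mem_left _ (I.sum_mem fun p _ =>
    I.mul_mem_left _ (hw p)), ?_⟩
  simp only [nab1, map_sum, Derivation.leibniz, smul_eq_mul, S.compat_inv, S.Ds]
  simp only [Fin.sum_univ_four, S.G_symm, S.Γ_symm]
  ring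

theorem nab1_contract (Z : Fin 4 → Fin 4 → Fin 4 → A) (k : Fin 4 → Fin 4 → A) (b p : Fin 4) :
    nab1 D S.Γ (fun p => ∑ a, ∑ q, Z p a q * k a q) b p
      = ∑ a, ∑ q, (nab3 D S.Γ Z b p a q * k a q + Z p a q * nabUp D S.Γ k b a q) := by
  simp only [nab1, nab3, nabUp, map_sum, Derivation.leibniz, smul_eq_mul]
  simp only [Fin.sum_univ_four]
  ring

/-- Integration by parts of `Z^p_{aq} ∇_p k^{aq}`. -/
theorem exact_parts {I : Ideal A} (Z : Fin 4 → Fin 4 → Fin 4 → A) (k : Fin 4 → Fin 4 → A)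
    (h : ∀ p a q, Z p a q * k a q ∈ I) :
    S.s * (∑ p, ∑ b, S.G p b * ∑ a, ∑ q, Z p a q * nabUp D S.Γ k b a q)
      + S.s * (∑ p, ∑ b, S.G p b * ∑ a, ∑ q, nab3 D S.Γ Z b p a q * k a q) ∈ Exact D I := by
  have := S.exact_div (I := I) (fun p => ∑ a, ∑ q, Z p a q * k a q)
    fun p => I.sum_mem fun a _ => I.sum_mem fun q _ => h p a q
  simp only [S.nab1_contract, Finset.sum_add_distrib, mul_add] at this
  rwa [add_comm]

/-- Integration by parts of the contraction `X^{bd} ∇_d t_b`. -/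
theorem exact_div_up {I : Ideal A} (X : Fin 4 → Fin 4 → A) (t : Fin 4 → A) (ht : ∀ a, t a ∈ I) :
    S.s * (∑ b, ∑ d, nabUp D S.Γ X d b d * t b) + S.s * (∑ b, ∑ d, X b d * nab1 D S.Γ t d b)
      ∈ Exact D I := by
  refine ⟨fun d => S.s * ∑ b, X b d * t b, fun b => I.mul_mem_left _ (I.sum_mem fun p _ =>
    I.mul_mem_left _ (ht p)), ?_⟩
  simp only [nab1, nabUp, map_sum, Derivation.leibniz, smul_eq_mul, S.Ds]
  simp only [Fin.sum_univ_four, S.Γ_symm]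
  ring

theorem nabUp_up2 (t : Fin 4 → Fin 4 → A) (c a b : Fin 4) :
    nabUp D S.Γ (up2 S.G t) c a b = ∑ p, ∑ q, S.G a p * S.G b q * nab2 D S.Γ t c p q := by
  simp only [nabUp, nab2, up2, map_sum, Derivation.leibniz, smul_eq_mul, S.compat_inv]
  simp only [Fin.sum_univ_four]
  ring

end Geom

end

section

variable {A : Type*} [CommRing A] [Algebra ℝ A] {D : Fin 4 → Derivation ℝ A A}

/-! ### First variation of the action -/

/-- The first variation of the Ricci tensor under a variation `T` of the connection `Γ`. -/
def ricVar (D : Fin 4 → Derivation ℝ A A) (Γ T : Fin 4 → Fin 4 → Fin 4 → A) (b d : Fin 4) : A :=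
  ∑ a, ((D a (T a b d) + ∑ e, (T a a e * Γ e b d + Γ a a e * T e b d))
    - (D d (T a b a) + ∑ e, (T a d e * Γ e b a + Γ a d e * T e b a)))

/-- A first-order variation of a geometry, `δg = h`, `δΓ = T`, `δK = K'`, `δs = s'`, presented by
the linearised defining properties of `Γ`, `K` and `s`. -/
structure Variation (S : Geom D) where
  h : Fin 4 → Fin 4 → A
  T : Fin 4 → Fin 4 → Fin 4 → A
  K' : Fin 4 → Fin 4 → A
  s' : A
  h_symm : ∀ a b, h a b = h b a
  T_symm : ∀ a b c, T a b c = T a c b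
  compat' : ∀ c a b, nab2 D S.Γ h c a b = (∑ e, T e c a * S.g e b) + ∑ e, T e c b * S.g a e
  schout' : ∀ a b, ricVar D S.Γ T a b
    = 2 * K' a b + (tr2 S.G K' - tr2 (up2 S.G h) S.K) * S.g a b + S.κ * h a b
  vol' : 2 * s' = S.s * tr2 S.G h

theorem tr2_add (X Y Z : Fin 4 → Fin 4 → A) :
    tr2 X (fun a b => Y a b + Z a b) = tr2 X Y + tr2 X Z := by
  simp only [tr2, mul_add, Finset.sum_add_distrib]

theorem tr2_sub (X Y Z : Fin 4 → Fin 4 → A) :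
    tr2 X (fun a b => Y a b - Z a b) = tr2 X Y - tr2 X Z := by
  simp only [tr2, mul_sub, Finset.sum_sub_distrib]

theorem tr2_mul (X Y : Fin 4 → Fin 4 → A) (c : A) :
    tr2 X (fun a b => c * Y a b) = c * tr2 X Y := by
  simp only [tr2, Finset.mul_sum]
  exact Finset.sum_congr rfl fun a _ => Finset.sum_congr rfl fun b _ => by ring

theorem tr2_up2_comm (G t u : Fin 4 → Fin 4 → A) (hG : ∀ a b, G a b = G b a) :
    tr2 (up2 G t) u = tr2 (up2 G u) t := by
  simp only [tr2, up2, Finset.sum_mul]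
  rw [sum_comm22]
  exact Finset.sum_congr rfl fun a _ => Finset.sum_congr rfl fun b _ =>
    Finset.sum_congr rfl fun c _ => Finset.sum_congr rfl fun d _ => by
      rw [hG a, hG b]; ring

theorem up2_symm (G t : Fin 4 → Fin 4 → A) (ht : ∀ a b, t a b = t b a) (a b : Fin 4) :
    up2 G t a b = up2 G t b a := by
  simp only [up2]
  rw [Finset.sum_comm]
  exact Finset.sum_congr rfl fun c _ => Finset.sum_congr rfl fun d _ => by
      rw [ht d]; ring

/-- Contraction of two rank-three tensors with three inverse metrics. -/
def tri (G : Fin 4 → Fin 4 → A) (U V : Fin 4 → Fin 4 → Fin 4 → A) : A :=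
  ∑ p, ∑ a, G p a * ∑ b, ∑ d, U p b d * ∑ q, ∑ r, G b q * G d r * V a q r

theorem tri_eq (G : Fin 4 → Fin 4 → A) (hG : ∀ a b, G a b = G b a)
    (U V : Fin 4 → Fin 4 → Fin 4 → A) :
    tri G U V = ∑ a, ∑ b, ∑ c, (∑ p, ∑ q, ∑ r, G a p * G b q * G c r * U p q r) * V a b c := by
  simp only [tri, Finset.mul_sum, Finset.sum_mul]
  rw [Finset.sum_comm]
  refine Finset.sum_congr rfl fun a _ => ?_
  refine (Finset.sum_congr rfl fun p _ => sum_comm22 _).trans ?_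
  rw [Finset.sum_comm]
  refine Finset.sum_congr rfl fun q _ => ?_
  rw [Finset.sum_comm]
  refine Finset.sum_congr rfl fun r _ => Finset.sum_congr rfl fun p _ =>
    Finset.sum_congr rfl fun b _ => Finset.sum_congr rfl fun d _ => ?_
  rw [hG b, hG d, hG p]
  ring

theorem tri_comm (G : Fin 4 → Fin 4 → A) (hG : ∀ a b, G a b = G b a)
    (U V : Fin 4 → Fin 4 → Fin 4 → A) : tri G U V = tri G V U := by
  simp only [tri, Finset.mul_sum]
  rw [Finset.sum_comm]
  refine Finset.sum_congr rfl fun a _ => Finset.sum_congr rfl fun p _ => ?_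
  rw [sum_comm22]
  exact Finset.sum_congr rfl fun q _ => Finset.sum_congr rfl fun r _ =>
    Finset.sum_congr rfl fun b _ => Finset.sum_congr rfl fun d _ => by
      rw [hG b, hG d, hG p]; ring

theorem tri_add (G : Fin 4 → Fin 4 → A) (U V W : Fin 4 → Fin 4 → Fin 4 → A) :
    tri G (fun a b c => U a b c + V a b c) W = tri G U W + tri G V W := by
  simp only [tri, add_mul, Finset.sum_add_distrib, mul_add]

theorem tri_sub (G : Fin 4 → Fin 4 → A) (U V W : Fin 4 → Fin 4 → Fin 4 → A) :
    tri G (fun a b c => U a b c - V a b c) W = tri G U W - tri G V W := by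
  simp only [tri, sub_mul, Finset.sum_sub_distrib, mul_sub]

theorem tri_swap12 (G : Fin 4 → Fin 4 → A) (hG : ∀ a b, G a b = G b a)
    (U V : Fin 4 → Fin 4 → Fin 4 → A) :
    tri G (fun a b c => U b a c) V = tri G U (fun a b c => V b a c) := by
  rw [tri_eq G hG, tri_eq G hG, Finset.sum_comm]
  refine Finset.sum_congr rfl fun a _ => Finset.sum_congr rfl fun b _ =>
    Finset.sum_congr rfl fun c _ => ?_
  congr 1
  rw [Finset.sum_comm]
  exact Finset.sum_congr rfl fun a _ => Finset.sum_congr rfl fun b _ =>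
    Finset.sum_congr rfl fun c _ => by ring

theorem tri_swap23 (G : Fin 4 → Fin 4 → A) (hG : ∀ a b, G a b = G b a)
    (U V : Fin 4 → Fin 4 → Fin 4 → A) :
    tri G (fun a b c => U a c b) V = tri G U (fun a b c => V a c b) := by
  rw [tri_eq G hG, tri_eq G hG]
  refine Finset.sum_congr rfl fun a _ => ?_
  rw [Finset.sum_comm]
  refine Finset.sum_congr rfl fun b _ => Finset.sum_congr rfl fun c _ => ?_
  congr 1
  refine Finset.sum_congr rfl fun a _ => ?_
  rw [Finset.sum_comm]
  exact Finset.sum_congr rfl fun b _ => Finset.sum_congr rfl fun c _ => by ring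

namespace Geom

variable (S : Geom D)

/-- The Lagrangian density `√-g (K_{ab} K^{ab} - κ²)`. -/
def lag : A := S.s * (S.normK - S.κ ^ 2)

theorem up2_g (a b : Fin 4) : up2 S.G S.g a b = S.G a b := by
  have : ∀ p, ∑ q, S.G a p * S.G b q * S.g p q = S.G a p * if p = b then 1 else 0 := by
    intro p
    rw [← S.gG p b, Finset.mul_sum]
    exact Finset.sum_congr rfl fun q _ => by rw [S.G_symm b]; ring
  simp [up2, this]

theorem tr2_up2_g (t : Fin 4 → Fin 4 → A) : tr2 (up2 S.G t) S.g = tr2 S.G t := by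
  rw [tr2_up2_comm _ _ _ S.G_symm]
  simp only [tr2, S.up2_g]

end Geom

namespace Variation

variable {S : Geom D} (V : Variation S)

/-- The first variation of `Geom.lag`. -/
def lag' : A :=
  V.s' * (S.normK - S.κ ^ 2) + S.s * (2 * tr2 (up2 S.G S.K) V.K' - 2 * tr2 (up2 S.G V.h) S.KK
    - 2 * S.κ * (tr2 S.G V.K' - tr2 (up2 S.G V.h) S.K))

/-- The tensor `2 K_{ab} - κ g_{ab}` conjugate to the Ricci tensor. -/
def _root_.WeylGravitons.Geom.X (S : Geom D) (a b : Fin 4) : A := 2 * S.K a b - S.κ * S.g a b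

/-- The variation of `4 √-g (|K|² - κ²)` with the variation of `K` traded for that of the Ricci
tensor. -/
theorem four_lag' : 4 * V.lag' = S.s * (2 * tr2 (up2 S.G S.X) (ricVar D S.Γ V.T)
    + 2 * tr2 S.G V.h * S.normK - 8 * tr2 (up2 S.G V.h) S.KK) := by
  have h0 : ∀ a b, ricVar D S.Γ V.T a b = 2 * V.K' a b
      + ((tr2 S.G V.K' - tr2 (up2 S.G V.h) S.K) * S.g a b + S.κ * V.h a b) := fun a b => by
    rw [V.schout']; ring
  have h1 : tr2 S.G (ricVar D S.Γ V.T) = 2 * tr2 S.G V.K'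
      + ((tr2 S.G V.K' - tr2 (up2 S.G V.h) S.K) * 4 + S.κ * tr2 S.G V.h) := by
    rw [show ricVar D S.Γ V.T = _ from funext fun a => funext fun b => h0 a b]
    rw [tr2_add, tr2_add, tr2_mul, tr2_mul, tr2_mul,
      show tr2 S.G S.g = 4 from S.sum_ite_trace]
  have h2 : tr2 (up2 S.G S.K) (ricVar D S.Γ V.T) = 2 * tr2 (up2 S.G S.K) V.K'
      + ((tr2 S.G V.K' - tr2 (up2 S.G V.h) S.K) * S.κ + S.κ * tr2 (up2 S.G V.h) S.K) := by
    rw [show ricVar D S.Γ V.T = _ from funext fun a => funext fun b => h0 a b]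
    rw [tr2_add, tr2_add, tr2_mul, tr2_mul, tr2_mul, S.tr2_up2_g,
      tr2_up2_comm S.G V.h _ S.G_symm]
    rfl
  have h3 : tr2 (up2 S.G S.X) (ricVar D S.Γ V.T) = 2 * tr2 (up2 S.G S.K) (ricVar D S.Γ V.T)
      - S.κ * tr2 S.G (ricVar D S.Γ V.T) := by
    rw [tr2_up2_comm _ _ _ S.G_symm, show S.X = _ from rfl]
    unfold Geom.X
    rw [tr2_sub, tr2_mul, tr2_mul, S.tr2_up2_g, tr2_up2_comm _ _ _ S.G_symm]
  rw [h3, h2, h1, lag']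
  linear_combination 2 * (S.normK - S.κ ^ 2) * V.vol'

/-- The lowered connection variation. -/
def τ (p b d : Fin 4) : A := ∑ e, S.g p e * V.T e b d

/-- The trace of the connection variation. -/
def t (b : Fin 4) : A := ∑ a, V.T a b a

theorem nab2_h (c a b : Fin 4) : nab2 D S.Γ V.h c a b = V.τ b c a + V.τ a c b := by
  rw [V.compat', τ, τ]
  congr 1
  · exact Finset.sum_congr rfl fun e _ => by rw [S.g_symm, mul_comm]
  · exact Finset.sum_congr rfl fun e _ => by rw [mul_comm]

theorem τ_symm (p b d : Fin 4) : V.τ p b d = V.τ p d b := by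
  simp only [τ, V.T_symm]

/-- The variation of the connection in terms of that of the metric. -/
theorem two_τ (p b d : Fin 4) : 2 * V.τ p b d = nab2 D S.Γ V.h b p d + nab2 D S.Γ V.h d p b
    - nab2 D S.Γ V.h p b d := by
  rw [nab2_h, nab2_h, nab2_h, V.τ_symm b p d, V.τ_symm d p b, V.τ_symm p d b]; ring

theorem two_t (b : Fin 4) : 2 * V.t b = D b (tr2 S.G V.h) := by
  have h1 : ∑ a, ∑ c, S.G a c * V.τ c b a = V.t b := by
    refine Finset.sum_congr rfl fun a _ => ?_
    exact S.raise_lower (fun e => V.T e b a) a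
  have h2 : ∑ a, ∑ c, S.G a c * V.τ a b c = V.t b := by
    rw [← h1, Finset.sum_comm]
    simp only [S.G_symm]
  rw [← S.tr2_nab2]
  simp only [nab2_h, mul_add, Finset.sum_add_distrib, h1, h2]
  ring

/-- The Palatini identity `δR_{bd} = ∇^p τ_{pbd} - ∇_d t_b`. -/
theorem ricVar_eq (b d : Fin 4) : ricVar D S.Γ V.T b d
    = (∑ a, ∑ p, S.G a p * nab3 D S.Γ V.τ a p b d) - nab1 D S.Γ V.t d b := by
  have h1 : ∀ a p, nab3 D S.Γ V.τ a p b d = ∑ f, S.g p f * (D a (V.T f b d)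
      + (∑ e, S.Γ f a e * V.T e b d) - (∑ e, S.Γ e a b * V.T f e d)
      - ∑ e, S.Γ e a d * V.T f b e) := by
    intro a p
    simp only [nab3, τ, map_sum, Derivation.leibniz, smul_eq_mul, S.compat]
    simp only [Fin.sum_univ_four]
    ring
  simp only [h1, S.raise_lower]
  simp only [ricVar, nab1, t, map_sum]
  simp only [Fin.sum_univ_four, S.Γ_symm, V.T_symm]
  ring

/-- Upper components `h^{ab}`. -/
def k (a b : Fin 4) : A := up2 S.G V.h a b

theorem k_symm (a b : Fin 4) : V.k a b = V.k b a := up2_symm _ _ V.h_symm a b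

theorem _root_.WeylGravitons.Geom.nab2_X (S : Geom D) (c a b : Fin 4) :
    nab2 D S.Γ S.X c a b = 2 * nab2 D S.Γ S.K c a b - D c S.κ * S.g a b := by
  have := S.nab2_g c a b
  simp only [nab2, Geom.X, map_sub, Derivation.leibniz, smul_eq_mul, Geom.D_two,
    Fin.sum_univ_four] at this ⊢
  linear_combination -S.κ * this

theorem _root_.WeylGravitons.Geom.nab3_X (S : Geom D) (d c a b : Fin 4) :
    nab3 D S.Γ (nab2 D S.Γ S.X) d c a b = 2 * nab3 D S.Γ (nab2 D S.Γ S.K) d c a b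
      - nab1 D S.Γ (fun c => D c S.κ) d c * S.g a b := by
  have := S.nab2_g d a b
  simp only [nab3, S.nab2_X, nab1, map_sub, Derivation.leibniz, smul_eq_mul, Geom.D_two]
  rw [nab2] at this
  simp only [Fin.sum_univ_four] at this ⊢
  linear_combination -D c S.κ * this

/-- Contracting the connection variation with a tensor symmetric in its last indices. -/
theorem two_tri (z : Fin 4 → Fin 4 → Fin 4 → A) (hz : ∀ a b c, z a b c = z a c b) :
    2 * tri S.G V.τ z = 2 * tri S.G (fun p a q => z a p q) (nab2 D S.Γ V.h)
      - tri S.G z (nab2 D S.Γ V.h) := by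
  have h1 : 2 * tri S.G V.τ z = tri S.G (fun p b d => V.τ p b d + V.τ p b d) z := by
    rw [tri_add]; ring
  have h2 : ∀ p b d, V.τ p b d + V.τ p b d = nab2 D S.Γ V.h b p d + nab2 D S.Γ V.h d p b
    - nab2 D S.Γ V.h p b d := fun p b d => by rw [← V.two_τ]; ring
  have h3 : tri S.G (fun p b d => nab2 D S.Γ V.h b p d) z
      = tri S.G (fun p a q => z a p q) (nab2 D S.Γ V.h) := by
    rw [tri_comm _ S.G_symm, ← tri_swap12 _ S.G_symm]
  have h4 : tri S.G (fun p b d => nab2 D S.Γ V.h d p b) z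
      = tri S.G (fun p a q => z a p q) (nab2 D S.Γ V.h) := by
    rw [← h3, tri_swap23 _ S.G_symm (fun p b d => nab2 D S.Γ V.h b p d)]
    simp only [← hz]
  simp only [h1, h2]
  rw [tri_sub _ (fun p b d => nab2 D S.Γ V.h b p d + nab2 D S.Γ V.h d p b),
    tri_add _ (fun p b d => nab2 D S.Γ V.h b p d), h3, h4, tri_comm _ S.G_symm z]
  ring

/-- `∇_d (2 K^{bd} - κ g^{bd}) = ∂^b κ`. -/
theorem _root_.WeylGravitons.Geom.div_X (S : Geom D) (b : Fin 4) :
    ∑ d, nabUp D S.Γ (up2 S.G S.X) d b d = ∑ e, S.G b e * D e S.κ := by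
  simp only [S.nabUp_up2]
  have h1 : ∀ p, ∑ d, ∑ q, S.G d q * nab2 D S.Γ S.X d p q = D p S.κ := by
    intro p
    have h2 := S.div_schouten p
    have h3 : ∑ d, ∑ q, S.G d q * (D d S.κ * S.g p q) = D p S.κ := by
      have : ∀ d, ∑ q, S.G d q * (D d S.κ * S.g p q) = D d S.κ * ∑ q, S.G d q * S.g q p := by
        intro d
        rw [Finset.mul_sum]
        exact Finset.sum_congr rfl fun b _ => by rw [S.g_symm]; ring
      simp [this, S.Gg]
    simp only [S.nab2_X, mul_sub, Finset.sum_sub_distrib, h3, mul_left_comm _ (2 : A),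
      ← Finset.mul_sum]
    have h4 : ∑ d, ∑ q, S.G d q * nab2 D S.Γ S.K d p q = D p S.κ := by
      rw [← h2, Finset.sum_comm]
      exact Finset.sum_congr rfl fun d _ => Finset.sum_congr rfl fun q _ => by
        rw [S.G_symm, S.nab2_K_symm]
    rw [h4]; ring
  rw [Finset.sum_comm]
  simp only [mul_assoc, ← Finset.mul_sum, ← h1]

/-- The part of the variation coming from the Ricci tensor, integrated by parts twice. -/
theorem exact_ric {I : Ideal A} (hI : ∀ a b, V.h a b ∈ I) (hT : ∀ a b c, V.T a b c ∈ I) :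
    S.s * (2 * tr2 (up2 S.G S.X) (ricVar D S.Γ V.T))
      - S.s * tr2 V.k (fun a q => 4 * (∑ p, ∑ b, S.G p b * nab3 D S.Γ (nab2 D S.Γ S.K) b a p q)
        - 2 * nab1 D S.Γ (fun c => D c S.κ) q a
        - 2 * ∑ p, ∑ b, S.G p b * nab3 D S.Γ (nab2 D S.Γ S.K) b p a q) ∈ Exact D I := by
  set z : Fin 4 → Fin 4 → Fin 4 → A := nab2 D S.Γ S.X with hz
  have hzs : ∀ a b c, z a b c = z a c b := fun a b c => by
    rw [hz, S.nab2_X, S.nab2_X, S.nab2_K_symm, S.g_symm b]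
  have hτ : ∀ a b c, V.τ a b c ∈ I := fun a b c => I.sum_mem fun e _ => I.mul_mem_left _ (hT _ _ _)
  have ht : ∀ b, V.t b ∈ I := fun b => I.sum_mem fun e _ => hT _ _ _
  have hk : ∀ a b, V.k a b ∈ I := fun a b =>
    show (∑ p, ∑ q, S.G a p * S.G b q * V.h p q) ∈ I from
      I.sum_mem fun p _ => I.sum_mem fun q _ => I.mul_mem_left _ (hI _ _)
  have htr : tr2 S.G V.h ∈ I := I.sum_mem fun p _ => I.sum_mem fun q _ => I.mul_mem_left _ (hI _ _)
  -- the divergence part of `ricVar`, integrated by parts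
  have e1 := S.exact_parts (I := I) V.τ (up2 S.G S.X) fun p a q => I.mul_mem_right _ (hτ p a q)
  -- the gradient part of `ricVar`, integrated by parts; `e3` does it once more
  have e2 := S.exact_div_up (I := I) (up2 S.G S.X) V.t ht
  have e3 := S.exact_div (I := I) (fun b => tr2 S.G V.h * D b S.κ) fun b => I.mul_mem_right _ htr
  -- the two contractions of `∇h` that make up `τ`, integrated by parts
  have e4 := S.exact_parts (I := I) (fun p a q => z a p q) V.k fun p a q => I.mul_mem_left _ (hk a q)
  have e5 := S.exact_parts (I := I) z V.k fun p a q => I.mul_mem_left _ (hk a q)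
  have hnk : ∀ c a b, nabUp D S.Γ V.k c a b = ∑ p, ∑ q, S.G a p * S.G b q * nab2 D S.Γ V.h c p q :=
    S.nabUp_up2 V.h
  simp only [S.nabUp_up2] at e1
  simp only [hnk] at e4 e5
  have t1 := V.two_tri z hzs
  rw [tri, tri, tri] at t1
  have hric : tr2 (up2 S.G S.X) (ricVar D S.Γ V.T)
      = (∑ p, ∑ b, S.G p b * ∑ a, ∑ q, nab3 D S.Γ V.τ b p a q * up2 S.G S.X a q)
        - ∑ b, ∑ d, up2 S.G S.X b d * nab1 D S.Γ V.t d b := by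
    simp only [tr2, ricVar_eq, mul_sub, Finset.sum_sub_distrib]
    congr 1
    simp only [Finset.mul_sum]
    rw [sum_comm22, Finset.sum_comm]
    exact Finset.sum_congr rfl fun p _ => Finset.sum_congr rfl fun b _ =>
      Finset.sum_congr rfl fun a _ => Finset.sum_congr rfl fun q _ => by
        rw [S.G_symm]; ring
  have h2 : ∑ b, ∑ d, nabUp D S.Γ (up2 S.G S.X) d b d * V.t b
      = ∑ b, (∑ e, S.G b e * D e S.κ) * V.t b := by
    simp only [← Finset.sum_mul, S.div_X]
  rw [h2] at e2
  have h3 : ∑ p, ∑ b, S.G p b * nab1 D S.Γ (fun b => tr2 S.G V.h * D b S.κ) b p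
      = 2 * (∑ b, (∑ e, S.G b e * D e S.κ) * V.t b)
        + tr2 S.G V.h * ∑ p, ∑ b, S.G p b * nab1 D S.Γ (fun b => D b S.κ) b p := by
    have : ∀ b p, nab1 D S.Γ (fun b => tr2 S.G V.h * D b S.κ) b p
        = 2 * (V.t b * D p S.κ) + tr2 S.G V.h * nab1 D S.Γ (fun b => D b S.κ) b p := by
      intro b p
      rw [← mul_assoc, V.two_t]
      simp only [nab1, Derivation.leibniz, smul_eq_mul, Fin.sum_univ_four]
      ring
    simp only [this, mul_add, Finset.sum_add_distrib, mul_left_comm _ (2 : A),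
      mul_left_comm _ (tr2 S.G V.h), ← Finset.mul_sum]
    congr 2
    rw [Finset.sum_comm]
    simp only [Finset.sum_mul]
    exact Finset.sum_congr rfl fun p _ => Finset.sum_congr rfl fun b _ => by
      rw [S.G_symm]; ring
  rw [h3] at e3
  have h4 : ∑ p, ∑ b, S.G p b * ∑ a, ∑ q, nab3 D S.Γ (fun p a q => z a p q) b p a q * V.k a q
      = tr2 V.k (fun a q => 2 * (∑ p, ∑ b, S.G p b * nab3 D S.Γ (nab2 D S.Γ S.K) b a p q)
        - nab1 D S.Γ (fun c => D c S.κ) q a) := by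
    have e : ∀ a q, 2 * (∑ p, ∑ b, S.G p b * nab3 D S.Γ (nab2 D S.Γ S.K) b a p q)
        - nab1 D S.Γ (fun c => D c S.κ) q a
        = ∑ p, ∑ b, S.G p b * nab3 D S.Γ (fun p a q => z a p q) b p a q := by
      intro a q
      have h6 : ∀ b p, nab3 D S.Γ (fun p a q => z a p q) b p a q
          = 2 * nab3 D S.Γ (nab2 D S.Γ S.K) b a p q
            - nab1 D S.Γ (fun c => D c S.κ) b a * S.g p q := by
        intro b p
        rw [← S.nab3_X]
        simp only [nab3, hz]
        ring
      have h7 : ∑ p, ∑ b, S.G p b * (nab1 D S.Γ (fun c => D c S.κ) b a * S.g p q)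
          = nab1 D S.Γ (fun c => D c S.κ) q a := by
        rw [Finset.sum_comm]
        have : ∀ b, ∑ p, S.G p b * (nab1 D S.Γ (fun c => D c S.κ) b a * S.g p q)
            = nab1 D S.Γ (fun c => D c S.κ) b a * ∑ p, S.G b p * S.g p q := by
          intro b
          rw [Finset.mul_sum]
          exact Finset.sum_congr rfl fun p _ => by rw [S.G_symm]; ring
        simp [this, S.Gg]
      simp only [h6, mul_sub, Finset.sum_sub_distrib, h7, mul_left_comm _ (2 : A),
        ← Finset.mul_sum]
    simp only [e]
    simp only [tr2, Finset.mul_sum]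
    rw [sum_comm22]
    exact Finset.sum_congr rfl fun p _ => Finset.sum_congr rfl fun b _ =>
      Finset.sum_congr rfl fun a _ => Finset.sum_congr rfl fun q _ => by ring
  rw [h4] at e4
  have h5 : ∑ p, ∑ b, S.G p b * ∑ a, ∑ q, nab3 D S.Γ z b p a q * V.k a q
      = tr2 V.k (fun a q => 2 * (∑ p, ∑ b, S.G p b * nab3 D S.Γ (nab2 D S.Γ S.K) b p a q))
        - tr2 S.G V.h * ∑ p, ∑ b, S.G p b * nab1 D S.Γ (fun b => D b S.κ) b p := by
    have e : tr2 S.G V.h = tr2 V.k S.g := (S.tr2_up2_g V.h).symm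
    rw [e, mul_comm (tr2 V.k S.g), ← tr2_mul, ← tr2_sub, tr2]
    simp only [hz, S.nab3_X, Finset.mul_sum, Finset.sum_mul, ← Finset.sum_sub_distrib]
    rw [sum_comm22]
    exact Finset.sum_congr rfl fun p _ => Finset.sum_congr rfl fun b _ =>
      Finset.sum_congr rfl fun a _ => Finset.sum_congr rfl fun q _ => by ring
  rw [h5] at e5
  rw [tr2_mul] at e5
  rw [tr2_sub, tr2_mul] at e4
  rw [hric, tr2_sub, tr2_sub, tr2_mul, tr2_mul, tr2_mul]
  have hcomb := (Exact D I).add_mem ((Exact D I).sub_mem ((Exact D I).add_mem ((Exact D I).sub_mem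
    e5 ((Exact D I).add_mem e4 e4)) e3) ((Exact D I).add_mem e2 e2)) ((Exact D I).add_mem e1 e1)
  convert hcomb using 1
  linear_combination -S.s * t1

/-- The Bach tensor contracted with `h`, in terms of second derivatives of the Schouten tensor. -/
theorem contract_bac : tr2 V.k S.bac
    = tr2 V.k (fun a q => 2 * (∑ p, ∑ b, S.G p b * nab3 D S.Γ (nab2 D S.Γ S.K) b a p q)
        - 2 * ∑ p, ∑ b, S.G p b * nab3 D S.Γ (nab2 D S.Γ S.K) b p a q)
      - 2 * tr2 V.k (fun a b => ∑ c, ∑ d, S.G c d * ∑ e, S.K c e * S.wey e b d a) := by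
  have h1 : tr2 V.k (fun a b => ∑ c, ∑ d, S.G c d * nab3 D S.Γ S.cot d a b c)
      = tr2 V.k (fun a q => (∑ p, ∑ b, S.G p b * nab3 D S.Γ (nab2 D S.Γ S.K) b p a q)
        - ∑ p, ∑ b, S.G p b * nab3 D S.Γ (nab2 D S.Γ S.K) b a p q) := by
    have : ∀ a b, ∑ c, ∑ d, S.G c d * nab3 D S.Γ S.cot d a b c
        = (∑ c, ∑ d, S.G c d * nab3 D S.Γ (nab2 D S.Γ S.K) d c b a)
        - ∑ c, ∑ d, S.G c d * nab3 D S.Γ (nab2 D S.Γ S.K) d b c a := by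
      intro a b
      simp only [← Finset.sum_sub_distrib, ← mul_sub]
      refine Finset.sum_congr rfl fun c _ => Finset.sum_congr rfl fun d _ => ?_
      simp only [nab3, Geom.cot, map_sub, mul_sub, Finset.sum_sub_distrib]
      ring
    simp only [this, tr2]
    rw [Finset.sum_comm]
    exact Finset.sum_congr rfl fun a _ => Finset.sum_congr rfl fun b _ => by rw [V.k_symm]
  have h2 : tr2 V.k (fun a b => ∑ c, ∑ d, S.G c d * ∑ e, S.K c e * S.wey e b d a)
      = tr2 V.k (fun a b => ∑ c, ∑ d, ∑ p, ∑ q,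
        S.G c p * S.G d q * S.K p q * S.weyLow a c b d) := by
    have h3 : ∀ e b d a, S.wey e b d a = ∑ f, S.G e f * S.weyLow b f a d := by
      intro e b d a
      rw [← S.raise_lower (fun e => S.wey e b d a) e]
      exact Finset.sum_congr rfl fun f _ => by
        rw [S.weyLow_antisymm_first, S.weyLow_antisymm_last, neg_neg]; rfl
    have h4 : ∀ a b, ∑ c, ∑ d, S.G c d * ∑ e, S.K c e * S.wey e b d a
        = ∑ c, ∑ d, ∑ p, ∑ q, S.G c p * S.G d q * S.K p q * S.weyLow b c a d := by
      intro a b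
      simp only [h3, Finset.mul_sum]
      rw [sum_comm22, Finset.sum_comm]
      refine Finset.sum_congr rfl fun f _ => ?_
      rw [sum_comm21]
      exact Finset.sum_congr rfl fun d _ => Finset.sum_congr rfl fun e _ =>
        Finset.sum_congr rfl fun c _ => by rw [S.G_symm f, S.G_symm c, S.K_symm c]; ring
    simp only [h4, tr2]
    rw [Finset.sum_comm]
    exact Finset.sum_congr rfl fun a _ => Finset.sum_congr rfl fun b _ => by rw [V.k_symm]
  simp only [show S.bac = fun a b => -2 * ((∑ c, ∑ d, S.G c d * nab3 D S.Γ S.cot d a b c)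
    + ∑ c, ∑ d, ∑ p, ∑ q, S.G c p * S.G d q * S.K p q * S.weyLow a c b d) from rfl]
  rw [tr2_mul, tr2_add, h1, ← h2, tr2_sub, tr2_sub, tr2_mul, tr2_mul]
  ring

/-- The first variation formula: up to a total derivative, the variation of `4 √-g (|K|² - κ²)`
is `√-g h_{ab} B^{ab}`. -/
theorem first_variation {I : Ideal A} (hI : ∀ a b, V.h a b ∈ I) (hT : ∀ a b c, V.T a b c ∈ I) :
    4 * V.lag' - S.s * tr2 V.k S.bac ∈ Exact D I := by
  have h := V.exact_ric hI hT
  convert h using 1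
  have h1 : ∀ a q, ∑ p, ∑ b, S.G p b * nab3 D S.Γ (nab2 D S.Γ S.K) b a p q
      = (nab1 D S.Γ (fun c => D c S.κ) a q + 4 * S.KK a q - S.normK * S.g a q)
        - ∑ c, ∑ d, S.G c d * ∑ e, S.K c e * S.wey e q d a := fun a q => by
    rw [S.div_nab_schouten, mul_comm S.normK]
  have h2 : tr2 V.k (fun a q => nab1 D S.Γ (fun c => D c S.κ) q a)
      = tr2 V.k (fun a q => nab1 D S.Γ (fun c => D c S.κ) a q) := by
    rw [tr2, tr2, Finset.sum_comm]
    exact Finset.sum_congr rfl fun a _ => Finset.sum_congr rfl fun b _ => by rw [V.k_symm]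
  have h3 : tr2 V.k S.g = tr2 S.G V.h := S.tr2_up2_g V.h
  have h4 : tr2 (up2 S.G V.h) S.KK = tr2 V.k (fun a b => S.KK a b) := rfl
  have h5 : tr2 V.k (fun a b => S.g a b) = tr2 S.G V.h := h3
  rw [V.four_lag', V.contract_bac, h4]
  simp only [tr2_sub, tr2_mul, h2]
  simp only [h1, tr2_sub, tr2_add, tr2_mul, h5]
  ring

end Variation

end

section

variable {A : Type*} [CommRing A] [Algebra ℝ A] {D : Fin 4 → Derivation ℝ A A}

namespace Geom

variable (S : Geom D)

/-! ### Variations along derivations -/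

theorem deriv_inv (δ : Derivation ℝ A A) (a b : Fin 4) :
    δ (S.G a b) = -up2 S.G (fun p q => δ (S.g p q)) a b := by
  have h1 : ∀ f, ∑ e, S.g f e * δ (S.G a e) = -∑ e, S.G a e * δ (S.g e f) := by
    intro f
    have := congrArg δ (S.Gg a f)
    rw [map_sum] at this
    have h0 : δ (if a = f then (1 : A) else 0) = 0 := by split_ifs <;> simp
    rw [h0] at this
    simp only [Derivation.leibniz, smul_eq_mul, Finset.sum_add_distrib] at this
    rw [← sub_eq_zero, sub_neg_eq_add, ← this, add_comm]
    simp only [S.g_symm f]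
  rw [← S.raise_lower (fun e => δ (S.G a e)) b]
  simp only [h1, up2, mul_neg, Finset.sum_neg_distrib, Finset.mul_sum]
  rw [Finset.sum_comm]
  congr 1
  exact Finset.sum_congr rfl fun f _ => Finset.sum_congr rfl fun e _ => by ring

theorem deriv_κ (δ : Derivation ℝ A A) : δ S.κ = tr2 S.G (fun a b => δ (S.K a b))
    - tr2 (up2 S.G (fun p q => δ (S.g p q))) S.K := by
  simp only [κ, tr2, map_sum, Derivation.leibniz, smul_eq_mul, S.deriv_inv,
    ← Finset.sum_sub_distrib]
  exact Finset.sum_congr rfl fun f _ => Finset.sum_congr rfl fun e _ => by ring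

theorem KK_symm (a b : Fin 4) : S.KK a b = S.KK b a := by
  simp only [KK]
  rw [Finset.sum_comm]
  exact Finset.sum_congr rfl fun f _ => Finset.sum_congr rfl fun e _ => by
    rw [S.G_symm]; ring

theorem deriv_normK (δ : Derivation ℝ A A) : δ S.normK =
    2 * tr2 (up2 S.G S.K) (fun a b => δ (S.K a b))
    - 2 * tr2 (up2 S.G (fun p q => δ (S.g p q))) S.KK := by
  have h1 : ∀ a b, δ (S.KK a b) = (∑ c, ∑ d, S.G c d * δ (S.K a c) * S.K b d)
      + (∑ c, ∑ d, S.G c d * δ (S.K b c) * S.K a d)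
      - ∑ c, ∑ d, up2 S.G (fun p q => δ (S.g p q)) c d * S.K a c * S.K b d := by
    intro a b
    rw [Finset.sum_comm (f := fun c d => S.G c d * δ (S.K b c) * S.K a d)]
    simp only [KK, map_sum, Derivation.leibniz, smul_eq_mul, S.deriv_inv,
      ← Finset.sum_sub_distrib, ← Finset.sum_add_distrib]
    exact Finset.sum_congr rfl fun f _ => Finset.sum_congr rfl fun e _ => by
      rw [S.G_symm e f]; ring
  have h2 : ∀ X : Fin 4 → Fin 4 → A,
      ∑ a, ∑ b, S.G a b * ∑ c, ∑ d, X c d * S.K a c * S.K b d = tr2 X S.KK := by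
    intro X
    simp only [tr2, KK, Finset.mul_sum]
    rw [sum_comm22]
    exact Finset.sum_congr rfl fun a _ => Finset.sum_congr rfl fun b _ =>
      Finset.sum_congr rfl fun c _ => Finset.sum_congr rfl fun d _ => by
        rw [S.K_symm a c, S.K_symm b d]; ring
  have h3 : ∑ a, ∑ b, S.G a b * ∑ c, ∑ d, S.G c d * δ (S.K a c) * S.K b d
      = tr2 (up2 S.G S.K) (fun a b => δ (S.K a b)) := by
    simp only [tr2, up2, Finset.mul_sum, Finset.sum_mul]
    refine Finset.sum_congr rfl fun a _ => ?_
    rw [Finset.sum_comm]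
    exact Finset.sum_congr rfl fun b _ =>
      Finset.sum_congr rfl fun c _ => Finset.sum_congr rfl fun d _ => by ring
  have h4 : ∑ a, ∑ b, S.G a b * ∑ c, ∑ d, S.G c d * δ (S.K b c) * S.K a d
      = tr2 (up2 S.G S.K) (fun a b => δ (S.K a b)) := by
    rw [← h3, Finset.sum_comm]
    simp only [S.G_symm]
  rw [S.normK_eq, tr2]
  simp only [map_sum, Derivation.leibniz, smul_eq_mul, h1, S.deriv_inv, mul_add, mul_sub,
    Finset.sum_add_distrib, Finset.sum_sub_distrib, h2, h3, h4]
  have h5 : ∑ a, ∑ b, S.KK a b * -up2 S.G (fun p q => δ (S.g p q)) a b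
      = -tr2 (up2 S.G (fun p q => δ (S.g p q))) S.KK := by
    simp only [tr2, mul_neg, Finset.sum_neg_distrib, mul_comm]
  rw [h5]
  ring

theorem tr_deriv_g (a : Fin 4) : tr2 S.G (fun p q => D a (S.g p q)) = 2 * ∑ e, S.Γ e e a := by
  have h1 : ∑ p, ∑ q, S.G p q * ∑ e, S.Γ e a p * S.g e q = ∑ e, S.Γ e e a := by
    have : ∀ p q, S.G p q * ∑ e, S.Γ e a p * S.g e q = S.G p q * ∑ e, S.g q e * S.Γ e a p :=
      fun p q => by
        congr 1
        exact Finset.sum_congr rfl fun e _ => by rw [S.g_symm q]; ring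
    refine Finset.sum_congr rfl fun p _ => ?_
    rw [Finset.sum_congr rfl fun q _ => this p q, S.raise_lower (fun e => S.Γ e a p) p, S.Γ_symm]
  have h2 : ∑ p, ∑ q, S.G p q * ∑ e, S.Γ e a q * S.g p e = ∑ e, S.Γ e e a := by
    rw [← h1, Finset.sum_comm]
    simp only [S.G_symm, S.g_symm]
  simp only [tr2, S.compat, mul_add, Finset.sum_add_distrib, h1, h2]
  ring

end Geom

/-- The variation of a geometry along a derivation commuting with the coordinate derivations. -/
def Variation.ofDeriv (S : Geom D) (δ : Derivation ℝ A A) (hδ : ∀ a x, δ (D a x) = D a (δ x))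
    (hs : 2 * δ S.s = S.s * tr2 S.G (fun a b => δ (S.g a b))) : Variation S where
  h a b := δ (S.g a b)
  T a b c := δ (S.Γ a b c)
  K' a b := δ (S.K a b)
  s' := δ S.s
  h_symm a b := by rw [S.g_symm]
  T_symm a b c := by rw [S.Γ_symm]
  compat' c a b := by
    have := congrArg δ (S.compat c a b)
    simp only [hδ, map_add, map_sum, Derivation.leibniz, smul_eq_mul] at this
    rw [nab2, this]
    simp only [Fin.sum_univ_four]
    ring
  schout' a b := by
    have := congrArg δ (S.schout' a b)
    rw [map_add, Derivation.leibniz, Derivation.leibniz, S.deriv_κ, Geom.D_two] at this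
    simp only [smul_eq_mul] at this
    rw [show 2 * δ (S.K a b) + (tr2 S.G (fun a b => δ (S.K a b))
      - tr2 (up2 S.G fun a b => δ (S.g a b)) S.K) * S.g a b + S.κ * δ (S.g a b)
      = δ (ricD D S.Γ a b) by rw [this]; ring]
    simp only [ricVar, ricD, riemD, map_sub, map_add, map_sum, Derivation.leibniz, smul_eq_mul, hδ]
    refine Finset.sum_congr rfl fun c _ => ?_
    congr 2 <;> exact Finset.sum_congr rfl fun e _ => by ring
  vol' := hs

theorem Variation.lag'_ofDeriv (S : Geom D) (δ : Derivation ℝ A A)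
    (hδ : ∀ a x, δ (D a x) = D a (δ x))
    (hs : 2 * δ S.s = S.s * tr2 S.G (fun a b => δ (S.g a b))) :
    (Variation.ofDeriv S δ hδ hs).lag' = δ S.lag := by
  have h1 : (Variation.ofDeriv S δ hδ hs).K' = fun a b => δ (S.K a b) := rfl
  have h2 : (Variation.ofDeriv S δ hδ hs).h = fun a b => δ (S.g a b) := rfl
  have h3 : (Variation.ofDeriv S δ hδ hs).s' = δ S.s := rfl
  rw [Variation.lag', h1, h2, h3, Geom.lag, Derivation.leibniz, map_sub, S.deriv_normK, sq,
    Derivation.leibniz, S.deriv_κ]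
  simp only [smul_eq_mul]
  ring

/-! ### Lie derivatives -/

/-- The Lie derivative of a covariant rank-two tensor along `v`. -/
def lie2 (D : Fin 4 → Derivation ℝ A A) (v : Fin 4 → A) (t : Fin 4 → Fin 4 → A) (a b : Fin 4) : A :=
  ∑ e, (v e * D e (t a b) + D a (v e) * t e b + D b (v e) * t a e)

/-- The Lie derivative of a connection along `v`. -/
def lieΓ (D : Fin 4 → Derivation ℝ A A) (v : Fin 4 → A) (Γ : Fin 4 → Fin 4 → Fin 4 → A)
    (a b c : Fin 4) : A :=
  (∑ e, (v e * D e (Γ a b c) - D e (v a) * Γ e b c + D b (v e) * Γ a e c + D c (v e) * Γ a b e))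
    + D b (D c (v a))

namespace Geom

variable (S : Geom D)

/-- The Lie derivative of metric compatibility: `lieΓ` is the variation of the connection. -/
theorem lie_compat (v : Fin 4 → A) (c a b : Fin 4) : nab2 D S.Γ (lie2 D v S.g) c a b
    = (∑ e, lieΓ D v S.Γ e c a * S.g e b) + ∑ e, lieΓ D v S.Γ e c b * S.g a e := by
  have h : ∀ e, D c (D e (S.g a b)) = D e ((∑ e, S.Γ e c a * S.g e b) + ∑ e, S.Γ e c b * S.g a e) :=
    fun e => by rw [S.comm, S.compat]
  simp only [nab2, lie2, lieΓ, map_sum, map_add, Derivation.leibniz, smul_eq_mul, h]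
  simp only [S.compat]
  simp only [Fin.sum_univ_four, S.g_symm, S.Γ_symm]
  ring

set_option maxRecDepth 8000 in
set_option maxHeartbeats 1000000 in
/-- The curvature varies by its Lie derivative when the connection varies by `lieΓ`. -/
theorem lie_riem (v : Fin 4 → A) (a b c d : Fin 4) :
    (D c (lieΓ D v S.Γ a b d)
        + ∑ e, (lieΓ D v S.Γ a c e * S.Γ e b d + S.Γ a c e * lieΓ D v S.Γ e b d))
      - (D d (lieΓ D v S.Γ a b c)
        + ∑ e, (lieΓ D v S.Γ a d e * S.Γ e b c + S.Γ a d e * lieΓ D v S.Γ e b c))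
      = ∑ e, (v e * D e (riemD D S.Γ a b c d) - D e (v a) * riemD D S.Γ e b c d
        + D b (v e) * riemD D S.Γ a e c d + D c (v e) * riemD D S.Γ a b e d
        + D d (v e) * riemD D S.Γ a b c e) := by
  simp only [lieΓ, riemD, map_sum, map_add, map_sub, Derivation.leibniz, smul_eq_mul]
  simp only [Fin.sum_univ_four, S.Γ_symm, S.comm]
  ring

theorem lie_ric (v : Fin 4 → A) (a b : Fin 4) :
    ricVar D S.Γ (lieΓ D v S.Γ) a b = lie2 D v (ricD D S.Γ) a b := by
  have h1 : ∑ c, ∑ e, D e (v c) * riemD D S.Γ e a c b = ∑ c, ∑ e, D c (v e) * riemD D S.Γ c a e b :=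
    Finset.sum_comm
  rw [ricVar, Finset.sum_congr rfl fun c _ => S.lie_riem v c a c b]
  simp only [Finset.sum_add_distrib, Finset.sum_sub_distrib, h1]
  simp only [lie2, ricD, map_sum, Finset.sum_add_distrib, Finset.mul_sum]
  rw [Finset.sum_comm (f := fun c e => v e * D e (riemD D S.Γ c a c b)),
    Finset.sum_comm (f := fun c e => D a (v e) * riemD D S.Γ c e c b),
    Finset.sum_comm (f := fun c e => D b (v e) * riemD D S.Γ c a c e)]
  ring

/-- The part of a Lie derivative that is algebraic in the tensor. -/
def rot (N : Fin 4 → Fin 4 → A) (t : Fin 4 → Fin 4 → A) (a b : Fin 4) : A :=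
  ∑ e, (N a e * t e b + N b e * t a e)

theorem lie2_eq (v : Fin 4 → A) (t : Fin 4 → Fin 4 → A) (a b : Fin 4) :
    lie2 D v t a b = (∑ e, v e * D e (t a b)) + rot (fun a e => D a (v e)) t a b := by
  rw [lie2, rot, ← Finset.sum_add_distrib]
  exact Finset.sum_congr rfl fun e _ => by ring

theorem tr2_sum_mul (X : Fin 4 → Fin 4 → A) (v : Fin 4 → A) (t : Fin 4 → Fin 4 → Fin 4 → A) :
    tr2 X (fun a b => ∑ e, v e * t e a b) = ∑ e, v e * tr2 X (t e) := by
  simp only [tr2, Finset.mul_sum]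
  rw [sum_comm21]
  exact Finset.sum_congr rfl fun a _ => Finset.sum_congr rfl fun b _ =>
    Finset.sum_congr rfl fun c _ => by ring

theorem tr2_up2_sum_mul (v : Fin 4 → A) (t : Fin 4 → Fin 4 → Fin 4 → A) (X : Fin 4 → Fin 4 → A) :
    tr2 (up2 S.G fun a b => ∑ e, v e * t e a b) X = ∑ e, v e * tr2 (up2 S.G (t e)) X := by
  rw [tr2_up2_comm _ _ _ S.G_symm, tr2_sum_mul]
  exact Finset.sum_congr rfl fun e _ => by rw [tr2_up2_comm _ _ _ S.G_symm]

theorem up2_rot_g (N : Fin 4 → Fin 4 → A) (a b : Fin 4) :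
    up2 S.G (rot N S.g) a b = ∑ p, (S.G a p * N p b + S.G b p * N p a) := by
  have h1 : ∀ p b, ∑ q, S.G b q * ∑ e, S.g q e * N p e = N p b := fun p b =>
    S.raise_lower (fun e => N p e) b
  simp only [up2, rot, mul_add, Finset.sum_add_distrib]
  congr 1
  · refine Finset.sum_congr rfl fun p _ => ?_
    rw [← h1 p b, Finset.mul_sum]
    exact Finset.sum_congr rfl fun q _ => by
      rw [mul_assoc]; congr 2
      exact Finset.sum_congr rfl fun e _ => by rw [S.g_symm e]; ring
  · rw [Finset.sum_comm]
    refine Finset.sum_congr rfl fun p _ => ?_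
    rw [← h1 p a, Finset.mul_sum]
    exact Finset.sum_congr rfl fun q _ => by
      rw [mul_comm (S.G a q), mul_assoc]; congr 2
      exact Finset.sum_congr rfl fun e _ => by ring

theorem tr2_rot (N t : Fin 4 → Fin 4 → A) :
    tr2 S.G (rot N t) = tr2 (up2 S.G (rot N S.g)) t := by
  simp only [tr2, S.up2_rot_g, rot]
  simp only [Fin.sum_univ_four, S.G_symm]
  ring

theorem tr2_rot_g (N : Fin 4 → Fin 4 → A) : tr2 S.G (rot N S.g) = 2 * ∑ a, N a a := by
  have h : ∀ a b, ∑ p, S.G a p * S.g p b = if a = b then 1 else 0 := S.Gg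
  rw [tr2_rot, tr2]
  have e : ∀ a b, up2 S.G (rot N S.g) a b * S.g a b
      = (∑ p, S.G a p * N p b * S.g a b) + ∑ p, S.G b p * N p a * S.g a b := by
    intro a b
    rw [S.up2_rot_g, Finset.sum_mul, ← Finset.sum_add_distrib]
    exact Finset.sum_congr rfl fun q _ => by ring
  have e2 : ∑ a, ∑ b, ∑ p, S.G b p * N p a * S.g a b = ∑ a, N a a := by
    refine Finset.sum_congr rfl fun a _ => ?_
    rw [Finset.sum_comm]
    have : ∀ p, ∑ b, S.G b p * N p a * S.g a b = N p a * ∑ b, S.G p b * S.g b a := by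
      intro p
      rw [Finset.mul_sum]
      exact Finset.sum_congr rfl fun q _ => by rw [S.G_symm, S.g_symm a]; ring
    simp [this, h]
  have e3 : ∑ a, ∑ b, ∑ p, S.G a p * N p b * S.g a b = ∑ a, N a a := by
    rw [← e2, Finset.sum_comm]
    simp only [S.g_symm]
  simp only [e, Finset.sum_add_distrib, e2, e3]
  ring

/-- Rotating `K` in `K^{ab} K_{ab}` is the same as rotating the metrics that raise the indices. -/
theorem tr2_up2_rot (N : Fin 4 → Fin 4 → A) :
    tr2 (up2 S.G S.K) (rot N S.K) = tr2 (up2 S.G (rot N S.g)) S.KK := by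
  have h0 : ∀ e p, ∑ b, (∑ q, S.G b q * S.K p q) * S.K e b = S.KK p e := by
    intro e p
    rw [KK_symm, KK]
    simp only [Finset.sum_mul]
    exact Finset.sum_congr rfl fun a _ => Finset.sum_congr rfl fun b _ => by ring
  have h1 : ∑ a, ∑ b, up2 S.G S.K a b * ∑ e, N a e * S.K e b
      = ∑ a, ∑ e, ∑ p, S.G a p * N a e * S.KK p e := by
    refine Finset.sum_congr rfl fun a _ => ?_
    simp only [← h0, up2, Finset.mul_sum, Finset.sum_mul]
    rw [Finset.sum_comm]
    refine Finset.sum_congr rfl fun e _ => ?_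
    rw [Finset.sum_comm]
    exact Finset.sum_congr rfl fun p _ => Finset.sum_congr rfl fun b _ =>
      Finset.sum_congr rfl fun q _ => by ring
  have h2 : ∑ a, ∑ b, up2 S.G S.K a b * ∑ e, N b e * S.K a e
      = ∑ a, ∑ e, ∑ p, S.G a p * N a e * S.KK p e := by
    rw [← h1, Finset.sum_comm]
    refine Finset.sum_congr rfl fun a _ => Finset.sum_congr rfl fun b _ => ?_
    rw [up2_symm _ _ S.K_symm]
    simp only [S.K_symm]
  have h3 : ∑ a, ∑ b, (∑ p, S.G a p * N p b) * S.KK a b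
      = ∑ a, ∑ e, ∑ p, S.G a p * N a e * S.KK p e := by
    simp only [Finset.sum_mul]
    rw [sum_comm21]
    refine Finset.sum_congr rfl fun a _ => ?_
    rw [Finset.sum_comm]
    exact Finset.sum_congr rfl fun p _ => Finset.sum_congr rfl fun b _ => by rw [S.G_symm]
  have h4 : ∑ a, ∑ b, (∑ p, S.G b p * N p a) * S.KK a b
      = ∑ a, ∑ e, ∑ p, S.G a p * N a e * S.KK p e := by
    rw [← h3, Finset.sum_comm]
    simp only [S.KK_symm]
  simp only [tr2, S.up2_rot_g, rot, Finset.sum_add_distrib, mul_add, add_mul, h1, h2, h3, h4]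

/-- The coordinate derivations satisfy the volume law of a variation. -/
theorem two_Ds (e : Fin 4) : 2 * D e S.s = S.s * tr2 S.G (fun a b => D e (S.g a b)) := by
  rw [S.tr_deriv_g, S.Ds]; ring

theorem lie2_fun (v : Fin 4 → A) (t : Fin 4 → Fin 4 → A) : lie2 D v t
    = fun a b => (∑ e, v e * D e (t a b)) + rot (fun a e => D a (v e)) t a b :=
  funext fun a => funext fun b => lie2_eq v t a b

theorem tr2_lie2_g (v : Fin 4 → A) : tr2 S.G (lie2 D v S.g)
    = (∑ e, v e * tr2 S.G (fun a b => D e (S.g a b))) + 2 * ∑ e, D e (v e) := by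
  rw [lie2_fun, tr2_add, tr2_sum_mul, S.tr2_rot_g]

theorem tr2_up2_lie2_g (v : Fin 4 → A) (X : Fin 4 → Fin 4 → A) :
    tr2 (up2 S.G (lie2 D v S.g)) X
      = (∑ e, v e * tr2 (up2 S.G fun a b => D e (S.g a b)) X)
        + tr2 (up2 S.G (rot (fun a e => D a (v e)) S.g)) X := by
  rw [lie2_fun, tr2_up2_comm _ _ _ S.G_symm, tr2_add, tr2_up2_comm _ _ _ S.G_symm,
    tr2_up2_sum_mul, tr2_up2_comm _ _ (rot _ _) S.G_symm]

theorem lie_κ (v : Fin 4 → A) : tr2 S.G (lie2 D v S.K) - tr2 (up2 S.G (lie2 D v S.g)) S.K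
    = ∑ e, v e * D e S.κ := by
  rw [tr2_up2_lie2_g, lie2_fun, tr2_add, tr2_sum_mul, S.tr2_rot, add_sub_add_right_eq_sub,
    ← Finset.sum_sub_distrib]
  exact Finset.sum_congr rfl fun e _ => by rw [S.deriv_κ]; ring

theorem lie_normK (v : Fin 4 → A) :
    2 * tr2 (up2 S.G S.K) (lie2 D v S.K) - 2 * tr2 (up2 S.G (lie2 D v S.g)) S.KK
      = ∑ e, v e * D e S.normK := by
  rw [tr2_up2_lie2_g, lie2_fun, tr2_add, tr2_sum_mul, S.tr2_up2_rot]
  have : ∑ e, v e * D e S.normK = ∑ e, (2 * (v e * tr2 (up2 S.G S.K) (fun a b => D e (S.K a b)))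
      - 2 * (v e * tr2 (up2 S.G (fun p q => D e (S.g p q))) S.KK)) :=
    Finset.sum_congr rfl fun e _ => by rw [S.deriv_normK]; ring
  rw [this, Finset.sum_sub_distrib, ← Finset.mul_sum, ← Finset.mul_sum]
  ring

end Geom

/-- The variation of a geometry under an infinitesimal diffeomorphism. -/
def Variation.lie (S : Geom D) (v : Fin 4 → A) : Variation S where
  h := lie2 D v S.g
  T := lieΓ D v S.Γ
  K' := lie2 D v S.K
  s' := ∑ e, D e (v e * S.s)
  h_symm a b := by
    simp only [lie2]
    exact Finset.sum_congr rfl fun e _ => by rw [S.g_symm a b, S.g_symm e b, S.g_symm e a]; ring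
  T_symm a b c := by
    simp only [lieΓ, S.comm b c]
    congr 1
    exact Finset.sum_congr rfl fun e _ => by
      rw [S.Γ_symm a b c, S.Γ_symm e b c, S.Γ_symm a e c, S.Γ_symm a e b]; ring
  compat' := S.lie_compat v
  schout' a b := by
    rw [S.lie_ric, S.lie_κ]
    have h : ∀ a b, ricD D S.Γ a b = 2 * S.K a b + S.κ * S.g a b := S.schout'
    simp only [lie2, h, map_add, Derivation.leibniz, smul_eq_mul, Geom.D_two]
    simp only [Fin.sum_univ_four]
    ring
  vol' := by
    rw [S.tr2_lie2_g, mul_add, Finset.mul_sum, Finset.mul_sum]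
    have : ∀ e, 2 * D e (v e * S.s)
        = S.s * (v e * tr2 S.G fun a b => D e (S.g a b)) + S.s * (2 * D e (v e)) := by
      intro e
      rw [Derivation.leibniz, smul_eq_mul, smul_eq_mul]
      linear_combination v e * S.two_Ds e
    simp only [this, Finset.sum_add_distrib, Finset.mul_sum]

/-- The Lagrangian is a scalar density: its variation under an infinitesimal diffeomorphism is a
total derivative. -/
theorem Variation.lag'_lie (S : Geom D) (v : Fin 4 → A) :
    (Variation.lie S v).lag' = ∑ e, D e (v e * S.lag) := by
  have h1 : (Variation.lie S v).K' = lie2 D v S.K := rfl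
  have h2 : (Variation.lie S v).h = lie2 D v S.g := rfl
  have h3 : (Variation.lie S v).s' = ∑ e, D e (v e * S.s) := rfl
  rw [Variation.lag', h1, h2, h3, S.lie_normK, S.lie_κ, Finset.sum_mul, Finset.mul_sum,
    ← Finset.sum_sub_distrib, Finset.mul_sum, ← Finset.sum_add_distrib]
  refine Finset.sum_congr rfl fun e _ => ?_
  simp only [Geom.lag, Derivation.leibniz, map_sub, sq, smul_eq_mul]
  ring

/-- The difference of two variations; the conditions on a variation are linear. -/
def Variation.sub {S : Geom D} (V W : Variation S) : Variation S where
  h a b := V.h a b - W.h a b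
  T a b c := V.T a b c - W.T a b c
  K' a b := V.K' a b - W.K' a b
  s' := V.s' - W.s'
  h_symm a b := by rw [V.h_symm, W.h_symm]
  T_symm a b c := by rw [V.T_symm, W.T_symm]
  compat' c a b := by
    have h1 := V.compat' c a b
    have h2 := W.compat' c a b
    simp only [nab2, map_sub, Fin.sum_univ_four] at h1 h2 ⊢
    linear_combination h1 - h2
  schout' a b := by
    have h1 := V.schout' a b
    have h2 := W.schout' a b
    have h3 : ricVar D S.Γ (fun a b c => V.T a b c - W.T a b c) a b
        = ricVar D S.Γ V.T a b - ricVar D S.Γ W.T a b := by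
      simp only [ricVar, map_sub, Fin.sum_univ_four]
      ring
    rw [h3, tr2_up2_comm _ _ _ S.G_symm, tr2_sub, tr2_sub, h1, h2,
      tr2_up2_comm _ V.h _ S.G_symm, tr2_up2_comm _ W.h _ S.G_symm]
    ring
  vol' := by
    rw [tr2_sub, mul_sub, V.vol', W.vol']; ring

theorem Variation.lag'_sub {S : Geom D} (V W : Variation S) :
    (V.sub W).lag' = V.lag' - W.lag' := by
  have h1 : (V.sub W).K' = fun a b => V.K' a b - W.K' a b := rfl
  have h2 : (V.sub W).h = fun a b => V.h a b - W.h a b := rfl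
  have h3 : (V.sub W).s' = V.s' - W.s' := rfl
  simp only [Variation.lag', h1, h2, h3, tr2_up2_comm _ _ _ S.G_symm, tr2_sub]
  ring

/-- Conformal variations of the Lagrangian are total derivatives, the Bach tensor being
trace-free. -/
theorem Variation.lag'_conformal {S : Geom D} (V : Variation S) (φ : A)
    (hV : ∀ a b, V.h a b = φ * S.g a b) {I : Ideal A} (hI : ∀ a b, V.h a b ∈ I)
    (hT : ∀ a b c, V.T a b c ∈ I) : 4 * V.lag' ∈ Exact D I := by
  have h := V.first_variation hI hT
  have h1 : tr2 V.k S.bac = 0 := by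
    have : ∀ a b, V.k a b = φ * S.G a b := by
      intro a b
      rw [← S.up2_g]
      simp only [Variation.k, up2, hV, Finset.mul_sum]
      exact Finset.sum_congr rfl fun a _ => Finset.sum_congr rfl fun b _ => by ring
    have h2 := S.bac_trace
    simp only [tr2, this, mul_assoc, ← Finset.mul_sum, h2, mul_zero]
  rwa [h1, mul_zero, sub_zero] at h

/-- Infinitesimal gauge invariance of the Weyl action. The variation minus its Lie part is conformal,
whatever connection and Schouten variations it carries. -/
theorem Variation.lag'_gauge {S : Geom D} (V : Variation S) (v : Fin 4 → A) (φ : A)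
    (hV : ∀ a b, V.h a b = lie2 D v S.g a b + φ * S.g a b) {I : Ideal A}
    (hD : ∀ a x, x ∈ I → D a x ∈ I) (hv : ∀ a, v a ∈ I) (hI : ∀ a b, V.h a b ∈ I)
    (hT : ∀ a b c, V.T a b c ∈ I) : 4 * V.lag' ∈ Exact D I := by
  have hl : ∀ (t : Fin 4 → Fin 4 → A) a b, lie2 D v t a b ∈ I := fun t a b =>
    I.sum_mem fun e _ => I.add_mem (I.add_mem (I.mul_mem_right _ (hv e))
      (I.mul_mem_right _ (hD _ _ (hv e)))) (I.mul_mem_right _ (hD _ _ (hv e)))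
  have hlΓ : ∀ a b c, lieΓ D v S.Γ a b c ∈ I := fun a b c =>
    I.add_mem (I.sum_mem fun e _ => I.add_mem (I.add_mem (I.sub_mem (I.mul_mem_right _ (hv e))
      (I.mul_mem_right _ (hD _ _ (hv _)))) (I.mul_mem_right _ (hD _ _ (hv e))))
      (I.mul_mem_right _ (hD _ _ (hv e)))) (hD _ _ (hD _ _ (hv a)))
  have h1 := (V.sub (Variation.lie S v)).lag'_conformal φ (fun a b => by
      change V.h a b - lie2 D v S.g a b = _
      rw [hV]; ring) (I := I) (fun a b => I.sub_mem (hI a b) (hl _ a b))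
      (fun a b c => I.sub_mem (hT a b c) (hlΓ a b c))
  have h2 : 4 * (Variation.lie S v).lag' ∈ Exact D I := by
    refine ⟨fun e => 4 * (v e * S.lag), fun e => I.mul_mem_left _ (I.mul_mem_right _ (hv e)), ?_⟩
    rw [Variation.lag'_lie, Finset.mul_sum]
    exact Finset.sum_congr rfl fun e _ => by
      simp only [Derivation.leibniz, smul_eq_mul, Geom.D_four]; ring
  have h3 := (Exact D I).add_mem h1 h2
  rw [Variation.lag'_sub] at h3
  convert h3 using 1
  ring

/-- `T` lies in every differential ideal containing `h`, by the formula for the connection in terms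
of the metric. -/
theorem Variation.T_mem {S : Geom D} (V : Variation S) {I : Ideal A}
    (hD : ∀ a x, x ∈ I → D a x ∈ I) (hI : ∀ a b, V.h a b ∈ I) (a b c : Fin 4) : V.T a b c ∈ I := by
  have h1 : ∀ c a b, nab2 D S.Γ V.h c a b ∈ I := fun c a b =>
    I.sub_mem (I.sub_mem (hD _ _ (hI _ _)) (I.sum_mem fun e _ => I.mul_mem_left _ (hI _ _)))
      (I.sum_mem fun e _ => I.mul_mem_left _ (hI _ _))
  have h2 : ∀ x : A, 2 * x ∈ I → x ∈ I := fun x hx => by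
    have := Submodule.smul_of_tower_mem I (1 / 2 : ℝ) hx
    have e : (2 : A) * x = (2 : ℝ) • x := by rw [two_mul, two_smul]
    rwa [e, smul_smul, one_div, inv_mul_cancel₀ two_ne_zero, one_smul] at this
  have h3 : ∀ p b d, V.τ p b d ∈ I := fun p b d => h2 _ (by
    rw [V.two_τ]
    exact I.sub_mem (I.add_mem (h1 _ _ _) (h1 _ _ _)) (h1 _ _ _))
  rw [← S.raise_lower (fun e => V.T e b c) a]
  exact I.sum_mem fun e _ => I.mul_mem_left _ (h3 e b c)

end

section

/-! ### Smooth functions as a differential ring -/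

/-- The algebra of smooth functions on a normed space. -/
def SmoothFun (X : Type*) [NormedAddCommGroup X] [NormedSpace ℝ X] : Subalgebra ℝ (X → ℝ) where
  carrier := {f | ContDiff ℝ ∞ f}
  mul_mem' := fun {f g} (hf : ContDiff ℝ ∞ f) (hg : ContDiff ℝ ∞ g) => hf.mul hg
  one_mem' := show ContDiff ℝ ∞ (fun _ : X => (1 : ℝ)) from contDiff_const
  add_mem' := fun {f g} (hf : ContDiff ℝ ∞ f) (hg : ContDiff ℝ ∞ g) => hf.add hg
  zero_mem' := show ContDiff ℝ ∞ (fun _ : X => (0 : ℝ)) from contDiff_const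
  algebraMap_mem' r := show ContDiff ℝ ∞ (fun _ : X => r) from contDiff_const

section

variable {X : Type*} [NormedAddCommGroup X] [NormedSpace ℝ X]

theorem smooth_coe (f : SmoothFun X) : ContDiff ℝ ∞ (f : X → ℝ) := f.2

theorem diff_coe (f : SmoothFun X) : Differentiable ℝ (f : X → ℝ) :=
  (smooth_coe f).differentiable (by simp)

/-- The derivative in a fixed direction. -/
def dir (v : X) : Derivation ℝ (SmoothFun X) (SmoothFun X) :=
  Derivation.mk'
    { toFun := fun f => ⟨fun x => fderiv ℝ (f : X → ℝ) x v,
        show ContDiff ℝ ∞ (fun x => fderiv ℝ (f : X → ℝ) x v) from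
          ((smooth_coe f).fderiv_right (m := ∞) (by simp)).clm_apply contDiff_const⟩
      map_add' := fun f g => by
        ext x
        change fderiv ℝ ((f : X → ℝ) + (g : X → ℝ)) x v = fderiv ℝ f x v + fderiv ℝ g x v
        rw [fderiv_add (diff_coe f x) ((diff_coe g) x)]; rfl
      map_smul' := fun c f => by
        ext x
        change fderiv ℝ (c • (f : X → ℝ)) x v = c • fderiv ℝ f x v
        rw [fderiv_const_smul (diff_coe f x)]; rfl }
    fun f g => by
      ext x
      change fderiv ℝ ((f : X → ℝ) * (g : X → ℝ)) x v = f.1 x * fderiv ℝ g x v + g.1 x * fderiv ℝ f x v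
      rw [fderiv_mul (diff_coe f x) ((diff_coe g) x)]; rfl

theorem dir_comm (v w : X) (f : SmoothFun X) : dir v (dir w f) = dir w (dir v f) := by
  ext x
  have h : ∀ v w : X, (dir v (dir w f) : X → ℝ) x = fderiv ℝ (fderiv ℝ (f : X → ℝ)) x v w := by
    intro v w
    change fderiv ℝ (fun x => fderiv ℝ (f : X → ℝ) x w) x v = _
    rw [fderiv_clm_apply
      ((((smooth_coe f).fderiv_right (m := ∞) (by simp)).differentiable (by simp)) x)
      (differentiableAt_const w)]
    simp
  rw [h, h]
  exact ((smooth_coe f).contDiffAt (x := x)).isSymmSndFDerivAt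
    (by rw [minSmoothness_of_isRCLikeNormedField]; exact WithTop.coe_le_coe.2 le_top) v w

end

/-! ### The geometry of a smooth metric -/

section

variable {A : Type*} [CommRing A] [Algebra ℝ A]

theorem deriv_det (δ : Derivation ℝ A A) (M : Matrix (Fin 4) (Fin 4) A) :
    δ M.det = ∑ a, ∑ b, M.adjugate a b * δ (M b a) := by
  simp only [Matrix.adjugate_fin_succ_eq_det_submatrix, Matrix.det_succ_row_zero (n := 3),
    Matrix.det_fin_three, Matrix.submatrix_apply, Fin.sum_univ_four, map_add, map_sub,
    Derivation.leibniz, smul_eq_mul, Fin.succAbove]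
  simp
  ring

theorem half_smul (x : A) : 2 * ((1 / 2 : ℝ) • x) = x := by
  rw [mul_smul_comm, two_mul, ← two_smul ℝ, smul_smul]; norm_num

theorem two_mul_sqrt_deriv (δ : Derivation ℝ A A) (M G : Matrix (Fin 4) (Fin 4) A) (s : A)
    (hG : G * M = 1) (hs : s * s = -M.det) (hu : IsUnit s) :
    2 * δ s = s * tr2 G (fun a b => δ (M b a)) := by
  have h1 : M.adjugate = M.det • G := by
    calc M.adjugate = (G * M) * M.adjugate := by rw [hG, one_mul]
      _ = G * (M * M.adjugate) := by rw [mul_assoc]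
      _ = M.det • G := by rw [Matrix.mul_adjugate]; simp
  have h2 := congrArg δ hs
  rw [map_neg, deriv_det, Derivation.leibniz] at h2
  simp only [h1, Matrix.smul_apply, smul_eq_mul, mul_assoc, ← Finset.mul_sum] at h2
  apply hu.mul_left_cancel
  simp only [tr2]
  linear_combination h2 - (∑ a, ∑ b, G a b * δ (M b a)) * hs

theorem inverse_isSymm (M G : Matrix (Fin 4) (Fin 4) A) (hM : M.IsSymm) (hG : G * M = 1) :
    G.IsSymm := by
  have h1 : M * Gᵀ = 1 := by
    have := congrArg Matrix.transpose hG
    rwa [Matrix.transpose_mul, hM.eq, Matrix.transpose_one] at this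
  calc Gᵀ = (G * M) * Gᵀ := by rw [hG, one_mul]
    _ = G * (M * Gᵀ) := by rw [mul_assoc]
    _ = G := by rw [h1, mul_one]

/-- The geometry of a symmetric invertible matrix with a square root `s` of `-det`. -/
def Geom.ofMatrix (D : Fin 4 → Derivation ℝ A A) (comm : ∀ a b x, D a (D b x) = D b (D a x))
    (M G : Matrix (Fin 4) (Fin 4) A) (s : A) (hM : M.IsSymm) (hG : G * M = 1)
    (hs : s * s = -M.det) (hu : IsUnit s) : Geom D where
  g := M
  G := G
  Γ a b c := (1 / 2 : ℝ) • ∑ d, G a d * (D b (M d c) + D c (M d b) - D d (M b c))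
  K a b :=
    let Γ : Fin 4 → Fin 4 → Fin 4 → A :=
      fun a b c => (1 / 2 : ℝ) • ∑ d, G a d * (D b (M d c) + D c (M d b) - D d (M b c))
    (1 / 2 : ℝ) • (ricD D Γ a b - (1 / 6 : ℝ) • (M a b * tr2 G (ricD D Γ)))
  s := s
  comm := comm
  g_symm a b := hM.apply b a
  G_symm a b := congrFun (congrFun (inverse_isSymm M G hM hG) b) a
  gG a b := by
    have h : M * G = 1 := mul_eq_one_comm.mp hG
    rw [← Matrix.mul_apply, h, Matrix.one_apply]
  Γ_symm a b c := by
    congr 1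
    refine Finset.sum_congr rfl fun d _ => ?_
    rw [hM.apply c b, add_comm (D b _)]
  compat c a b := by
    have h : ∀ (w : Fin 4 → A) b, ∑ e, (∑ d, G e d * w d) * M e b = w b := by
      intro w b
      have h1 : M * G = 1 := mul_eq_one_comm.mp hG
      have h2 : ∀ d, ∑ e, M b e * G e d = if b = d then 1 else 0 := fun d => by
        rw [← Matrix.mul_apply, h1, Matrix.one_apply]
      have h3 : ∑ e, (∑ d, G e d * w d) * M e b = ∑ d, (∑ e, M b e * G e d) * w d := by
        simp only [Finset.sum_mul]
        rw [Finset.sum_comm]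
        exact Finset.sum_congr rfl fun d _ => Finset.sum_congr rfl fun e _ => by
          rw [hM.apply b e]; ring
      simp [h3, h2]
    have h' : ∀ (w : Fin 4 → A), ∑ e, (∑ d, G e d * w d) * M a e = w a := fun w => by
      rw [← h w a]
      exact Finset.sum_congr rfl fun e _ => by rw [hM.apply e a]
    simp only [smul_mul_assoc, ← Finset.smul_sum, h, h', ← smul_add]
    apply Geom.two_cancel
    rw [half_smul, hM.apply a b, hM.apply b c, hM.apply a c]
    ring
  schout a b := by
    have hGs : ∀ a b, G a b = G b a := fun a b => congrFun (congrFun (inverse_isSymm M G hM hG) b) a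
    have h1 : tr2 G M = 4 := by
      have h : M * G = 1 := mul_eq_one_comm.mp hG
      have : tr2 G M = (M * G).trace := by
        simp only [tr2, Matrix.trace, Matrix.diag, Matrix.mul_apply]
        exact Finset.sum_congr rfl fun i _ => Finset.sum_congr rfl fun j _ => by
          rw [hGs i j, mul_comm]
      rw [this, h]
      simp
    set r := ricD D fun a b c => (1 / 2 : ℝ) • ∑ d, G a d * (D b (M d c) + D c (M d b) - D d (M b c))
    have h2 : tr2 G (fun a b => (1 / 2 : ℝ) • (r a b - (1 / 6 : ℝ) • (M a b * tr2 G r)))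
        = (1 / 6 : ℝ) • tr2 G r := by
      have : tr2 G (fun a b => (1 / 2 : ℝ) • (r a b - (1 / 6 : ℝ) • (M a b * tr2 G r)))
          = (1 / 2 : ℝ) • (tr2 G r - (1 / 6 : ℝ) • (tr2 G M * tr2 G r)) := by
        simp only [tr2, mul_smul_comm, ← Finset.smul_sum, mul_sub, Finset.sum_sub_distrib,
          ← mul_assoc, ← Finset.sum_mul]
      rw [this, h1, show (4 : A) * tr2 G r = (4 : ℝ) • tr2 G r by
        rw [Algebra.smul_def, map_ofNat], smul_smul, ← one_smul ℝ (tr2 G r), smul_smul, smul_smul,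
        ← sub_smul, smul_smul]
      norm_num
    rw [h2, half_smul, smul_mul_assoc, mul_comm (M a b)]
    abel
  Ds a := by
    apply Geom.two_cancel
    rw [two_mul_sqrt_deriv _ M G s hG hs hu, mul_left_comm]
    congr 1
    have hGs : ∀ a b, G a b = G b a := fun a b => congrFun (congrFun (inverse_isSymm M G hM hG) b) a
    rw [← Finset.smul_sum, half_smul]
    have h1 : ∑ e, ∑ d, G e d * D e (M d a) = ∑ e, ∑ d, G e d * D d (M e a) := by
      rw [Finset.sum_comm]
      exact Finset.sum_congr rfl fun e _ => Finset.sum_congr rfl fun d _ => by rw [hGs]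
    simp only [tr2, mul_sub, mul_add, Finset.sum_add_distrib, Finset.sum_sub_distrib, h1]
    abel
  s_unit := hu

end

end

section

/-! ### Families of metrics -/

section

variable {E : Type*} [NormedAddCommGroup E] [NormedSpace ℝ E]

/-- The partial derivative `∂_a` on functions of a parameter and a spacetime point. -/
def sdir (E : Type*) [NormedAddCommGroup E] [NormedSpace ℝ E] (a : Fin 4) :
    Derivation ℝ (SmoothFun (E × Spacetime)) (SmoothFun (E × Spacetime)) :=
  dir (0, Pi.single a 1)

/-- Evaluation of smooth functions at a point. -/
def ev {X : Type*} [NormedAddCommGroup X] [NormedSpace ℝ X] (x : X) : SmoothFun X →ₐ[ℝ] ℝ where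
  toFun f := f.1 x
  map_one' := rfl
  map_mul' _ _ := rfl
  map_zero' := rfl
  map_add' _ _ := rfl
  commutes' _ := rfl

theorem ev_ext {X : Type*} [NormedAddCommGroup X] [NormedSpace ℝ X] {f g : SmoothFun X}
    (h : ∀ x, ev x f = ev x g) : f = g := Subtype.ext (funext h)

/-- Restriction to a fixed value of the parameter. -/
def slice (p : E) (f : SmoothFun (E × Spacetime)) : ScalarField := fun x => ev (p, x) f

theorem slice_contDiff (p : E) (f : SmoothFun (E × Spacetime)) : ContDiff ℝ ∞ (slice p f) :=
  (smooth_coe f).comp (contDiff_const.prodMk contDiff_id)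

theorem pd_slice (p : E) (f : SmoothFun (E × Spacetime)) (a : Fin 4) :
    pd a (slice p f) = slice p (sdir E a f) := by
  ext x
  change fderiv ℝ ((f : E × Spacetime → ℝ) ∘ fun y => (p, y)) x (Pi.single a 1)
    = fderiv ℝ (f : E × Spacetime → ℝ) (p, x) (0, Pi.single a 1)
  have h : HasFDerivAt (fun y : Spacetime => (p, y)) (ContinuousLinearMap.inr ℝ E Spacetime) x :=
    hasFDerivAt_prodMk_right p x
  rw [((diff_coe f (p, x)).hasFDerivAt.comp x h).fderiv]
  simp

variable (M : Matrix (Fin 4) (Fin 4) (SmoothFun (E × Spacetime)))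

/-- The tensor field with components `M a b` at the parameter `p`. -/
def fieldAt (p : E) : TensorField := fun x => Matrix.of fun a b => slice p (M a b) x

theorem ev_det {X : Type*} [NormedAddCommGroup X] [NormedSpace ℝ X]
    (M : Matrix (Fin 4) (Fin 4) (SmoothFun X)) (x : X) : ev x M.det = (M.map (ev x)).det :=
  (ev x).map_det M

/-- The reciprocal of a negative determinant of smooth functions. -/
def detInv {X : Type*} [NormedAddCommGroup X] [NormedSpace ℝ X]
    (M : Matrix (Fin 4) (Fin 4) (SmoothFun X)) (hdet : ∀ x, ev x M.det < 0) : SmoothFun X :=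
  ⟨fun x => (ev x M.det)⁻¹, show ContDiff ℝ ∞ (fun x => (ev x M.det)⁻¹) from
    (smooth_coe M.det).inv fun x => (hdet x).ne⟩

theorem detInv_mul {X : Type*} [NormedAddCommGroup X] [NormedSpace ℝ X]
    (M : Matrix (Fin 4) (Fin 4) (SmoothFun X)) (hdet : ∀ x, ev x M.det < 0) :
    detInv M hdet * M.det = 1 :=
  ev_ext fun x => inv_mul_cancel₀ (hdet x).ne

/-- The inverse of a matrix of smooth functions with negative determinant. -/
def smoothInv {X : Type*} [NormedAddCommGroup X] [NormedSpace ℝ X]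
    (M : Matrix (Fin 4) (Fin 4) (SmoothFun X))
    (hdet : ∀ x, ev x M.det < 0) : Matrix (Fin 4) (Fin 4) (SmoothFun X) :=
  detInv M hdet • M.adjugate

/-- The square root of minus a negative determinant. -/
def smoothVol {X : Type*} [NormedAddCommGroup X] [NormedSpace ℝ X]
    (M : Matrix (Fin 4) (Fin 4) (SmoothFun X))
    (hdet : ∀ x, ev x M.det < 0) : SmoothFun X :=
  ⟨fun x => Real.sqrt (-ev x M.det),
    ContDiff.sqrt (smooth_coe M.det).neg fun x => (neg_pos.2 (hdet x)).ne'⟩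

theorem smoothInv_mul {X : Type*} [NormedAddCommGroup X] [NormedSpace ℝ X]
    (M : Matrix (Fin 4) (Fin 4) (SmoothFun X)) (hdet : ∀ x, ev x M.det < 0) :
    smoothInv M hdet * M = 1 := by
  rw [smoothInv, smul_mul_assoc, Matrix.adjugate_mul, smul_smul, detInv_mul, one_smul]

theorem smoothVol_sq {X : Type*} [NormedAddCommGroup X] [NormedSpace ℝ X]
    (M : Matrix (Fin 4) (Fin 4) (SmoothFun X)) (hdet : ∀ x, ev x M.det < 0) :
    smoothVol M hdet * smoothVol M hdet = -M.det :=
  ev_ext fun x => Real.mul_self_sqrt (neg_pos.2 (hdet x)).le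

theorem smoothVol_isUnit {X : Type*} [NormedAddCommGroup X] [NormedSpace ℝ X]
    (M : Matrix (Fin 4) (Fin 4) (SmoothFun X)) (hdet : ∀ x, ev x M.det < 0) :
    IsUnit (smoothVol M hdet) := by
  have h : ∀ x, Real.sqrt (-ev x M.det) ≠ 0 := fun x => (Real.sqrt_pos.2 (neg_pos.2 (hdet x))).ne'
  exact IsUnit.of_mul_eq_one
    (⟨fun x => (Real.sqrt (-ev x M.det))⁻¹, (smooth_coe (smoothVol M hdet)).inv h⟩ : SmoothFun X)
    (ev_ext fun x => mul_inv_cancel₀ (h x))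

/-- The geometry of a smooth family of metrics. -/
def geomOf (hM : M.IsSymm) (hdet : ∀ x, ev x M.det < 0) : Geom (sdir E) :=
  Geom.ofMatrix (sdir E) (fun _ _ x => dir_comm _ _ x) M (smoothInv M hdet) (smoothVol M hdet) hM
    (smoothInv_mul M hdet) (smoothVol_sq M hdet) (smoothVol_isUnit M hdet)

variable {M} (hM : M.IsSymm) (hdet : ∀ x, ev x M.det < 0) (p : E)

theorem geomOf_vol (δ : Derivation ℝ (SmoothFun (E × Spacetime)) (SmoothFun (E × Spacetime))) :
    2 * δ (geomOf M hM hdet).s = (geomOf M hM hdet).s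
      * tr2 (geomOf M hM hdet).G (fun a b => δ ((geomOf M hM hdet).g a b)) := by
  have := two_mul_sqrt_deriv δ M (smoothInv M hdet) (smoothVol M hdet) (smoothInv_mul M hdet)
    (smoothVol_sq M hdet) (smoothVol_isUnit M hdet)
  simp only [fun a b => hM.apply a b] at this
  exact this

theorem inv_fieldAt (a b : Fin 4) :
    inv (fieldAt M p) a b = slice p ((geomOf M hM hdet).G a b) := by
  ext x
  have h : (smoothInv M hdet).map (ev (p, x)) * fieldAt M p x = 1 := by
    have h1 : fieldAt M p x = M.map (ev (p, x)) := rfl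
    rw [h1, ← Matrix.map_mul, smoothInv_mul]
    simp
  change (fieldAt M p x)⁻¹ a b = (smoothInv M hdet).map (ev (p, x)) a b
  rw [Matrix.inv_eq_left_inv h]

theorem christoffel_fieldAt (a b c : Fin 4) :
    christoffel (fieldAt M p) a b c = slice p ((geomOf M hM hdet).Γ a b c) := by
  ext x
  have h : ∀ d b c, pd d (fun y => fieldAt M p y b c) = slice p (sdir E d (M b c)) := fun d b c =>
    pd_slice p (M b c) d
  simp only [christoffel, inv_fieldAt hM hdet, h]
  change _ = ev (p, x) ((1 / 2 : ℝ) • ∑ d, smoothInv M hdet a d * (sdir E b (M d c)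
    + sdir E c (M d b) - sdir E d (M b c)))
  simp only [map_smul, map_sum, map_mul, map_add, map_sub, smul_eq_mul]
  rfl

theorem riemann_fieldAt (a b c d : Fin 4) :
    riemann (fieldAt M p) a b c d
      = slice p (riemD (sdir E) (geomOf M hM hdet).Γ a b c d) := by
  ext x
  simp only [riemann, christoffel_fieldAt hM hdet, pd_slice, riemD, slice, map_sum, map_mul,
    map_add, map_sub]

theorem ricci_fieldAt (a b : Fin 4) :
    ricci (fieldAt M p) a b = slice p (ricD (sdir E) (geomOf M hM hdet).Γ a b) := by
  ext x
  simp only [ricci, riemann_fieldAt hM hdet, ricD, slice, map_sum]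

theorem scalarCurv_fieldAt : scalarCurv (fieldAt M p)
    = slice p (tr2 (geomOf M hM hdet).G (ricD (sdir E) (geomOf M hM hdet).Γ)) := by
  ext x
  simp only [scalarCurv, ricci_fieldAt hM hdet, inv_fieldAt hM hdet, tr2, slice, map_sum, map_mul]

theorem schouten_fieldAt (a b : Fin 4) :
    schouten (fieldAt M p) a b = slice p ((geomOf M hM hdet).K a b) := by
  ext x
  simp only [schouten, ricci_fieldAt hM hdet, scalarCurv_fieldAt hM hdet]
  change _ = ev (p, x) ((1 / 2 : ℝ) • (ricD (sdir E) (geomOf M hM hdet).Γ a b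
    - (1 / 6 : ℝ) • (M a b * tr2 (geomOf M hM hdet).G (ricD (sdir E) (geomOf M hM hdet).Γ))))
  simp only [map_smul, map_mul, map_sub, smul_eq_mul, fieldAt, slice, Matrix.of_apply, mul_assoc]

theorem weyl_fieldAt (a b c d : Fin 4) :
    weyl (fieldAt M p) a b c d = slice p ((geomOf M hM hdet).wey a b c d) := by
  ext x
  have hg : ∀ b c, fieldAt M p x b c = ev (p, x) ((geomOf M hM hdet).g b c) := fun _ _ => rfl
  simp only [weyl, riemann_fieldAt hM hdet, schouten_fieldAt hM hdet, inv_fieldAt hM hdet, hg,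
    Geom.wey, slice, map_sum, map_mul, map_add, map_sub, apply_ite (ev (p, x)), map_one, map_zero]

theorem weylLow_fieldAt (a b c d : Fin 4) :
    weylLow (fieldAt M p) a b c d = slice p ((geomOf M hM hdet).weyLow a b c d) := by
  ext x
  have hg : ∀ b c, fieldAt M p x b c = ev (p, x) ((geomOf M hM hdet).g b c) := fun _ _ => rfl
  simp only [weylLow, weyl_fieldAt hM hdet, hg, Geom.weyLow, slice, map_sum, map_mul]

theorem cotton_fieldAt (a b c : Fin 4) :
    cotton (fieldAt M p) a b c = slice p ((geomOf M hM hdet).cot a b c) := by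
  ext x
  have h : schouten (fieldAt M p) = fun a b => slice p ((geomOf M hM hdet).K a b) := by
    ext a b; rw [schouten_fieldAt hM hdet]
  simp only [cotton, cov2, h, pd_slice, christoffel_fieldAt hM hdet, Geom.cot, nab2, slice,
    map_sum, map_mul, map_sub]

theorem bachLow_fieldAt (a b : Fin 4) :
    bachLow (fieldAt M p) a b = slice p ((geomOf M hM hdet).bac a b) := by
  ext x
  have h : cotton (fieldAt M p) = fun a b c => slice p ((geomOf M hM hdet).cot a b c) := by
    ext a b c; rw [cotton_fieldAt hM hdet]
  simp only [bachLow, cov3, h, pd_slice, christoffel_fieldAt hM hdet, schouten_fieldAt hM hdet,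
    weylLow_fieldAt hM hdet, inv_fieldAt hM hdet, Geom.bac, nab3, slice,
    map_sum, map_mul, map_sub, map_add, map_neg, map_ofNat]

/-- The Lagrangian density of a metric `g` and a tensor field `t`. -/
def bachLag (g t : TensorField) : ScalarField := fun x =>
  Real.sqrt (-(g x).det) * ∑ μ, ∑ ν, t x μ ν * bach g μ ν x

theorem bachLag_fieldAt (t : Matrix (Fin 4) (Fin 4) (SmoothFun (E × Spacetime))) :
    bachLag (fieldAt M p) (fieldAt t p) = slice p ((geomOf M hM hdet).s
      * tr2 (up2 (geomOf M hM hdet).G t) (geomOf M hM hdet).bac) := by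
  ext x
  have h1 : Real.sqrt (-(fieldAt M p x).det) = ev (p, x) (geomOf M hM hdet).s := by
    change _ = Real.sqrt (-ev (p, x) M.det)
    rw [ev_det]; rfl
  have h2 : tr2 (up2 (geomOf M hM hdet).G t) (geomOf M hM hdet).bac
      = tr2 t (up2 (geomOf M hM hdet).G (geomOf M hM hdet).bac) := by
    simp only [tr2, up2, Finset.sum_mul, Finset.mul_sum]
    rw [sum_comm22]
    refine Finset.sum_congr rfl fun a _ => Finset.sum_congr rfl fun b _ =>
      Finset.sum_congr rfl fun c _ => Finset.sum_congr rfl fun d _ => ?_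
    rw [(geomOf M hM hdet).G_symm a c, (geomOf M hM hdet).G_symm b d]; ring
  rw [h2, bachLag, slice, map_mul, h1]
  simp only [bach, bachLow_fieldAt hM hdet, inv_fieldAt hM hdet, tr2, up2, map_sum, map_mul]
  rfl

end

end

section

/-! ### Change of ring -/

section

variable {A : Type*} [CommRing A] [Algebra ℝ A] {D : Fin 4 → Derivation ℝ A A}

/-- The image of a geometry under a homomorphism of differential rings. -/
def Geom.map (S : Geom D) (Φ : A →ₐ[ℝ] A) (hΦ : ∀ a x, Φ (D a x) = D a (Φ x)) : Geom D where
  g a b := Φ (S.g a b)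
  G a b := Φ (S.G a b)
  Γ a b c := Φ (S.Γ a b c)
  K a b := Φ (S.K a b)
  s := Φ S.s
  comm := S.comm
  g_symm a b := by rw [S.g_symm]
  G_symm a b := by rw [S.G_symm]
  gG a b := by
    have := congrArg Φ (S.gG a b)
    simpa only [map_sum, map_mul, apply_ite Φ, map_one, map_zero] using this
  Γ_symm a b c := by rw [S.Γ_symm]
  compat c a b := by
    have := congrArg Φ (S.compat c a b)
    simpa only [map_sum, map_mul, map_add, hΦ] using this
  schout a b := by
    have := congrArg Φ (S.schout a b)
    simpa only [ricD, riemD, tr2, map_sum, map_mul, map_add, map_sub, map_ofNat, hΦ] using this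
  Ds a := by
    have := congrArg Φ (S.Ds a)
    simpa only [map_sum, map_mul, hΦ] using this
  s_unit := S.s_unit.map Φ

/-- The image of a variation under a homomorphism of differential rings. -/
def Variation.map {S : Geom D} (V : Variation S) (Φ : A →ₐ[ℝ] A)
    (hΦ : ∀ a x, Φ (D a x) = D a (Φ x)) : Variation (S.map Φ hΦ) where
  h a b := Φ (V.h a b)
  T a b c := Φ (V.T a b c)
  K' a b := Φ (V.K' a b)
  s' := Φ V.s'
  h_symm a b := by rw [V.h_symm]
  T_symm a b c := by rw [V.T_symm]
  compat' c a b := by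
    have := congrArg Φ (V.compat' c a b)
    simpa only [Geom.map, nab2, map_sum, map_mul, map_add, map_sub, hΦ] using this
  schout' a b := by
    have := congrArg Φ (V.schout' a b)
    simpa only [Geom.map, ricVar, tr2, up2, Geom.κ, map_sum, map_mul, map_add, map_sub, map_ofNat, hΦ]
      using this
  vol' := by
    have := congrArg Φ V.vol'
    simpa only [Geom.map, tr2, map_sum, map_mul, map_ofNat] using this

theorem Variation.lag'_map {S : Geom D} (V : Variation S) (Φ : A →ₐ[ℝ] A)
    (hΦ : ∀ a x, Φ (D a x) = D a (Φ x)) : (V.map Φ hΦ).lag' = Φ V.lag' := by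
  simp only [Variation.lag', Geom.normK, Geom.KK, Geom.κ, tr2, up2, map_sum, map_mul, map_add,
    map_sub, map_pow, map_ofNat]
  rfl

theorem two_mul_mem {I : Ideal A} {x : A} (hx : 2 * x ∈ I) : x ∈ I := by
  have := Submodule.smul_of_tower_mem I (1 / 2 : ℝ) hx
  have e : (2 : A) * x = (2 : ℝ) • x := by rw [two_mul, two_smul]
  rwa [e, smul_smul, one_div, inv_mul_cancel₀ two_ne_zero, one_smul] at this

theorem tr2_mem {I : Ideal A} {G t : Fin 4 → Fin 4 → A} (h : ∀ a b, t a b ∈ I) : tr2 G t ∈ I :=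
  I.sum_mem fun _ _ => I.sum_mem fun _ _ => I.mul_mem_left _ (h _ _)

theorem tr2_mem_left {I : Ideal A} {G t : Fin 4 → Fin 4 → A} (h : ∀ a b, G a b ∈ I) :
    tr2 G t ∈ I :=
  I.sum_mem fun _ _ => I.sum_mem fun _ _ => I.mul_mem_right _ (h _ _)

theorem up2_mem {I : Ideal A} {G t : Fin 4 → Fin 4 → A} (h : ∀ a b, t a b ∈ I) (a b : Fin 4) :
    up2 G t a b ∈ I :=
  I.sum_mem fun _ _ => I.sum_mem fun _ _ => I.mul_mem_left _ (h _ _)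

theorem Variation.K'_mem {S : Geom D} (V : Variation S) {I : Ideal A}
    (hD : ∀ a x, x ∈ I → D a x ∈ I) (hI : ∀ a b, V.h a b ∈ I) (a b : Fin 4) : V.K' a b ∈ I := by
  have hT := V.T_mem hD hI
  have hr : ∀ a b, ricVar D S.Γ V.T a b ∈ I := fun a b => by
    refine I.sum_mem fun c _ => I.sub_mem (I.add_mem (hD _ _ (hT _ _ _)) (I.sum_mem fun e _ => ?_))
      (I.add_mem (hD _ _ (hT _ _ _)) (I.sum_mem fun e _ => ?_)) <;>
    exact I.add_mem (I.mul_mem_right _ (hT _ _ _)) (I.mul_mem_left _ (hT _ _ _))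
  have h1 : ∀ a b, 2 * V.K' a b + tr2 S.G V.K' * S.g a b ∈ I := fun a b => by
    have : 2 * V.K' a b + tr2 S.G V.K' * S.g a b = ricVar D S.Γ V.T a b
        + tr2 (up2 S.G V.h) S.K * S.g a b - S.κ * V.h a b := by
      rw [V.schout']; ring
    rw [this]
    exact I.sub_mem (I.add_mem (hr a b) (I.mul_mem_right _ (tr2_mem_left (up2_mem hI))))
      (I.mul_mem_left _ (hI a b))
  have h2 : tr2 S.G V.K' ∈ I := by
    have h3 : tr2 S.G S.g = 4 := by
      simp only [tr2]
      rw [Finset.sum_congr rfl fun a _ => Finset.sum_congr rfl fun b _ => by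
        rw [S.g_symm a b]]
      simp [S.Gg]
    have h4 : tr2 S.G (fun a b => 2 * V.K' a b + tr2 S.G V.K' * S.g a b) ∈ I := tr2_mem h1
    rw [tr2_add, tr2_mul, tr2_mul, h3] at h4
    have h5 : (2 * tr2 S.G V.K' + tr2 S.G V.K' * 4) = (6 : ℝ) • tr2 S.G V.K' := by
      rw [Algebra.smul_def, map_ofNat]; ring
    rw [h5] at h4
    have := Submodule.smul_of_tower_mem I (1 / 6 : ℝ) h4
    rwa [smul_smul, one_div, inv_mul_cancel₀ (by norm_num), one_smul] at this
  apply two_mul_mem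
  have := I.sub_mem (h1 a b) (I.mul_mem_right (S.g a b) h2)
  rwa [add_sub_cancel_right] at this

/-- The first variation of the Lagrangian lies in every differential ideal containing `h`. -/
theorem Variation.lag'_mem {S : Geom D} (V : Variation S) {I : Ideal A}
    (hD : ∀ a x, x ∈ I → D a x ∈ I) (hI : ∀ a b, V.h a b ∈ I) : V.lag' ∈ I := by
  have hK := V.K'_mem hD hI
  have hs : V.s' ∈ I := two_mul_mem (by rw [V.vol']; exact I.mul_mem_left _ (tr2_mem hI))
  refine I.add_mem (I.mul_mem_right _ hs) (I.mul_mem_left _ (I.sub_mem (I.sub_mem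
    (I.mul_mem_left _ (tr2_mem hK)) (I.mul_mem_left _ (tr2_mem_left (up2_mem hI))))
    (I.mul_mem_left _ (I.sub_mem (tr2_mem hK) (tr2_mem_left (up2_mem hI))))))

end

/-! ### Integration over spacetime -/

section

variable {E : Type*} [NormedAddCommGroup E] [NormedSpace ℝ E]

/-- The ideal of functions vanishing outside `K`. -/
def vanOff (E : Type*) [NormedAddCommGroup E] [NormedSpace ℝ E] (K : Set Spacetime) :
    Ideal (SmoothFun (E × Spacetime)) where
  carrier := {f | ∀ p, ∀ x ∉ K, ev (p, x) f = 0}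
  add_mem' := fun {f g} hf hg p x hx => by rw [map_add, hf p x hx, hg p x hx, add_zero]
  zero_mem' := fun p x _ => map_zero _
  smul_mem' := fun c f hf p x hx => by rw [smul_eq_mul, map_mul, hf p x hx, mul_zero]

theorem dir_mem_vanOff {K : Set Spacetime} (hK : IsClosed K) (v : E × Spacetime)
    {f : SmoothFun (E × Spacetime)} (hf : f ∈ vanOff E K) : dir v f ∈ vanOff E K := by
  intro p x hx
  change fderiv ℝ (f : E × Spacetime → ℝ) (p, x) v = 0
  have h : (f : E × Spacetime → ℝ) =ᶠ[𝓝 (p, x)] fun _ => 0 := by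
    have h1 : ∀ᶠ z : E × Spacetime in 𝓝 (p, x), z.2 ∈ Kᶜ :=
      continuous_snd.continuousAt.eventually_mem (hK.isOpen_compl.mem_nhds hx)
    filter_upwards [h1] with z hz using hf z.1 z.2 hz
  rw [h.fderiv_eq]
  simp

theorem slice_hasCompactSupport {K : Set Spacetime} (hK : IsCompact K)
    {f : SmoothFun (E × Spacetime)} (hf : f ∈ vanOff E K) (p : E) :
    HasCompactSupport (slice p f) :=
  HasCompactSupport.intro hK fun x hx => hf p x hx

theorem slice_integrable {K : Set Spacetime} (hK : IsCompact K)
    {f : SmoothFun (E × Spacetime)} (hf : f ∈ vanOff E K) (p : E) : Integrable (slice p f) :=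
  (slice_contDiff p f).continuous.integrable_of_hasCompactSupport (slice_hasCompactSupport hK hf p)

/-- The divergence theorem for compactly supported smooth fields. -/
theorem integral_exact {K : Set Spacetime} (hK : IsCompact K) {f : SmoothFun (E × Spacetime)}
    (hf : f ∈ Exact (sdir E) (vanOff E K)) (p : E) : ∫ x, slice p f x = 0 := by
  obtain ⟨J, hJ, rfl⟩ := hf
  have h1 : ∀ a, sdir E a (J a) ∈ vanOff E K := fun a => dir_mem_vanOff hK.isClosed _ (hJ a)
  have h2 : slice p (∑ a, sdir E a (J a)) = fun x => ∑ a, slice p (sdir E a (J a)) x := by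
    ext x; simp only [slice, map_sum]
  rw [h2, integral_finsetSum _ fun a _ => slice_integrable hK (h1 a) p]
  refine Finset.sum_eq_zero fun a _ => ?_
  have h3 := integral_mul_fderiv_eq_neg_fderiv_mul_of_integrable (μ := (volume : Measure Spacetime))
    (f := fun _ => (1 : ℝ)) (g := slice p (J a)) (v := Pi.single a 1)
    (by simp) (by
      simp only [one_mul]
      have := slice_integrable hK (h1 a) p
      rw [← pd_slice] at this
      exact this)
    (by simpa using slice_integrable hK (hJ a) p) (fun _ _ => differentiableAt_const _)
    (fun x _ => (slice_contDiff p (J a)).differentiable (by simp) x)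
  rw [← pd_slice]
  simpa [pd] using h3

theorem hasDerivAt_integral_slice [FiniteDimensional ℝ E] {K : Set Spacetime} (hK : IsCompact K)
    {f : SmoothFun (E × Spacetime)} (hf : f ∈ vanOff E K) (p w : E) :
    HasDerivAt (fun s : ℝ => ∫ x, slice (p + s • w) f x) (∫ x, slice p (dir (w, 0) f) x) 0 := by
  have hf' : dir (w, 0) f ∈ vanOff E K := dir_mem_vanOff hK.isClosed _ hf
  obtain ⟨C, hC⟩ : ∃ C, ∀ s ∈ Metric.closedBall (0 : ℝ) 1, ∀ x ∈ K,
      ‖slice (p + s • w) (dir (w, 0) f) x‖ ≤ C := by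
    have hcont : Continuous fun z : ℝ × Spacetime => slice (p + z.1 • w) (dir (w, 0) f) z.2 :=
      (smooth_coe (dir (w, 0) f)).continuous.comp
        ((continuous_const.add (continuous_fst.smul continuous_const)).prodMk continuous_snd)
    obtain ⟨C, hC⟩ := ((isCompact_closedBall (0 : ℝ) 1).prod hK).exists_bound_of_continuousOn
      hcont.continuousOn
    exact ⟨C, fun s hs x hx => hC (s, x) ⟨hs, hx⟩⟩
  have key := hasDerivAt_integral_of_dominated_loc_of_deriv_le (μ := (volume : Measure Spacetime))
    (F := fun (s : ℝ) x => slice (p + s • w) f x)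
    (F' := fun (s : ℝ) x => slice (p + s • w) (dir (w, 0) f) x)
    (x₀ := 0) (bound := K.indicator fun _ => C) (Metric.closedBall_mem_nhds (0 : ℝ) one_pos)
    (Eventually.of_forall fun s => (slice_contDiff _ f).continuous.aestronglyMeasurable)
    (slice_integrable hK hf _) (slice_contDiff _ _).continuous.aestronglyMeasurable
    (Eventually.of_forall fun x s hs => ?_)
    ((integrable_indicator_iff hK.measurableSet).2
      (integrableOn_const hK.measure_lt_top.ne))
    (Eventually.of_forall fun x s _ => ?_)
  · simpa using key.2
  · by_cases hx : x ∈ K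
    · rw [Set.indicator_of_mem hx]; exact hC s hs x hx
    · rw [Set.indicator_of_notMem hx, slice, hf' _ _ hx, norm_zero]
  · have h1 : HasDerivAt (fun s : ℝ => (p + s • w, x)) (w, (0 : Spacetime)) s := by
      have : HasDerivAt (fun s : ℝ => p + s • w) w s := by
        simpa using ((hasDerivAt_id s).smul_const w).const_add p
      exact this.prodMk (hasDerivAt_const s x)
    exact (diff_coe f _).hasFDerivAt.comp_hasDerivAt s h1

/-- Evaluation of the parameter at `p`, as an endomorphism of the ring of smooth functions. -/
def freeze (p : E) : SmoothFun (E × Spacetime) →ₐ[ℝ] SmoothFun (E × Spacetime) where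
  toFun f := ⟨fun z => slice p f z.2, (slice_contDiff p f).comp contDiff_snd⟩
  map_one' := rfl
  map_mul' _ _ := rfl
  map_zero' := rfl
  map_add' _ _ := rfl
  commutes' _ := rfl

theorem slice_freeze (p q : E) (f : SmoothFun (E × Spacetime)) :
    slice q (freeze p f) = slice p f := rfl

theorem freeze_sdir (p : E) (a : Fin 4) (f : SmoothFun (E × Spacetime)) :
    freeze p (sdir E a f) = sdir E a (freeze p f) := by
  apply ev_ext
  rintro ⟨q, x⟩
  change slice q (freeze p (sdir E a f)) x = slice q (sdir E a (freeze p f)) x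
  rw [slice_freeze, ← pd_slice, ← pd_slice, slice_freeze]

end

/-! ### Second variations -/

section

variable {M : Matrix (Fin 4) (Fin 4) (SmoothFun ((ℝ × ℝ) × Spacetime))}

/-- The derivative in the first parameter `s`. -/
def dS : Derivation ℝ (SmoothFun ((ℝ × ℝ) × Spacetime)) (SmoothFun ((ℝ × ℝ) × Spacetime)) :=
  dir ((1, 0), 0)

/-- The derivative in the second parameter `t`. -/
def dT : Derivation ℝ (SmoothFun ((ℝ × ℝ) × Spacetime)) (SmoothFun ((ℝ × ℝ) × Spacetime)) :=
  dir ((0, 1), 0)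

/-- The integrated first variation formula: the action of the interacting theory is the derivative
of the Weyl action along the second parameter. -/
theorem integral_first_variation (S : Geom (sdir (ℝ × ℝ)))
    (hV : 2 * dT S.s = S.s * tr2 S.G (fun a b => dT (S.g a b)))
    {K : Set Spacetime} (hK : IsCompact K) (hT : ∀ a b, dT (S.g a b) ∈ vanOff (ℝ × ℝ) K)
    (p : ℝ × ℝ) :
    4 * dT S.lag ∈ vanOff (ℝ × ℝ) K ∧
    ∫ x, slice p (S.s * tr2 (up2 S.G fun a b => dT (S.g a b)) S.bac) x
      = ∫ x, slice p (4 * dT S.lag) x := by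
  have hD : ∀ a x, x ∈ vanOff (ℝ × ℝ) K → sdir (ℝ × ℝ) a x ∈ vanOff (ℝ × ℝ) K := fun a x hx =>
    dir_mem_vanOff hK.isClosed _ hx
  obtain ⟨V, hh, hV'⟩ : ∃ V : Variation S, (∀ a b, V.h a b = dT (S.g a b)) ∧ V.lag' = dT S.lag :=
    ⟨Variation.ofDeriv S dT (fun a x => dir_comm _ _ x) hV, fun _ _ => rfl,
      Variation.lag'_ofDeriv S dT _ hV⟩
  have hh' : V.h = fun a b => dT (S.g a b) := by ext a b; rw [hh]
  rw [← hh', ← hV']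
  have hI : ∀ a b, V.h a b ∈ vanOff (ℝ × ℝ) K := fun a b => by rw [hh]; exact hT a b
  have h1 := V.first_variation (I := vanOff (ℝ × ℝ) K) hI (V.T_mem hD hI)
  have h3 : 4 * V.lag' ∈ vanOff (ℝ × ℝ) K := Ideal.mul_mem_left _ _ (V.lag'_mem hD hI)
  have h5 : S.s * tr2 V.k S.bac ∈ vanOff (ℝ × ℝ) K :=
    Ideal.mul_mem_left _ _ (tr2_mem_left fun a b => up2_mem hI a b)
  refine ⟨h3, ?_⟩
  have h7 := integral_exact hK h1 p
  have h8 : slice p (4 * V.lag' - S.s * tr2 V.k S.bac)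
      = fun x => slice p (4 * V.lag') x - slice p (S.s * tr2 V.k S.bac) x := by
    ext x; simp only [slice, map_sub]
  rw [h8, integral_sub (slice_integrable hK h3 _) (slice_integrable hK h5 _)] at h7
  exact (sub_eq_zero.1 h7).symm

/-- The derivative of the Weyl action along the first parameter vanishes at every parameter value
where that derivative is an infinitesimal gauge transformation. -/
theorem integral_gauge_variation (S : Geom (sdir (ℝ × ℝ)))
    (hV : 2 * dS S.s = S.s * tr2 S.G (fun a b => dS (S.g a b)))
    {K : Set Spacetime} (hK : IsCompact K) (hS : ∀ a b, dS (S.g a b) ∈ vanOff (ℝ × ℝ) K)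
    (v : Fin 4 → SmoothFun ((ℝ × ℝ) × Spacetime)) (φ : SmoothFun ((ℝ × ℝ) × Spacetime))
    (hv : ∀ a, v a ∈ vanOff (ℝ × ℝ) K) :
    4 * dS S.lag ∈ vanOff (ℝ × ℝ) K ∧
    ∀ p, (∀ x a b, slice p (dS (S.g a b)) x
      = slice p (lie2 (sdir (ℝ × ℝ)) v S.g a b + φ * S.g a b) x) →
      ∫ x, slice p (4 * dS S.lag) x = 0 := by
  have hD : ∀ a x, x ∈ vanOff (ℝ × ℝ) K → sdir (ℝ × ℝ) a x ∈ vanOff (ℝ × ℝ) K := fun a x hx =>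
    dir_mem_vanOff hK.isClosed _ hx
  obtain ⟨V, hh, hV'⟩ : ∃ V : Variation S, (∀ a b, V.h a b = dS (S.g a b)) ∧ V.lag' = dS S.lag :=
    ⟨Variation.ofDeriv S dS (fun a x => dir_comm _ _ x) hV, fun _ _ => rfl,
      Variation.lag'_ofDeriv S dS _ hV⟩
  rw [← hV']
  have hI : ∀ a b, V.h a b ∈ vanOff (ℝ × ℝ) K := fun a b => by rw [hh]; exact hS a b
  refine ⟨Ideal.mul_mem_left _ _ (V.lag'_mem hD hI), fun p hg => ?_⟩
  -- The condition holds only at the parameter `p`, so the geometry is restricted to `p` first.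
  have hfr : ∀ f ∈ vanOff (ℝ × ℝ) K, freeze p f ∈ vanOff (ℝ × ℝ) K :=
    fun f hf q x hx => hf _ x hx
  obtain ⟨W, hW, hW'⟩ : ∃ W : Variation (S.map (freeze p) (freeze_sdir p)),
      (∀ a b, W.h a b = freeze p (V.h a b)) ∧ W.lag' = freeze p V.lag' :=
    ⟨V.map (freeze p) (freeze_sdir p), fun _ _ => rfl, V.lag'_map _ _⟩
  have hWI : ∀ a b, W.h a b ∈ vanOff (ℝ × ℝ) K := fun a b => by rw [hW]; exact hfr _ (hI a b)
  have h4 := W.lag'_gauge (fun a => freeze p (v a)) (freeze p φ) (fun a b => by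
    have : freeze p (dS (S.g a b)) = freeze p
        (lie2 (sdir (ℝ × ℝ)) v S.g a b + φ * S.g a b) := ev_ext fun z => hg z.2 a b
    rw [hW, hh, this]
    simp only [Geom.map, lie2, map_add, map_mul, map_sum, freeze_sdir])
    hD (fun a => hfr _ (hv a)) hWI (W.T_mem hD hWI)
  have h5 := integral_exact hK h4 p
  rwa [hW', ← map_ofNat (freeze p) 4, ← map_mul, slice_freeze] at h5

/-- The derivative of the Bach action in the direction of a second deformation is a second
variation of the Weyl action. -/
theorem hasDerivAt_integral_bachLag (hM : M.IsSymm) (hdet : ∀ x, ev x M.det < 0)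
    {K : Set Spacetime} (hK : IsCompact K)
    (hT : ∀ a b, dT (M a b) ∈ vanOff (ℝ × ℝ) K) :
    HasDerivAt (fun s : ℝ => ∫ x, bachLag (fieldAt M (s, 0)) (fieldAt (M.map dT) (s, 0)) x)
      (∫ x, slice (0, 0) (dS (4 * dT (geomOf M hM hdet).lag)) x) 0 := by
  have h := integral_first_variation (geomOf M hM hdet) (geomOf_vol hM hdet dT) hK hT
  have h6 : ∀ s : ℝ, ∫ x, bachLag (fieldAt M (s, 0)) (fieldAt (M.map dT) (s, 0)) x
      = ∫ x, slice (s, 0) (4 * dT (geomOf M hM hdet).lag) x := fun s => by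
    rw [bachLag_fieldAt hM hdet]
    exact (h (s, 0)).2
  simp only [h6]
  have h9 := hasDerivAt_integral_slice hK (h 0).1 ((0, 0) : ℝ × ℝ) (1, 0)
  simp only [Prod.smul_mk, smul_eq_mul, mul_one, mul_zero, Prod.mk_add_mk, zero_add] at h9
  exact h9

/-- A second variation of the Weyl action vanishes when the first deformation is an infinitesimal
gauge transformation of every metric of the second deformation. -/
theorem second_variation_gauge (hM : M.IsSymm) (hdet : ∀ x, ev x M.det < 0)
    {K : Set Spacetime} (hK : IsCompact K)
    (v : Fin 4 → SmoothFun ((ℝ × ℝ) × Spacetime)) (φ : SmoothFun ((ℝ × ℝ) × Spacetime))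
    (hv : ∀ a, v a ∈ vanOff (ℝ × ℝ) K)
    (hS : ∀ a b, dS (M a b) ∈ vanOff (ℝ × ℝ) K)
    (hg : ∀ (t : ℝ) x a b, slice (0, t) (dS (M a b)) x
      = slice (0, t) (lie2 (sdir (ℝ × ℝ)) v M a b + φ * M a b) x) :
    ∫ x, slice (0, 0) (dS (4 * dT (geomOf M hM hdet).lag)) x = 0 := by
  have h := integral_gauge_variation (geomOf M hM hdet) (geomOf_vol hM hdet dS) hK hS v φ hv
  have h3 : ∀ t : ℝ, ∫ x, slice (0, t) (4 * dS (geomOf M hM hdet).lag) x = 0 := fun t =>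
    h.2 (0, t) (hg t)
  generalize geomOf M hM hdet = S at h h3
  have h1 : dS (4 * dT S.lag) = dT (4 * dS S.lag) := by
    rw [Derivation.leibniz, Derivation.leibniz, Geom.D_four, Geom.D_four,
      show dS (dT S.lag) = dT (dS S.lag) from dir_comm _ _ _, smul_zero, smul_zero]
  have h9 := hasDerivAt_integral_slice hK h.1 ((0, 0) : ℝ × ℝ) (0, 1)
  simp only [Prod.smul_mk, smul_eq_mul, mul_one, mul_zero, Prod.mk_add_mk, zero_add, h3] at h9
  rw [h1]
  exact h9.unique (hasDerivAt_const _ _)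

end

end

section

/-! ### Two-parameter deformations of a metric -/

/-- A bounded function tangent to the identity at `0`. Substituting it for the parameters of a
family keeps the family near its member at `0` without changing first derivatives there. -/
def damp (r s : ℝ) : ℝ := r * Real.sin (s / r)

theorem abs_damp_le {r : ℝ} (hr : 0 < r) (s : ℝ) : |damp r s| ≤ r := by
  rw [damp, abs_mul, abs_of_pos hr]
  exact mul_le_of_le_one_right hr.le (Real.abs_sin_le_one _)

theorem damp_zero (r : ℝ) : damp r 0 = 0 := by simp [damp]

theorem hasDerivAt_damp {r : ℝ} (hr : 0 < r) (s : ℝ) :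
    HasDerivAt (damp r) (Real.cos (s / r)) s := by
  have := ((Real.hasDerivAt_sin (s / r)).comp s ((hasDerivAt_id s).div_const r)).const_mul r
  rwa [mul_one_div, mul_div_cancel₀ _ hr.ne'] at this

theorem damp_arcsin {r ε : ℝ} (hr : 0 < r) (hε : |ε| ≤ r) :
    damp r (r * Real.arcsin (ε / r)) = ε := by
  have h := abs_le.1 hε
  rw [damp, mul_div_cancel_left₀ _ hr.ne', Real.sin_arcsin, mul_div_cancel₀ _ hr.ne']
  · rw [le_div_iff₀ hr]; linarith
  · rw [div_le_iff₀ hr]; linarith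

theorem contDiff_damp (r : ℝ) : ContDiff ℝ ∞ (damp r) :=
  contDiff_const.mul (Real.contDiff_sin.comp (contDiff_id.div_const r))

/-- Substitution of damped parameters. -/
def reparam (r : ℝ) :
    SmoothFun ((ℝ × ℝ) × Spacetime) →ₐ[ℝ] SmoothFun ((ℝ × ℝ) × Spacetime) where
  toFun f := ⟨fun z => slice (damp r z.1.1, damp r z.1.2) f z.2, (smooth_coe f).comp
    ((((contDiff_damp r).comp (contDiff_fst.comp contDiff_fst)).prodMk
      ((contDiff_damp r).comp (contDiff_snd.comp contDiff_fst))).prodMk contDiff_snd)⟩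
  map_one' := rfl
  map_mul' _ _ := rfl
  map_zero' := rfl
  map_add' _ _ := rfl
  commutes' _ := rfl

theorem slice_reparam (r : ℝ) (p : ℝ × ℝ) (f : SmoothFun ((ℝ × ℝ) × Spacetime)) :
    slice p (reparam r f) = slice (damp r p.1, damp r p.2) f := rfl

theorem reparam_sdir (r : ℝ) (a : Fin 4) (f : SmoothFun ((ℝ × ℝ) × Spacetime)) :
    reparam r (sdir (ℝ × ℝ) a f) = sdir (ℝ × ℝ) a (reparam r f) := by
  apply ev_ext
  rintro ⟨q, x⟩
  change slice q (reparam r (sdir _ a f)) x = slice q (sdir _ a (reparam r f)) x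
  rw [slice_reparam, ← pd_slice, ← pd_slice, slice_reparam]

theorem hasDerivAt_slice_fst (f : SmoothFun ((ℝ × ℝ) × Spacetime)) (s t : ℝ) (x : Spacetime) :
    HasDerivAt (fun s => slice (s, t) f x) (slice (s, t) (dS f) x) s :=
  (diff_coe f ((s, t), x)).hasFDerivAt.comp_hasDerivAt s
    (((hasDerivAt_id s).prodMk (hasDerivAt_const s t)).prodMk (hasDerivAt_const s x))

theorem hasDerivAt_slice_snd (f : SmoothFun ((ℝ × ℝ) × Spacetime)) (s t : ℝ) (x : Spacetime) :
    HasDerivAt (fun t => slice (s, t) f x) (slice (s, t) (dT f) x) t :=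
  (diff_coe f ((s, t), x)).hasFDerivAt.comp_hasDerivAt t
    (((hasDerivAt_const t s).prodMk (hasDerivAt_id t)).prodMk (hasDerivAt_const t x))

theorem slice_dS_reparam {r : ℝ} (hr : 0 < r) (f : SmoothFun ((ℝ × ℝ) × Spacetime)) (s t : ℝ)
    (x : Spacetime) : slice (s, t) (dS (reparam r f)) x
      = slice (damp r s, damp r t) (dS f) x * Real.cos (s / r) :=
  (hasDerivAt_slice_fst (reparam r f) s t x).unique
    ((hasDerivAt_slice_fst f (damp r s) (damp r t) x).comp s (hasDerivAt_damp hr s))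

theorem slice_dT_reparam {r : ℝ} (hr : 0 < r) (f : SmoothFun ((ℝ × ℝ) × Spacetime)) (s t : ℝ)
    (x : Spacetime) : slice (s, t) (dT (reparam r f)) x
      = slice (damp r s, damp r t) (dT f) x * Real.cos (t / r) :=
  (hasDerivAt_slice_snd (reparam r f) s t x).unique
    ((hasDerivAt_slice_snd f (damp r s) (damp r t) x).comp t (hasDerivAt_damp hr t))

theorem dS_mem_vanOff {K : Set Spacetime} {f : SmoothFun ((ℝ × ℝ) × Spacetime)}
    (h : ∀ p, ∀ x ∉ K, slice p f x = slice 0 f x) : dS f ∈ vanOff (ℝ × ℝ) K := fun p x hx =>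
  (hasDerivAt_slice_fst f p.1 p.2 x).unique
    (by simp only [h _ x hx]; exact hasDerivAt_const _ _)

theorem dT_mem_vanOff {K : Set Spacetime} {f : SmoothFun ((ℝ × ℝ) × Spacetime)}
    (h : ∀ p, ∀ x ∉ K, slice p f x = slice 0 f x) : dT f ∈ vanOff (ℝ × ℝ) K := fun p x hx =>
  (hasDerivAt_slice_snd f p.1 p.2 x).unique
    (by simp only [h _ x hx]; exact hasDerivAt_const _ _)

section

variable {N : Matrix (Fin 4) (Fin 4) (SmoothFun ((ℝ × ℝ) × Spacetime))} {K : Set Spacetime}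

/-- A deformation with compact support stays nondegenerate for small parameters. -/
theorem exists_reparam_det (hK : IsCompact K)
    (h0 : ∀ x, (fieldAt N 0 x).det < 0)
    (hc : ∀ a b p, ∀ x ∉ K, slice p (N a b) x = slice 0 (N a b) x) :
    ∃ r > 0, ∀ z, ev z (N.map (reparam r)).det < 0 := by
  have hopen : IsOpen {z : (ℝ × ℝ) × Spacetime | ev z N.det < 0} :=
    isOpen_lt (smooth_coe N.det).continuous continuous_const
  obtain ⟨U, V, hU, -, h0U, hKV, hUV⟩ := generalized_tube_lemma
    (isCompact_singleton (x := (0 : ℝ × ℝ))) hK hopen (by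
      rintro ⟨p, x⟩ ⟨hp, -⟩
      rw [Set.mem_singleton_iff] at hp
      subst hp
      change ev _ _ < 0
      rw [ev_det]
      exact h0 x)
  obtain ⟨ε, hε, hball⟩ := Metric.isOpen_iff.1 hU 0 (h0U rfl)
  refine ⟨ε / 2, half_pos hε, ?_⟩
  rintro ⟨p, x⟩
  set q : ℝ × ℝ := (damp (ε / 2) p.1, damp (ε / 2) p.2)
  have h1 : ev (p, x) (N.map (reparam (ε / 2))).det = ev (q, x) N.det := by
    rw [ev_det, ev_det]; rfl
  rw [h1]
  by_cases hx : x ∈ K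
  · refine hUV (Set.mk_mem_prod (hball ?_) (hKV hx))
    rw [mem_ball_zero_iff, Prod.norm_def]
    exact max_lt ((abs_damp_le (half_pos hε) _).trans_lt (half_lt_self hε))
      ((abs_damp_le (half_pos hε) _).trans_lt (half_lt_self hε))
  · rw [ev_det]
    have : N.map (ev (q, x)) = fieldAt N 0 x := by
      ext a b; exact hc a b q x hx
    rw [this]
    exact h0 x

theorem bachLag_reparam {r : ℝ} (hr : 0 < r) (s : ℝ) :
    bachLag (fieldAt (N.map (reparam r)) (s, 0))
      (fieldAt ((N.map (reparam r)).map dT) (s, 0))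
    = bachLag (fieldAt N (damp r s, 0)) (fieldAt (N.map dT) (damp r s, 0)) := by
  have h1 : fieldAt (N.map (reparam r)) (s, 0) = fieldAt N (damp r s, 0) := by
    ext x a b
    change slice (s, 0) (reparam r (N a b)) x = _
    rw [slice_reparam, damp_zero]; rfl
  have h2 : fieldAt ((N.map (reparam r)).map dT) (s, 0) = fieldAt (N.map dT) (damp r s, 0) := by
    ext x a b
    change slice (s, 0) (dT (reparam r (N a b))) x = _
    rw [slice_dT_reparam hr, damp_zero, zero_div, Real.cos_zero, mul_one]; rfl
  rw [h1, h2]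

/-- The Bach action along a compactly supported deformation, in terms of the damped one. -/
theorem hasDerivAt_bachLag_deformation (hN : N.IsSymm) (hK : IsCompact K)
    (hc : ∀ a b p, ∀ x ∉ K, slice p (N a b) x = slice 0 (N a b) x)
    {r : ℝ} (hr : 0 < r) (hdet : ∀ z, ev z (N.map (reparam r)).det < 0)
    (hM : (N.map (reparam r)).IsSymm := hN.map _) :
    (∀ᶠ ε in 𝓝 (0 : ℝ), Integrable (bachLag (fieldAt N (ε, 0)) (fieldAt (N.map dT) (ε, 0)))) ∧
    HasDerivAt (fun ε : ℝ => ∫ x, bachLag (fieldAt N (ε, 0)) (fieldAt (N.map dT) (ε, 0)) x)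
      (∫ x, slice (0, 0) (dS (4 * dT (geomOf (N.map (reparam r)) hM hdet).lag)) x) 0 := by
  have hT : ∀ a b, dT (N.map (reparam r) a b) ∈ vanOff (ℝ × ℝ) K := fun a b =>
    dT_mem_vanOff fun p x hx => by
      rw [Matrix.map_apply, slice_reparam, slice_reparam, hc _ _ _ x hx, eq_comm, hc _ _ _ x hx]
  have hε : ∀ᶠ ε in 𝓝 (0 : ℝ), damp r (r * Real.arcsin (ε / r)) = ε := by
    filter_upwards [Metric.closedBall_mem_nhds (0 : ℝ) hr] with ε hε
    exact damp_arcsin hr (by simpa using hε)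
  constructor
  · filter_upwards [hε] with ε hε
    rw [← hε, ← bachLag_reparam hr, bachLag_fieldAt hM hdet]
    exact slice_integrable hK (Ideal.mul_mem_left _ _ (tr2_mem_left (up2_mem hT))) _
  · have h1 := hasDerivAt_integral_bachLag hM hdet hK hT
    simp only [bachLag_reparam hr] at h1
    have h2 : HasDerivAt (fun ε : ℝ => r * Real.arcsin (ε / r)) 1 0 := by
      have h3 : HasDerivAt Real.arcsin 1 (0 / r) := by
        have := Real.hasDerivAt_arcsin (x := 0) (by norm_num) (by norm_num)
        simpa using this
      have := (h3.comp (0 : ℝ) ((hasDerivAt_id (0 : ℝ)).div_const r)).const_mul r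
      rwa [one_mul, mul_one_div, div_self hr.ne'] at this
    have h4 : r * Real.arcsin (0 / r) = 0 := by simp
    have h5 := HasDerivAt.comp_of_eq (0 : ℝ) h1 h2 h4.symm
    rw [mul_one] at h5
    refine h5.congr_of_eventuallyEq ?_
    filter_upwards [hε] with ε hε
    simp only [Function.comp_apply, hε]

/-- The Bach action is stationary along a deformation by gauge transformations. -/
theorem hasDerivAt_bachLag_gauge (hN : N.IsSymm) (hK : IsCompact K)
    (h0 : ∀ x, (fieldAt N 0 x).det < 0)
    (hc : ∀ a b p, ∀ x ∉ K, slice p (N a b) x = slice 0 (N a b) x)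
    (v : Fin 4 → SmoothFun ((ℝ × ℝ) × Spacetime)) (φ : SmoothFun ((ℝ × ℝ) × Spacetime))
    (hv : ∀ a, v a ∈ vanOff (ℝ × ℝ) K)
    (hg : ∀ (t : ℝ) x a b, slice (0, t) (dS (N a b)) x
      = slice (0, t) (lie2 (sdir (ℝ × ℝ)) v N a b + φ * N a b) x) :
    (∀ᶠ ε in 𝓝 (0 : ℝ), Integrable (bachLag (fieldAt N (ε, 0)) (fieldAt (N.map dT) (ε, 0)))) ∧
    HasDerivAt (fun ε : ℝ => ∫ x, bachLag (fieldAt N (ε, 0)) (fieldAt (N.map dT) (ε, 0)) x) 0 0 := by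
  obtain ⟨r, hr, hdet⟩ := exists_reparam_det hK h0 hc
  have h := hasDerivAt_bachLag_deformation hN hK hc hr hdet
  rw [second_variation_gauge (hN.map _) hdet hK (fun a => reparam r (v a)) (reparam r φ)
    (fun a p x hx => hv a _ x hx) (fun a b => dS_mem_vanOff fun p x hx => by
      rw [Matrix.map_apply, slice_reparam, slice_reparam, hc _ _ _ x hx, eq_comm, hc _ _ _ x hx])
    (fun t x a b => by
      have h1 : lie2 (sdir (ℝ × ℝ)) (fun a => reparam r (v a)) (N.map (reparam r)) a b
          + reparam r φ * N.map (reparam r) a b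
          = reparam r (lie2 (sdir (ℝ × ℝ)) v N a b + φ * N a b) := by
        simp only [lie2, map_add, map_mul, map_sum, reparam_sdir, Matrix.map_apply]
      rw [h1, slice_reparam, Matrix.map_apply, slice_dS_reparam hr, damp_zero, zero_div,
        Real.cos_zero, mul_one]
      exact hg _ x a b)] at h
  exact h

end

end

section

/-! ### Gauge invariance of the interacting action -/

section

variable {A : Type*} [CommRing A] [Algebra ℝ A] {D : Fin 4 → Derivation ℝ A A}

/-- The Lie derivative of the metric is the symmetrised covariant derivative. -/
theorem Geom.lie2_g_eq (S : Geom D) (w : Fin 4 → A) (a b : Fin 4) :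
    lie2 D (fun ρ => ∑ σ, S.G ρ σ * w σ) S.g a b = nab1 D S.Γ w b a + nab1 D S.Γ w a b := by
  have key : ∀ v : Fin 4 → A, lie2 D v S.g a b
      = nab1 D S.Γ (fun a => ∑ e, S.g a e * v e) b a
        + nab1 D S.Γ (fun a => ∑ e, S.g a e * v e) a b := by
    intro v
    simp only [lie2, nab1, Fin.sum_univ_four]
    simp only [map_add, Derivation.leibniz, smul_eq_mul, S.compat, Fin.sum_univ_four,
      S.g_symm, S.Γ_symm]
    ring
  rw [key]
  have h : (fun a => ∑ e, S.g a e * ∑ σ, S.G e σ * w σ) = w := by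
    ext c
    simp only [Finset.mul_sum]
    rw [Finset.sum_comm]
    simp only [← mul_assoc, ← Finset.sum_mul, S.gG, ite_mul, one_mul, zero_mul]
    simp
  rw [h]

theorem deriv_lie2 (δ : Derivation ℝ A A) (hδ : ∀ a x, δ (D a x) = D a (δ x)) (v : Fin 4 → A)
    (t : Fin 4 → Fin 4 → A) (a b : Fin 4) : δ (lie2 D v t a b)
      = lie2 D (fun e => δ (v e)) t a b + lie2 D v (fun a b => δ (t a b)) a b := by
  simp only [lie2, map_sum, map_add, Derivation.leibniz, smul_eq_mul, hδ,
    ← Finset.sum_add_distrib]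
  exact Finset.sum_congr rfl fun e _ => by ring

end

section

variable {g g' : TensorField} {O : Set Spacetime}

theorem pd_congr (hO : IsOpen O) {f f' : ScalarField} (h : Set.EqOn f f' O) (a : Fin 4) :
    Set.EqOn (pd a f) (pd a f') O := fun x hx => by
  have : f =ᶠ[𝓝 x] f' := by filter_upwards [hO.mem_nhds hx] with y hy using h hy
  rw [pd, pd, this.fderiv_eq]

theorem bach_congr (hO : IsOpen O) (h : Set.EqOn g g' O) (a b : Fin 4) :
    Set.EqOn (bach g a b) (bach g' a b) O := by
  have h1 : ∀ a b, Set.EqOn (inv g a b) (inv g' a b) O := fun a b x hx => by rw [inv, inv, h hx]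
  have h2 : ∀ a b c, Set.EqOn (pd c fun y => g y a b) (pd c fun y => g' y a b) O := fun a b c =>
    pd_congr hO (fun y hy => by simp only [h hy]) c
  have h3 : ∀ a b c, Set.EqOn (christoffel g a b c) (christoffel g' a b c) O := fun a b c x hx => by
    simp only [christoffel, h1 _ _ hx, h2 _ _ _ hx]
  have h4 : ∀ a b c d, Set.EqOn (pd d (christoffel g a b c)) (pd d (christoffel g' a b c)) O :=
    fun a b c d => pd_congr hO (h3 a b c) d
  have h5 : ∀ a b c d, Set.EqOn (riemann g a b c d) (riemann g' a b c d) O := fun a b c d x hx => by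
    simp only [riemann, h3 _ _ _ hx, h4 _ _ _ _ hx]
  have h6 : ∀ a b, Set.EqOn (schouten g a b) (schouten g' a b) O := fun a b x hx => by
    simp only [schouten, scalarCurv, ricci, h5 _ _ _ _ hx, h1 _ _ hx, h hx]
  have h7 : ∀ a b c d, Set.EqOn (weylLow g a b c d) (weylLow g' a b c d) O := fun a b c d x hx => by
    simp only [weylLow, weyl, h5 _ _ _ _ hx, h6 _ _ hx, h1 _ _ hx, h hx]
  have h8 : ∀ a b c, Set.EqOn (pd c (schouten g a b)) (pd c (schouten g' a b)) O :=
    fun a b c => pd_congr hO (h6 a b) c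
  have h9 : ∀ a b c, Set.EqOn (cotton g a b c) (cotton g' a b c) O := fun a b c x hx => by
    simp only [cotton, cov2, h8 _ _ _ hx, h6 _ _ hx, h3 _ _ _ hx]
  have h10 : ∀ a b c d, Set.EqOn (pd d (cotton g a b c)) (pd d (cotton g' a b c)) O :=
    fun a b c d => pd_congr hO (h9 a b c) d
  intro x hx
  simp only [bach, bachLow, cov3, h10 _ _ _ _ hx, h9 _ _ _ hx, h7 _ _ _ _ hx, h6 _ _ hx,
    h3 _ _ _ hx, h1 _ _ hx]

/-- The Bach Lagrangian is local in the metric and pointwise in the second field. -/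
theorem bachLag_congr (hO : IsOpen O) (h : Set.EqOn g g' O) {t t' : TensorField} {x : Spacetime}
    (hx : x ∈ O) (ht : t x = t' x) : bachLag g t x = bachLag g' t' x := by
  simp only [bachLag, bach_congr hO h _ _ hx, h hx, ht]

end

/-- A scalar field, as a function independent of the parameters. -/
def lift (f : ScalarField) (hf : ContDiff ℝ ∞ f) : SmoothFun ((ℝ × ℝ) × Spacetime) :=
  ⟨fun z => f z.2, hf.comp contDiff_snd⟩

/-- The first parameter. -/
def parS : SmoothFun ((ℝ × ℝ) × Spacetime) := ⟨fun z => z.1.1,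
  show ContDiff ℝ ∞ fun z : (ℝ × ℝ) × Spacetime => z.1.1 from contDiff_fst.comp contDiff_fst⟩

/-- The second parameter. -/
def parT : SmoothFun ((ℝ × ℝ) × Spacetime) := ⟨fun z => z.1.2,
  show ContDiff ℝ ∞ fun z : (ℝ × ℝ) × Spacetime => z.1.2 from contDiff_snd.comp contDiff_fst⟩

theorem dS_lift (f : ScalarField) (hf : ContDiff ℝ ∞ f) : dS (lift f hf) = 0 :=
  ev_ext fun z => (hasDerivAt_slice_fst (lift f hf) z.1.1 z.1.2 z.2).unique
    (hasDerivAt_const (c := f z.2) _)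

theorem dT_lift (f : ScalarField) (hf : ContDiff ℝ ∞ f) : dT (lift f hf) = 0 :=
  ev_ext fun z => (hasDerivAt_slice_snd (lift f hf) z.1.1 z.1.2 z.2).unique
    (hasDerivAt_const (c := f z.2) _)

theorem dS_parS : dS parS = 1 :=
  ev_ext fun z => (hasDerivAt_slice_fst parS z.1.1 z.1.2 z.2).unique (hasDerivAt_id _)

theorem dS_parT : dS parT = 0 :=
  ev_ext fun z => (hasDerivAt_slice_fst parT z.1.1 z.1.2 z.2).unique
    (hasDerivAt_const (c := z.1.2) _)

theorem dT_parS : dT parS = 0 :=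
  ev_ext fun z => (hasDerivAt_slice_snd parS z.1.1 z.1.2 z.2).unique
    (hasDerivAt_const (c := z.1.1) _)

theorem dT_parT : dT parT = 1 :=
  ev_ext fun z => (hasDerivAt_slice_snd parT z.1.1 z.1.2 z.2).unique (hasDerivAt_id _)

/-- A tensor field, as a field independent of the parameters. -/
def liftM (t : TensorField) (ht : IsSymmField t) :
    Matrix (Fin 4) (Fin 4) (SmoothFun ((ℝ × ℝ) × Spacetime)) :=
  Matrix.of fun a b => lift (fun x => t x a b) (ht.smooth a b)

theorem liftM_isSymm (t : TensorField) (ht : IsSymmField t) : (liftM t ht).IsSymm :=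
  Matrix.IsSymm.ext fun a b => ev_ext fun z => (ht.symm z.2).apply a b

theorem dS_liftM (t : TensorField) (ht : IsSymmField t) (a b : Fin 4) : dS (liftM t ht a b) = 0 :=
  dS_lift (fun x => t x a b) (ht.smooth a b)

theorem dT_liftM (t : TensorField) (ht : IsSymmField t) (a b : Fin 4) : dT (liftM t ht a b) = 0 :=
  dT_lift (fun x => t x a b) (ht.smooth a b)

theorem dS_lie2 (v : Fin 4 → SmoothFun ((ℝ × ℝ) × Spacetime))
    (t : Fin 4 → Fin 4 → SmoothFun ((ℝ × ℝ) × Spacetime)) (a b : Fin 4) :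
    dS (lie2 (sdir (ℝ × ℝ)) v t a b) = lie2 (sdir (ℝ × ℝ)) (fun e => dS (v e)) t a b
      + lie2 (sdir (ℝ × ℝ)) v (fun a b => dS (t a b)) a b :=
  deriv_lie2 dS (fun _ _ => dir_comm _ _ _) v t a b

theorem dT_lie2 (v : Fin 4 → SmoothFun ((ℝ × ℝ) × Spacetime))
    (t : Fin 4 → Fin 4 → SmoothFun ((ℝ × ℝ) × Spacetime)) (a b : Fin 4) :
    dT (lie2 (sdir (ℝ × ℝ)) v t a b) = lie2 (sdir (ℝ × ℝ)) (fun e => dT (v e)) t a b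
      + lie2 (sdir (ℝ × ℝ)) v (fun a b => dT (t a b)) a b :=
  deriv_lie2 dT (fun _ _ => dir_comm _ _ _) v t a b

theorem ev_liftM_det (t : TensorField) (ht : IsSymmField t) (z : (ℝ × ℝ) × Spacetime) :
    ev z (liftM t ht).det = (t z.2).det := by
  rw [ev_det]; rfl

theorem lie2_smul_add {A : Type*} [CommRing A] [Algebra ℝ A] {D : Fin 4 → Derivation ℝ A A}
    (v : Fin 4 → A) (t : Fin 4 → Fin 4 → A) (α : ℝ) (a b : Fin 4) :
    lie2 D (fun e => α • v e) t a b = α • lie2 D v t a b := by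
  simp only [lie2, Finset.smul_sum, Derivation.map_smul, smul_add, smul_mul_assoc]

section

variable {g : TensorField} (hg : IsSymmField g) (hdet : ∀ z, ev z (liftM g hg).det < 0)

/-- The geometry of a metric independent of the parameters. -/
def geomLift : Geom (sdir (ℝ × ℝ)) := geomOf (liftM g hg) (liftM_isSymm g hg) hdet

/-- The vector field `g^{ρσ} ξ_σ`. -/
def raised (ξ : CovectorField) (hξ : ∀ σ, ContDiff ℝ ∞ fun y => ξ y σ) (ρ : Fin 4) :
    SmoothFun ((ℝ × ℝ) × Spacetime) :=
  ∑ σ, (geomLift hg hdet).G ρ σ * lift (fun y => ξ y σ) (hξ σ)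

theorem deriv_geomLift_G (δ : Derivation ℝ (SmoothFun ((ℝ × ℝ) × Spacetime))
    (SmoothFun ((ℝ × ℝ) × Spacetime))) (hδ : ∀ a b, δ (liftM g hg a b) = 0) (a b : Fin 4) :
    δ ((geomLift hg hdet).G a b) = 0 := by
  rw [Geom.deriv_inv]
  have : ∀ p q, δ ((geomLift hg hdet).g p q) = 0 := hδ
  simp [up2, this]

theorem dS_raised (ξ : CovectorField) (hξ : ∀ σ, ContDiff ℝ ∞ fun y => ξ y σ) (ρ : Fin 4) :
    dS (raised hg hdet ξ hξ ρ) = 0 := by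
  simp only [raised, map_sum, Derivation.leibniz, dS_lift,
    deriv_geomLift_G hg hdet dS (dS_liftM g hg), smul_zero, add_zero,
    Finset.sum_const_zero]

theorem dT_raised (ξ : CovectorField) (hξ : ∀ σ, ContDiff ℝ ∞ fun y => ξ y σ) (ρ : Fin 4) :
    dT (raised hg hdet ξ hξ ρ) = 0 := by
  simp only [raised, map_sum, Derivation.leibniz, dT_lift,
    deriv_geomLift_G hg hdet dT (dT_liftM g hg), smul_zero, add_zero,
    Finset.sum_const_zero]

theorem inv_eq_slice (p : ℝ × ℝ) (a b : Fin 4) :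
    inv g a b = slice p ((geomLift hg hdet).G a b) :=
  inv_fieldAt (liftM_isSymm g hg) hdet p a b

theorem lieD_eq_slice (ξ : CovectorField) (hξ : ∀ σ, ContDiff ℝ ∞ fun y => ξ y σ)
    {t : TensorField} (ht : IsSymmField t) (p : ℝ × ℝ) (a b : Fin 4) :
    lieD g ξ t a b = slice p (lie2 (sdir (ℝ × ℝ)) (raised hg hdet ξ hξ) (liftM t ht) a b) := by
  ext x
  have h1 : ∀ ρ, (fun y => ∑ σ, inv g ρ σ y * ξ y σ) = slice p (raised hg hdet ξ hξ ρ) := by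
    intro ρ
    ext y
    simp only [inv_eq_slice hg hdet p, raised, slice, map_sum, map_mul]
    rfl
  have h2 : ∀ a b c, pd c (fun y => t y a b) = slice p (sdir (ℝ × ℝ) c (liftM t ht a b)) :=
    fun a b c => pd_slice p (liftM t ht a b) c
  simp only [lieD, h2]
  have h3 : ∀ a b, t x a b = slice p (liftM t ht a b) x := fun _ _ => rfl
  have h4 : ∀ ρ, ∑ σ, inv g ρ σ x * ξ x σ = slice p (raised hg hdet ξ hξ ρ) x := fun ρ =>
    congrFun (h1 ρ) x
  simp only [h1, h4, h3, pd_slice, lie2, slice, map_sum, map_mul, map_add]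

theorem gaugeBase_eq_slice (ξ : CovectorField) (hξ : ∀ σ, ContDiff ℝ ∞ fun y => ξ y σ)
    (φ : ScalarField) (hφ : ContDiff ℝ ∞ φ) (p : ℝ × ℝ) (x : Spacetime) (a b : Fin 4) :
    gaugeBase g ξ φ x a b = slice p (lie2 (sdir (ℝ × ℝ)) (raised hg hdet ξ hξ) (liftM g hg) a b
      + 2 * lift φ hφ * liftM g hg a b) x := by
  have h1 : ∀ c a, cov1 g (fun σ y => ξ y σ) c a x = slice p (nab1 (sdir (ℝ × ℝ))
      (geomLift hg hdet).Γ (fun σ => lift (fun y => ξ y σ) (hξ σ)) c a) x := by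
    intro c a
    have h2 : ∀ c σ, pd c (fun y => ξ y σ)
        = slice p (sdir (ℝ × ℝ) c (lift (fun y => ξ y σ) (hξ σ))) := fun c σ =>
      pd_slice p (lift (fun y => ξ y σ) (hξ σ)) c
    have h3 : ∀ a b c, christoffel g a b c = slice p ((geomLift hg hdet).Γ a b c) :=
      fun a b c => christoffel_fieldAt (liftM_isSymm g hg) hdet p a b c
    have h4 : ∀ σ, ξ x σ = slice p (lift (fun y => ξ y σ) (hξ σ)) x := fun _ => rfl
    simp only [cov1, h3, nab1, h2]
    simp only [h4, slice, map_sub, map_sum, map_mul]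
  have h5 := (geomLift hg hdet).lie2_g_eq (fun σ => lift (fun y => ξ y σ) (hξ σ)) a b
  have h6 : lie2 (sdir (ℝ × ℝ)) (raised hg hdet ξ hξ) (liftM g hg) a b = _ := h5
  rw [h6, gaugeBase, Matrix.of_apply, h1, h1]
  simp only [slice, map_add, map_mul, map_ofNat]
  rfl

end

theorem mink_isSymm : mink.IsSymm := Matrix.isSymm_diagonal _

theorem metric_isSymmField {α : ℝ} {h : Fin 2 → TensorField} (h0 : IsSymmField (h 0)) :
    IsSymmField (metric α h) where
  smooth a b := by
    change ContDiff ℝ ∞ fun x => mink a b + α * h 0 x a b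
    exact contDiff_const.add (contDiff_const.mul (h0.smooth a b))
  symm x := mink_isSymm.add ((h0.symm x).smul α)

theorem IsSymmField.smul {t : TensorField} (ht : IsSymmField t) {χ : ScalarField}
    (hχ : ContDiff ℝ ∞ χ) : IsSymmField fun x => χ x • t x where
  smooth a b := hχ.mul (ht.smooth a b)
  symm x := (ht.symm x).smul (χ x)

theorem exists_cutoff {K : Set Spacetime} (hK : IsCompact K) :
    ∃ (K' : Set Spacetime) (χ : ScalarField), IsCompact K' ∧ K ⊆ K' ∧ ContDiff ℝ ∞ χ ∧
      (∀ᶠ x in 𝓝ˢ K, χ x = 1) ∧ ∀ x ∉ K', χ x = 0 := by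
  obtain ⟨K', hK', hKK'⟩ := exists_compact_superset hK
  obtain ⟨f, h1, h2, -⟩ := exists_contMDiffMap_one_nhds_of_subset_interior
    (modelWithCornersSelf ℝ Spacetime) (n := (⊤ : ℕ∞)) hK.isClosed hKK'
  exact ⟨K', f, hK', hKK'.trans interior_subset, f.contMDiff.contDiff, h1, h2⟩

theorem pd_eq_zero {K : Set Spacetime} (hK : IsClosed K) {f : ScalarField} (h : ∀ x ∉ K, f x = 0)
    {x : Spacetime} (hx : x ∉ K) (a : Fin 4) : pd a f x = 0 := by
  rw [pd_congr hK.isOpen_compl (f' := fun _ => 0) (fun y hy => h y hy) a hx]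
  simp [pd]

theorem gaugeBase_eq_zero {K : Set Spacetime} (hK : IsClosed K) {ξ : CovectorField}
    {φ : ScalarField} (hξ : ∀ x ∉ K, ξ x = 0) (hφ : ∀ x ∉ K, φ x = 0) (g : TensorField)
    {x : Spacetime} (hx : x ∉ K) : gaugeBase g ξ φ x = 0 := by
  ext a b
  have h : ∀ σ a, pd a (fun y => ξ y σ) x = 0 := fun σ a =>
    pd_eq_zero hK (fun y hy => by rw [hξ y hy]; rfl) hx a
  simp [gaugeBase, cov1, h, hξ x hx, hφ x hx]

theorem lieD_eq_zero {K : Set Spacetime} (hK : IsClosed K) {ξ : CovectorField}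
    (hξ : ∀ x ∉ K, ξ x = 0) (g t : TensorField) {x : Spacetime} (hx : x ∉ K) (a b : Fin 4) :
    lieD g ξ t a b x = 0 := by
  have h : ∀ ρ a, pd a (fun y => ∑ σ, inv g ρ σ y * ξ y σ) x = 0 := fun σ a =>
    pd_eq_zero hK (fun y hy => by simp [hξ y hy]) hx a
  simp [lieD, h, hξ x hx]

theorem lieD_congr {g t t' : TensorField} {ξ : CovectorField} {x : Spacetime}
    (h : t =ᶠ[𝓝 x] t') (a b : Fin 4) : lieD g ξ t a b x = lieD g ξ t' a b x := by
  have h1 : ∀ a b c, pd c (fun y => t y a b) x = pd c (fun y => t' y a b) x := fun a b c => by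
    have : (fun y => t y a b) =ᶠ[𝓝 x] fun y => t' y a b := by
      filter_upwards [h] with y hy using by rw [hy]
    rw [pd, pd, this.fderiv_eq]
  simp only [lieD, h1, h.self_of_nhds]

section

variable (α : ℝ) {g k : TensorField} (hg : IsSymmField g) (hk : IsSymmField k)
  (hdet : ∀ z, ev z (liftM g hg).det < 0) {ξ : Fin 2 → CovectorField} {φ : Fin 2 → ScalarField}
  (hξ : ∀ a σ, ContDiff ℝ ∞ fun y => ξ a y σ) (hφ : ∀ a, ContDiff ℝ ∞ (φ a))

/-- The vector fields of the family of gauge transformations. -/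
def gaugeVec (ρ : Fin 4) : SmoothFun ((ℝ × ℝ) × Spacetime) :=
  α • raised hg hdet (ξ 0) (hξ 0) ρ + parT * raised hg hdet (ξ 1) (hξ 1) ρ

/-- The conformal factors of the family of gauge transformations. -/
def gaugeFac : SmoothFun ((ℝ × ℝ) × Spacetime) :=
  2 * (α • lift (φ 0) (hφ 0) + parT * lift (φ 1) (hφ 1))

/-- The line of metrics `g + t k`. -/
def lineM : Matrix (Fin 4) (Fin 4) (SmoothFun ((ℝ × ℝ) × Spacetime)) :=
  Matrix.of fun a b => liftM g hg a b + parT * liftM k hk a b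

/-- The line of metrics `g + t k`, deformed by gauge transformations. -/
def gaugeM : Matrix (Fin 4) (Fin 4) (SmoothFun ((ℝ × ℝ) × Spacetime)) :=
  Matrix.of fun a b => lineM hg hk a b + parS *
    (lie2 (sdir (ℝ × ℝ)) (gaugeVec α hg hdet hξ) (lineM hg hk) a b
      + gaugeFac α hφ * lineM hg hk a b)

theorem lineM_isSymm : (lineM hg hk).IsSymm := Matrix.IsSymm.ext fun a b => by
  simp only [lineM, Matrix.of_apply, (liftM_isSymm g hg).apply a b, (liftM_isSymm k hk).apply a b]

theorem gaugeM_isSymm : (gaugeM α hg hk hdet hξ hφ).IsSymm := Matrix.IsSymm.ext fun a b => by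
  simp only [gaugeM, Matrix.of_apply, lie2, (lineM_isSymm hg hk).apply a b]
  congr 3
  exact Finset.sum_congr rfl fun e _ => by
    rw [(lineM_isSymm hg hk).apply a e, (lineM_isSymm hg hk).apply e b]; ring

theorem dS_lineM (a b : Fin 4) : dS (lineM hg hk a b) = 0 := by
  simp [lineM, liftM, dS_lift, dS_parT]

theorem dT_lineM (a b : Fin 4) : dT (lineM hg hk a b) = liftM k hk a b := by
  simp [lineM, liftM, dT_lift, dT_parT]

theorem dS_gaugeVec (ρ : Fin 4) : dS (gaugeVec α hg hdet hξ ρ) = 0 := by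
  simp [gaugeVec, dS_raised, dS_parT]

theorem dT_gaugeVec (ρ : Fin 4) :
    dT (gaugeVec α hg hdet hξ ρ) = raised hg hdet (ξ 1) (hξ 1) ρ := by
  simp [gaugeVec, dT_raised, dT_parT]

theorem dS_gaugeFac : dS (gaugeFac α hφ) = 0 := by
  simp [gaugeFac, dS_lift, dS_parT, Geom.D_two]

theorem dT_gaugeFac : dT (gaugeFac α hφ) = 2 * lift (φ 1) (hφ 1) := by
  simp [gaugeFac, dT_lift, dT_parT, Geom.D_two]

theorem lie2_zero_left {A : Type*} [CommRing A] [Algebra ℝ A] {D : Fin 4 → Derivation ℝ A A}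
    (t : Fin 4 → Fin 4 → A) (a b : Fin 4) : lie2 D (fun _ => 0) t a b = 0 := by simp [lie2]

theorem lie2_zero_right {A : Type*} [CommRing A] [Algebra ℝ A] {D : Fin 4 → Derivation ℝ A A}
    (v : Fin 4 → A) (a b : Fin 4) : lie2 D v (fun _ _ => 0) a b = 0 := by simp [lie2]

theorem dS_gaugeM (a b : Fin 4) : dS (gaugeM α hg hk hdet hξ hφ a b)
    = lie2 (sdir (ℝ × ℝ)) (gaugeVec α hg hdet hξ) (lineM hg hk) a b
      + gaugeFac α hφ * lineM hg hk a b := by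
  simp only [gaugeM, Matrix.of_apply, map_add, Derivation.leibniz, dS_lineM, dS_parS, dS_gaugeFac,
    dS_lie2 _ (lineM hg hk), dS_gaugeVec, lie2_zero_left (lineM hg hk), lie2_zero_right,
    smul_eq_mul]
  ring

theorem dT_gaugeM (a b : Fin 4) : dT (gaugeM α hg hk hdet hξ hφ a b)
    = liftM k hk a b + parS *
      (lie2 (sdir (ℝ × ℝ)) (raised hg hdet (ξ 1) (hξ 1)) (lineM hg hk) a b
      + lie2 (sdir (ℝ × ℝ)) (gaugeVec α hg hdet hξ) (liftM k hk) a b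
      + (2 * lift (φ 1) (hφ 1) * lineM hg hk a b + gaugeFac α hφ * liftM k hk a b)) := by
  simp only [gaugeM, Matrix.of_apply, map_add, Derivation.leibniz, dT_lineM, dT_parS, dT_gaugeFac,
    dT_lie2 _ (lineM hg hk), dT_gaugeVec, smul_eq_mul]
  ring

theorem slice_lie2 (p : ℝ × ℝ) {v v' : Fin 4 → SmoothFun ((ℝ × ℝ) × Spacetime)}
    {t t' : Fin 4 → Fin 4 → SmoothFun ((ℝ × ℝ) × Spacetime)}
    (hv : ∀ a, slice p (v a) = slice p (v' a)) (ht : ∀ a b, slice p (t a b) = slice p (t' a b))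
    (a b : Fin 4) (x : Spacetime) :
    slice p (lie2 (sdir (ℝ × ℝ)) v t a b) x = slice p (lie2 (sdir (ℝ × ℝ)) v' t' a b) x := by
  have h : ∀ v t, slice p (lie2 (sdir (ℝ × ℝ)) v t a b) x = ∑ e, (slice p (v e) x
      * pd e (slice p (t a b)) x + pd a (slice p (v e)) x * slice p (t e b) x
      + pd b (slice p (v e)) x * slice p (t a e) x) := fun v t => by
    simp only [pd_slice, slice, lie2, map_sum, map_add, map_mul]
  rw [h, h]
  simp only [hv, ht]

theorem slice_gaugeVec (s : ℝ) (ρ : Fin 4) : slice (s, 0) (gaugeVec α hg hdet hξ ρ)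
    = slice (s, 0) (α • raised hg hdet (ξ 0) (hξ 0) ρ) := by
  ext x
  have : ev (((s, 0) : ℝ × ℝ), x) parT = 0 := rfl
  simp [slice, gaugeVec, this]

theorem slice_lineM (s : ℝ) (a b : Fin 4) :
    slice (s, 0) (lineM hg hk a b) = slice (s, 0) (liftM g hg a b) := by
  ext x
  have : ev (((s, 0) : ℝ × ℝ), x) parT = 0 := rfl
  simp [slice, lineM, this]

/-- At `t = 0` the family is `g` deformed by `α δh¹`. -/
theorem fieldAt_gaugeM (s : ℝ) (x : Spacetime) : fieldAt (gaugeM α hg hk hdet hξ hφ) (s, 0) x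
    = g x + (s * α) • gaugeBase g (ξ 0) (φ 0) x := by
  ext a b
  rw [Matrix.add_apply, Matrix.smul_apply, gaugeBase_eq_slice hg hdet _ (hξ 0) _ (hφ 0) (s, 0)]
  have h1 := slice_lie2 (s, 0) (slice_gaugeVec α hg hdet hξ s) (slice_lineM hg hk s) a b x
  rw [lie2_smul_add _ (liftM g hg)] at h1
  have h2 : ev (((s, 0) : ℝ × ℝ), x) parT = 0 := rfl
  have h3 : ev (((s, 0) : ℝ × ℝ), x) parS = s := rfl
  have h4 := congrFun (slice_lineM hg hk s a b) x
  simp only [slice] at h1 h4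
  simp only [fieldAt, gaugeM, slice, Matrix.of_apply, map_add, map_mul, h1, h4, h2, h3, gaugeFac,
    map_smul, map_ofNat, smul_eq_mul]
  change g x a b + _ = _
  ring

/-- The `t`-derivative of the family at `t = 0` is `k` deformed by its nonlinear gauge variation. -/
theorem fieldAt_dT_gaugeM (s : ℝ) (x : Spacetime) (a b : Fin 4) :
    fieldAt ((gaugeM α hg hk hdet hξ hφ).map dT) (s, 0) x a b
      = k x a b + s * (α * lieD g (ξ 0) k a b x + 2 * α * φ 0 x * k x a b
        + gaugeBase g (ξ 1) (φ 1) x a b) := by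
  rw [gaugeBase_eq_slice hg hdet _ (hξ 1) _ (hφ 1) (s, 0),
    lieD_eq_slice hg hdet _ (hξ 0) hk (s, 0)]
  have h1 := slice_lie2 (s, 0) (slice_gaugeVec α hg hdet hξ s) (t := liftM k hk)
    (fun _ _ => rfl) a b x
  have h5 := slice_lie2 (s, 0) (v := raised hg hdet (ξ 1) (hξ 1)) (fun _ => rfl)
    (slice_lineM hg hk s) a b x
  rw [lie2_smul_add _ (liftM k hk)] at h1
  have h2 : ev (((s, 0) : ℝ × ℝ), x) parT = 0 := rfl
  have h3 : ev (((s, 0) : ℝ × ℝ), x) parS = s := rfl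
  have h4 := congrFun (slice_lineM hg hk s a b) x
  have h6 : ev (((s, 0) : ℝ × ℝ), x) (lift (φ 0) (hφ 0)) = φ 0 x := rfl
  have h7 : ev (((s, 0) : ℝ × ℝ), x) (liftM k hk a b) = k x a b := rfl
  simp only [slice] at h1 h4 h5
  simp only [fieldAt, Matrix.map_apply, dT_gaugeM, slice, Matrix.of_apply, map_add, map_mul, h1,
    h4, h5, h2, h3, h6, h7, gaugeFac, map_smul, map_ofNat, smul_eq_mul]
  ring

theorem raised_mem {K : Set Spacetime} {ξ : CovectorField}
    (hξ : ∀ σ, ContDiff ℝ ∞ fun y => ξ y σ) (h : ∀ x ∉ K, ξ x = 0) (ρ : Fin 4) :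
    raised hg hdet ξ hξ ρ ∈ vanOff (ℝ × ℝ) K :=
  Ideal.sum_mem _ fun σ _ => Ideal.mul_mem_left _ _ fun p x hx => by
    change ξ x σ = 0
    rw [h x hx]; rfl

theorem lift_mem {K : Set Spacetime} {f : ScalarField} (hf : ContDiff ℝ ∞ f)
    (h : ∀ x ∉ K, f x = 0) : lift f hf ∈ vanOff (ℝ × ℝ) K := fun _ x hx => h x hx

/-- The gauge variation of the Bach action vanishes for a compactly supported second field. -/
theorem hasDerivAt_gaugeM {K : Set Spacetime} (hK : IsCompact K) (hkK : ∀ x ∉ K, k x = 0)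
    (hξK : ∀ a, ∀ x ∉ K, ξ a x = 0) (hφK : ∀ a, ∀ x ∉ K, φ a x = 0) :
    (∀ᶠ ε in 𝓝 (0 : ℝ), Integrable (bachLag (fieldAt (gaugeM α hg hk hdet hξ hφ) (ε, 0))
      (fieldAt ((gaugeM α hg hk hdet hξ hφ).map dT) (ε, 0)))) ∧
    HasDerivAt (fun ε : ℝ => ∫ x, bachLag (fieldAt (gaugeM α hg hk hdet hξ hφ) (ε, 0))
      (fieldAt ((gaugeM α hg hk hdet hξ hφ).map dT) (ε, 0)) x) 0 0 := by
  have hv : ∀ a, gaugeVec α hg hdet hξ a ∈ vanOff (ℝ × ℝ) K := fun a =>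
    add_mem (Submodule.smul_of_tower_mem _ α (raised_mem hg hdet (hξ 0) (hξK 0) a))
      (Ideal.mul_mem_left _ _ (raised_mem hg hdet (hξ 1) (hξK 1) a))
  have hf : gaugeFac α hφ ∈ vanOff (ℝ × ℝ) K :=
    Ideal.mul_mem_left _ _ (add_mem (Submodule.smul_of_tower_mem _ α (lift_mem (hφ 0) (hφK 0)))
      (Ideal.mul_mem_left _ _ (lift_mem (hφ 1) (hφK 1))))
  refine hasDerivAt_bachLag_gauge (gaugeM_isSymm α hg hk hdet hξ hφ) hK (fun x => ?_)
    (fun a b p x hx => ?_) (gaugeVec α hg hdet hξ) (gaugeFac α hφ) hv (fun t x a b => ?_)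
  · have h1 := fieldAt_gaugeM α hg hk hdet hξ hφ 0 x
    rw [zero_mul, zero_smul, add_zero] at h1
    change (fieldAt _ (0, 0) x).det < 0
    rw [h1, ← ev_liftM_det g hg ((0, 0), x)]
    exact hdet _
  · have h1 : ∀ p, slice p (gaugeM α hg hk hdet hξ hφ a b) x = g x a b := fun p => by
      have h2 : ∀ e, ev (p, x) (gaugeVec α hg hdet hξ e) = 0 := fun e => hv e p x hx
      have h3 : ∀ a e, ev (p, x) (sdir (ℝ × ℝ) a (gaugeVec α hg hdet hξ e)) = 0 := fun a e =>
        dir_mem_vanOff hK.isClosed _ (hv e) p x hx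
      have h4 : ev (p, x) (liftM k hk a b) = 0 := by
        change k x a b = 0
        rw [hkK x hx]; rfl
      have h5 : ev (p, x) (liftM g hg a b) = g x a b := rfl
      simp only [slice, gaugeM, Matrix.of_apply, lie2, map_add, map_mul, map_sum, h2, h3,
        hf p x hx, lineM, h4, h5]
      simp
    rw [h1, h1]
  · have h1 : ∀ a b, slice (0, t) (gaugeM α hg hk hdet hξ hφ a b)
        = slice (0, t) (lineM hg hk a b) := fun a b => by
      ext x
      have : ev (((0, t) : ℝ × ℝ), x) parS = 0 := rfl
      simp [slice, gaugeM, this]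
    have h2 := slice_lie2 (0, t) (v := gaugeVec α hg hdet hξ) (fun _ => rfl) h1 a b x
    have h3 := congrFun (h1 a b) x
    simp only [slice] at h2 h3
    rw [dS_gaugeM]
    simp only [slice, map_add, map_mul, h2, h3]

end

end

section

/-- Outside the supports of the gauge parameters nothing changes, and inside `h²` may be cut off, so
the action over `U` changes by that of compactly supported fields. -/
theorem gauge_invariance (α : ℝ) (h : Fin 2 → TensorField) (ξ : Fin 2 → CovectorField)
    (φ : Fin 2 → ScalarField) (hh : Admissible α h) (hp : IsGaugeParam ξ φ)
    (U : Set Spacetime)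
    (hsupp : ∀ a, tsupport (ξ a) ⊆ U ∧ tsupport (φ a) ⊆ U)
    (hint : IntegrableOn (lagrangian α h) U) :
    (∀ᶠ ε : ℝ in 𝓝 0, IntegrableOn (lagrangian α (h + ε • gaugeVar α h ξ φ)) U) ∧
      HasDerivAt (fun ε : ℝ => action α U (h + ε • gaugeVar α h ξ φ)) 0 0 := by
  obtain ⟨K₀, hK₀, hK₀U, hξ₀, hφ₀⟩ : ∃ K₀ : Set Spacetime, IsCompact K₀ ∧ K₀ ⊆ U ∧
      (∀ a, ∀ x ∉ K₀, ξ a x = 0) ∧ ∀ a, ∀ x ∉ K₀, φ a x = 0 := by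
    refine ⟨⋃ a, (tsupport (ξ a) ∪ tsupport (φ a)),
      isCompact_iUnion fun a => (hp.supp_ξ a).isCompact.union (hp.supp_φ a).isCompact,
      Set.iUnion_subset fun a => Set.union_subset (hsupp a).1 (hsupp a).2,
      fun a x hx => image_eq_zero_of_notMem_tsupport fun hx' => hx ?_,
      fun a x hx => image_eq_zero_of_notMem_tsupport fun hx' => hx ?_⟩
    · exact Set.mem_iUnion.2 ⟨a, Or.inl hx'⟩
    · exact Set.mem_iUnion.2 ⟨a, Or.inr hx'⟩
  obtain ⟨K, χ, hK, hK₀K, hχ, hχ1, hχ0⟩ := exists_cutoff hK₀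
  have hg : IsSymmField (metric α h) := metric_isSymmField (hh.field 0)
  have hk : IsSymmField fun x => χ x • h 1 x := (hh.field 1).smul hχ
  have hdet : ∀ z, ev z (liftM (metric α h) hg).det < 0 := fun z => by
    rw [ev_liftM_det]; exact hh.det_neg _
  have hξ : ∀ a σ, ContDiff ℝ ∞ fun y => ξ a y σ := fun a σ => contDiff_pi.1 (hp.smooth_ξ a) σ
  have key := hasDerivAt_gaugeM α hg hk hdet hξ hp.smooth_φ hK
    (fun x hx => by rw [hχ0 x hx, zero_smul]) (fun a x hx => hξ₀ a x fun h => hx (hK₀K h))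
    (fun a x hx => hφ₀ a x fun h => hx (hK₀K h))
  have hG : ∀ ε, fieldAt (gaugeM α hg hk hdet hξ hp.smooth_φ) (ε, 0)
      = metric α (h + ε • gaugeVar α h ξ φ) := fun ε => by
    ext1 x
    rw [fieldAt_gaugeM]
    change mink + α • h 0 x + _ = mink + α • (h 0 x + ε • gaugeBase (metric α h) (ξ 0) (φ 0) x)
    rw [smul_add, smul_smul, mul_comm α ε, add_assoc]
  set F : ℝ → ScalarField := fun ε =>
    bachLag (fieldAt (gaugeM α hg hk hdet hξ hp.smooth_φ) (ε, 0))
      (fieldAt ((gaugeM α hg hk hdet hξ hp.smooth_φ).map dT) (ε, 0)) with hF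
  have hk0 : ∀ x ∈ K₀, (fun x => χ x • h 1 x) =ᶠ[𝓝 x] h 1 := fun x hx => by
    filter_upwards [hχ1.filter_mono (nhds_le_nhdsSet hx)] with y hy
    rw [hy, one_smul]
  -- On the supports the Lagrangian is that of the cut-off field; off them it is independent of `ε`.
  have hin : ∀ ε, ∀ x ∈ K₀, lagrangian α (h + ε • gaugeVar α h ξ φ) x = F ε x := fun ε x hx => by
    change bachLag (metric α _) _ x = _
    rw [hF]
    simp only [hG]
    refine bachLag_congr isOpen_univ (Set.eqOn_refl _ _) (Set.mem_univ x) ?_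
    ext a b
    rw [fieldAt_dT_gaugeM, lieD_congr (hk0 x hx), show χ x • h 1 x = h 1 x from (hk0 x hx).self_of_nhds]
    rfl
  have hout : ∀ ε, ∀ x ∉ K₀, F ε x = F 0 x ∧
      lagrangian α (h + ε • gaugeVar α h ξ φ) x = lagrangian α h x := fun ε x hx => by
    have h1 : ∀ ε : ℝ, ∀ x ∉ K₀, metric α (h + ε • gaugeVar α h ξ φ) x = metric α h x :=
      fun ε x hx => by
        change mink + α • (h 0 x + ε • gaugeBase (metric α h) (ξ 0) (φ 0) x)
          = mink + α • h 0 x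
        rw [gaugeBase_eq_zero hK₀.isClosed (hξ₀ 0) (hφ₀ 0) _ hx, smul_zero, add_zero]
    have h2 : ∀ t, ∀ a b, α * lieD (metric α h) (ξ 0) t a b x + 2 * α * φ 0 x * t x a b
        + gaugeBase (metric α h) (ξ 1) (φ 1) x a b = 0 := fun t a b => by
      rw [lieD_eq_zero hK₀.isClosed (hξ₀ 0) _ _ hx, hφ₀ 0 x hx,
        gaugeBase_eq_zero hK₀.isClosed (hξ₀ 1) (hφ₀ 1) _ hx]
      simp
    constructor
    · rw [hF]
      simp only [hG]
      refine bachLag_congr hK₀.isClosed.isOpen_compl (fun y hy => ?_) hx ?_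
      · rw [h1 ε y hy, h1 0 y hy]
      · ext a b
        rw [fieldAt_dT_gaugeM, fieldAt_dT_gaugeM, h2]
        ring
    · change bachLag (metric α _) _ x = bachLag _ _ x
      refine bachLag_congr hK₀.isClosed.isOpen_compl (fun y hy => h1 ε y hy) hx ?_
      ext a b
      change h 1 x a b + ε * (α * lieD (metric α h) (ξ 0) (h 1) a b x
        + 2 * α * φ 0 x * h 1 x a b + gaugeBase (metric α h) (ξ 1) (φ 1) x a b) = h 1 x a b
      rw [h2, mul_zero, add_zero]
  have hsplit : ∀ ε, lagrangian α (h + ε • gaugeVar α h ξ φ)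
      = fun x => lagrangian α h x + (F ε x - F 0 x) := fun ε => by
    ext x
    by_cases hx : x ∈ K₀
    · have h0 := hin 0 x hx
      rw [zero_smul, add_zero] at h0
      rw [hin ε x hx, h0]; ring
    · rw [(hout ε x hx).1, (hout ε x hx).2]; ring
  have key' : (∀ᶠ ε in 𝓝 (0 : ℝ), Integrable (F ε)) ∧
      HasDerivAt (fun ε => ∫ x, F ε x) 0 0 := key
  clear_value F
  have hF0 : Integrable (F 0) := key'.1.self_of_nhds
  constructor
  · filter_upwards [key'.1] with ε hε
    rw [hsplit]
    exact hint.add (hε.sub hF0).integrableOn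
  · have hact : ∀ᶠ ε : ℝ in 𝓝 0, action α U (h + ε • gaugeVar α h ξ φ)
        = action α U h + ((∫ x, F ε x) - ∫ x, F 0 x) := by
      filter_upwards [key'.1] with ε hε
      rw [action, hsplit]
      refine (integral_add (g := fun x => F ε x - F 0 x) hint (hε.sub hF0).integrableOn).trans ?_
      have h3 : ∫ x in U, (F ε x - F 0 x) = ∫ x, (F ε x - F 0 x) :=
        setIntegral_eq_integral_of_forall_compl_eq_zero fun x hx => by
          rw [(hout ε x fun h => hx (hK₀U h)).1, sub_self]
      rw [h3, integral_sub hε hF0]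
      rfl
    refine HasDerivAt.congr_of_eventuallyEq ?_ hact
    exact (key'.2.sub_const _).const_add _

end

section

/-! ### The free limit of the gauge transformations -/

theorem tendsto_pd_slice {V : ℝ × Spacetime → ℝ} {x : Spacetime} (hV : ContDiffAt ℝ 1 V (0, x))
    (μ : Fin 4) : Tendsto (fun α : ℝ => pd μ (fun y => V (α, y)) x) (𝓝 0)
      (𝓝 (fderiv ℝ V (0, x) (0, Pi.single μ 1))) := by
  have hc : Tendsto (fun α : ℝ => ((α, x) : ℝ × Spacetime)) (𝓝 0) (𝓝 (0, x)) :=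
    (Continuous.prodMk_left x).tendsto' _ _ rfl
  have h1 : ∀ᶠ α : ℝ in 𝓝 0, pd μ (fun y => V (α, y)) x
      = fderiv ℝ V (α, x) (0, Pi.single μ 1) := by
    filter_upwards [hc.eventually (hV.eventually (by simp))] with α hα
    have h2 := ((hα.differentiableAt (by simp)).hasFDerivAt.comp x
      (hasFDerivAt_prodMk_right α x)).fderiv
    change fderiv ℝ (V ∘ fun y => (α, y)) x (Pi.single μ 1) = _
    rw [h2]
    simp
  refine Tendsto.congr' (h1.mono fun _ h => h.symm) ?_
  have h3 : ContinuousAt (fderiv ℝ V) (0, x) :=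
    (hV.fderiv_right (m := 0) (by simp)).continuousAt
  exact (((ContinuousLinearMap.apply ℝ ℝ ((0, Pi.single μ 1) : ℝ × Spacetime)).continuous.tendsto _
    ).comp h3.tendsto).comp hc

theorem mink_det : mink.det = -1 := by
  simp [mink, Matrix.det_diagonal, Fin.prod_univ_four]

theorem inv_contDiffAt {h : Fin 2 → TensorField} (h0 : IsSymmField (h 0)) (x : Spacetime)
    (ρ σ : Fin 4) :
    ContDiffAt ℝ 1 (fun z : ℝ × Spacetime => inv (metric z.1 h) ρ σ z.2) (0, x) := by
  let N : Matrix (Fin 4) (Fin 4) (SmoothFun (ℝ × Spacetime)) := Matrix.of fun a b =>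
    ⟨fun z => mink a b + z.1 * h 0 z.2 a b, show ContDiff ℝ ∞ _ from
      contDiff_const.add (contDiff_fst.mul ((h0.smooth a b).comp contDiff_snd))⟩
  have hN : ∀ z, N.map (ev z) = metric z.1 h z.2 := fun z => rfl
  have h1 : (fun z : ℝ × Spacetime => inv (metric z.1 h) ρ σ z.2)
      = fun z => (ev z N.det)⁻¹ * ev z (N.adjugate ρ σ) := by
    ext z
    have : ev z (N.adjugate ρ σ) = (N.map (ev z)).adjugate ρ σ :=
      congrFun (congrFun (RingHom.map_adjugate (ev z : SmoothFun (ℝ × Spacetime) →+* ℝ) N) ρ) σ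
    rw [inv, Matrix.inv_def, ← hN, this, ev_det, Matrix.smul_apply, Ring.inverse_eq_inv',
      smul_eq_mul]
  rw [h1]
  have h2 : ev ((0, x) : ℝ × Spacetime) N.det ≠ 0 := by
    rw [ev_det, hN, metric, zero_smul, add_zero, mink_det]; norm_num
  exact (((smooth_coe N.det).contDiffAt.inv h2).mul
    (smooth_coe (N.adjugate ρ σ)).contDiffAt).of_le (by simp)

theorem tendsto_inv {h : Fin 2 → TensorField} (h0 : IsSymmField (h 0)) (x : Spacetime)
    (ρ σ : Fin 4) : Tendsto (fun α : ℝ => inv (metric α h) ρ σ x) (𝓝 0) (𝓝 (mink⁻¹ ρ σ)) := by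
  have h1 : Tendsto (fun α : ℝ => ((α, x) : ℝ × Spacetime)) (𝓝 0) (𝓝 (0, x)) :=
    (Continuous.prodMk_left x).tendsto' _ _ rfl
  have h2 := (inv_contDiffAt h0 x ρ σ).continuousAt.tendsto.comp h1
  have h3 : inv (metric 0 h) ρ σ x = mink⁻¹ ρ σ := by rw [inv, metric, zero_smul, add_zero]
  rw [← h3]
  exact h2

theorem pd_metric {h : Fin 2 → TensorField} (h0 : IsSymmField (h 0)) (α : ℝ) (a b c : Fin 4)
    (x : Spacetime) :
    pd c (fun y => metric α h y a b) x = α * pd c (fun y => h 0 y a b) x := by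
  change fderiv ℝ (fun y => mink a b + α * h 0 y a b) x _ = _
  have h1 := (h0.smooth a b).differentiable (by simp) x
  rw [fderiv_const_add, fderiv_const_mul h1]
  rfl

theorem tendsto_christoffel {h : Fin 2 → TensorField} (h0 : IsSymmField (h 0)) (x : Spacetime)
    (a b c : Fin 4) : Tendsto (fun α : ℝ => christoffel (metric α h) a b c x) (𝓝 0) (𝓝 0) := by
  have h1 : ∀ α, christoffel (metric α h) a b c x = α * ((1 / 2) * ∑ d, inv (metric α h) a d x *
      (pd b (fun y => h 0 y d c) x + pd c (fun y => h 0 y d b) x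
        - pd d (fun y => h 0 y b c) x)) := fun α => by
    simp only [christoffel, pd_metric h0, Finset.mul_sum]
    exact Finset.sum_congr rfl fun d _ => by ring
  simp only [h1]
  have h2 := tendsto_id.mul ((tendsto_finsetSum Finset.univ fun d _ =>
    (tendsto_inv h0 x a d).mul_const (pd b (fun y => h 0 y d c) x + pd c (fun y => h 0 y d b) x
        - pd d (fun y => h 0 y b c) x)).const_mul (1 / 2))
  simpa using h2

theorem tendsto_gaugeBase {h : Fin 2 → TensorField} (h0 : IsSymmField (h 0))
    (ξ : CovectorField) (φ : ScalarField) (x : Spacetime) (μ ν : Fin 4) :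
    Tendsto (fun α : ℝ => gaugeBase (metric α h) ξ φ x μ ν) (𝓝 0)
      (𝓝 (pd μ (fun y => ξ y ν) x + pd ν (fun y => ξ y μ) x + 2 * φ x * mink μ ν)) := by
  have h1 : ∀ c a, Tendsto (fun α : ℝ => cov1 (metric α h) (fun σ y => ξ y σ) c a x) (𝓝 0)
      (𝓝 (pd c (fun y => ξ y a) x)) := fun c a => by
    have := (tendsto_finsetSum Finset.univ fun e _ =>
      (tendsto_christoffel h0 x e c a).mul_const (ξ x e)).const_sub (pd c (fun y => ξ y a) x)
    simpa [cov1] using this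
  have h2 : Tendsto (fun α : ℝ => metric α h x μ ν) (𝓝 0) (𝓝 (mink μ ν)) := by
    have : Tendsto (fun α : ℝ => mink μ ν + α * h 0 x μ ν) (𝓝 0) (𝓝 (mink μ ν + 0 * h 0 x μ ν)) :=
      (tendsto_id.mul_const _).const_add _
    rwa [zero_mul, add_zero] at this
  have h3 := ((h1 ν μ).add (h1 μ ν)).add (h2.const_mul (2 * φ x))
  rw [add_comm (pd ν (fun y => ξ y μ) x)] at h3
  exact h3

theorem tendsto_gaugeVar (h : Fin 2 → TensorField) (ξ : Fin 2 → CovectorField)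
    (φ : Fin 2 → ScalarField) (hh : ∀ a, IsSymmField (h a)) (hp : IsGaugeParam ξ φ) (a : Fin 2)
    (x : Spacetime) (μ ν : Fin 4) :
    Tendsto (fun α : ℝ => gaugeVar α h ξ φ a x μ ν) (𝓝 0) (𝓝 (freeGaugeVar ξ φ a x μ ν)) := by
  match a with
  | 0 => exact tendsto_gaugeBase (hh 0) (ξ 0) (φ 0) x μ ν
  | 1 =>
    have hξ : ∀ σ, ContDiff ℝ ∞ fun y => ξ 0 y σ := fun σ => contDiff_pi.1 (hp.smooth_ξ 0) σ
    have hV : ∀ ρ, ContDiffAt ℝ 1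
        (fun z : ℝ × Spacetime => ∑ σ, inv (metric z.1 h) ρ σ z.2 * ξ 0 z.2 σ) (0, x) := fun ρ =>
      ContDiffAt.sum fun σ _ => (inv_contDiffAt (hh 0) x ρ σ).mul
        ((((hξ σ).comp contDiff_snd).contDiffAt).of_le (by simp))
    have h1 := fun ρ => tendsto_finsetSum Finset.univ fun σ (_ : σ ∈ Finset.univ) =>
      (tendsto_inv (hh 0) x ρ σ).mul_const (ξ 0 x σ)
    have h2 := tendsto_finsetSum Finset.univ fun ρ (_ : ρ ∈ Finset.univ) =>
      ((((h1 ρ).mul_const (pd ρ (fun y => h 1 y μ ν) x)).add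
        ((tendsto_pd_slice (hV ρ) μ).mul_const (h 1 x ρ ν))).add
        ((tendsto_pd_slice (hV ρ) ν).mul_const (h 1 x μ ρ)))
    have h3 := ((tendsto_id.mul h2).add (((tendsto_id (α := ℝ) (x := 𝓝 0)).const_mul 2).mul_const
      (φ 0 x * h 1 x μ ν))).add (tendsto_gaugeBase (hh 0) (ξ 1) (φ 1) x μ ν)
    simp only [zero_mul, zero_add, mul_zero] at h3
    refine h3.congr fun α => ?_
    change _ = α * lieD (metric α h) (ξ 0) (h 1) μ ν x + 2 * α * φ 0 x * h 1 x μ ν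
      + gaugeBase (metric α h) (ξ 1) (φ 1) x μ ν
    rw [← mul_assoc (2 * id α)]
    rfl

end

section

set_option linter.unusedSimpArgs false

/-! ### The linearised Gauss–Bonnet theorem -/

section

variable {Q : Type*} [AddCommGroup Q] [Module ℝ Q]

/-- The weighted contraction of four pairs of indices. -/
def S4 (e : Fin 4 → ℝ) : (Fin 4 → Fin 4 → Fin 4 → Fin 4 → Q) →ₗ[ℝ] Q where
  toFun f := ∑ a, ∑ b, ∑ c, ∑ d, (e a * e b * e c * e d) • f a b c d
  map_add' f g := by simp only [Pi.add_apply, smul_add, Finset.sum_add_distrib]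
  map_smul' r f := by
    simp only [Pi.smul_apply, Finset.smul_sum, RingHom.id_apply, smul_comm _ r]

variable (e : Fin 4 → ℝ)

theorem S4_apply (f : Fin 4 → Fin 4 → Fin 4 → Fin 4 → Q) :
    S4 e f = ∑ a, ∑ b, ∑ c, ∑ d, (e a * e b * e c * e d) • f a b c d := rfl

theorem S4_swap12 (f : Fin 4 → Fin 4 → Fin 4 → Fin 4 → Q) :
    S4 e f = S4 e fun a b c d => f b a c d := by
  simp only [S4_apply]
  rw [Finset.sum_comm]
  exact Finset.sum_congr rfl fun a _ => Finset.sum_congr rfl fun b _ => Finset.sum_congr rfl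
    fun c _ => Finset.sum_congr rfl fun d _ => by rw [mul_comm (e b)]

theorem S4_swap23 (f : Fin 4 → Fin 4 → Fin 4 → Fin 4 → Q) :
    S4 e f = S4 e fun a b c d => f a c b d := by
  simp only [S4_apply]
  refine Finset.sum_congr rfl fun a _ => ?_
  rw [Finset.sum_comm]
  exact Finset.sum_congr rfl fun b _ => Finset.sum_congr rfl
    fun c _ => Finset.sum_congr rfl fun d _ => by rw [mul_right_comm (e a)]

theorem S4_swap34 (f : Fin 4 → Fin 4 → Fin 4 → Fin 4 → Q) :
    S4 e f = S4 e fun a b c d => f a b d c := by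
  simp only [S4_apply]
  refine Finset.sum_congr rfl fun a _ => Finset.sum_congr rfl fun b _ => ?_
  rw [Finset.sum_comm]
  exact Finset.sum_congr rfl
    fun c _ => Finset.sum_congr rfl fun d _ => by rw [mul_right_comm (e a * e b)]

theorem S4_swap13 (f : Fin 4 → Fin 4 → Fin 4 → Fin 4 → Q) :
    S4 e f = S4 e fun a b c d => f c b a d :=
  ((S4_swap12 e _).trans (S4_swap23 e _)).trans (S4_swap12 e _)

theorem S4_swap24 (f : Fin 4 → Fin 4 → Fin 4 → Fin 4 → Q) :
    S4 e f = S4 e fun a b c d => f a d c b :=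
  ((S4_swap23 e _).trans (S4_swap34 e _)).trans (S4_swap23 e _)

theorem S4_swap14 (f : Fin 4 → Fin 4 → Fin 4 → Fin 4 → Q) :
    S4 e f = S4 e fun a b c d => f d b c a :=
  ((S4_swap12 e _).trans (S4_swap24 e _)).trans (S4_swap12 e _)

theorem S4_congr {f g : Fin 4 → Fin 4 → Fin 4 → Fin 4 → Q}
    (h : ∀ a b c d, f a b c d = g a b c d) : S4 e f = S4 e g :=
  congrArg (S4 e) (funext fun a => funext fun b => funext fun c => funext fun d => h a b c d)

/-- The product `R_{abcd} R_{pqrs}` of two linearised Riemann tensors, up to a factor `4`, where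
`T a b c d i j k l` stands for `(∂_a ∂_b u_{ij}) (∂_c ∂_d v_{kl})`. -/
def riemProd (T : Fin 4 → Fin 4 → Fin 4 → Fin 4 → Fin 4 → Fin 4 → Fin 4 → Fin 4 → Q)
    (a b c d p q r s : Fin 4) : Q :=
  (T a c p r b d q s + T a c q s b d p r - T a c p s b d q r - T a c q r b d p s)
  + (T b d p r a c q s + T b d q s a c p r - T b d p s a c q r - T b d q r a c p s)
  - (T a d p r b c q s + T a d q s b c p r - T a d p s b c q r - T a d q r b c p s)
  - (T b c p r a d q s + T b c q s a d p r - T b c p s a d q r - T b c q r a d p s)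

set_option maxHeartbeats 1000000 in
/-- Modulo total derivatives the four derivatives in `T` commute with one another. The sixteen terms of
each product then fall into a few classes under relabelling of the summed indices, and they
cancel in the Gauss–Bonnet combination. -/
theorem S4_gaussBonnet
    (T : Fin 4 → Fin 4 → Fin 4 → Fin 4 → Fin 4 → Fin 4 → Fin 4 → Fin 4 → Q)
    (t12 : ∀ a b c d i j k l, T a b c d i j k l = T b a c d i j k l)
    (t23 : ∀ a b c d i j k l, T a b c d i j k l = T a c b d i j k l)
    (t34 : ∀ a b c d i j k l, T a b c d i j k l = T a b d c i j k l)
    (u12 : ∀ a b c d i j k l, T a b c d i j k l = T a b c d j i k l)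
    (v12 : ∀ a b c d i j k l, T a b c d i j k l = T a b c d i j l k) :
    S4 e (fun a b c d => riemProd T a b c d a b c d
      - (4 : ℝ) • riemProd T a b a d c b c d + riemProd T a b a b c d c d) = 0 := by
  have h1 : S4 e (fun a b c d => T b b d d a c a c)
      = S4 e (fun a b c d => T a a c c b d b d) :=
    ((S4_swap12 e _).trans (S4_swap34 e _)).trans
      (S4_congr e fun a b c d => by simp only [t12, t23, t34, u12, v12])
  have h2 : S4 e (fun a b c d => T a a d d b c b c)
      = S4 e (fun a b c d => T a a c c b d b d) :=
    (S4_swap34 e _).trans (S4_congr e fun a b c d => by simp only [t12, t23, t34, u12, v12])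
  have h3 : S4 e (fun a b c d => T b b c c a d a d)
      = S4 e (fun a b c d => T a a c c b d b d) :=
    (S4_swap12 e _).trans (S4_congr e fun a b c d => by simp only [t12, t23, t34, u12, v12])
  have h4 : S4 e (fun a b c d => T a b c d a c b d)
      = S4 e (fun a b c d => T a b c d b d a c) :=
    ((S4_swap12 e _).trans (S4_swap34 e _)).trans
      (S4_congr e fun a b c d => by simp only [t12, t23, t34, u12, v12])
  have h5 : S4 e (fun a b c d => T a b c d b c a d)
      = S4 e (fun a b c d => T a b c d b d a c) :=
    (S4_swap34 e _).trans (S4_congr e fun a b c d => by simp only [t12, t23, t34, u12, v12])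
  have h6 : S4 e (fun a b c d => T a b c d a d b c)
      = S4 e (fun a b c d => T a b c d b d a c) :=
    (S4_swap12 e _).trans (S4_congr e fun a b c d => by simp only [t12, t23, t34, u12, v12])
  have h7 : S4 e (fun a b c d => T a b c c b d a d)
      = S4 e (fun a b c d => T a a c d b d b c) :=
    ((S4_swap13 e _).trans (S4_swap24 e _)).trans
      (S4_congr e fun a b c d => by simp only [t12, t23, t34, u12, v12])
  have h8 : S4 e (fun a b c d => T a b d d a c b c)
      = S4 e (fun a b c d => T a a c d b d b c) :=
    ((S4_swap23 e _).trans (S4_swap14 e _)).trans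
      (S4_congr e fun a b c d => by simp only [t12, t23, t34, u12, v12])
  have h9 : S4 e (fun a b c d => T b b c d a c a d)
      = S4 e (fun a b c d => T a a c d b d b c) :=
    ((S4_swap12 e _).trans (S4_swap34 e _)).trans
      (S4_congr e fun a b c d => by simp only [t12, t23, t34, u12, v12])
  have h10 : S4 e (fun a b c d => T a a c d b c b d)
      = S4 e (fun a b c d => T a a c d b d b c) :=
    (S4_swap34 e _).trans (S4_congr e fun a b c d => by simp only [t12, t23, t34, u12, v12])
  have h11 : S4 e (fun a b c d => T a b d d b c a c)
      = S4 e (fun a b c d => T a a c d b d b c) :=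
    (((S4_swap12 e _).trans (S4_swap23 e _)).trans (S4_swap14 e _)).trans
      (S4_congr e fun a b c d => by simp only [t12, t23, t34, u12, v12])
  have h12 : S4 e (fun a b c d => T a b c c a d b d)
      = S4 e (fun a b c d => T a a c d b d b c) :=
    (((S4_swap12 e _).trans (S4_swap13 e _)).trans (S4_swap24 e _)).trans
      (S4_congr e fun a b c d => by simp only [t12, t23, t34, u12, v12])
  have h13 : S4 e (fun a b c d => T b b c d a d a c)
      = S4 e (fun a b c d => T a a c d b d b c) :=
    (S4_swap12 e _).trans (S4_congr e fun a b c d => by simp only [t12, t23, t34, u12, v12])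
  have h14 : S4 e (fun a b c d => T a a b c b d c d)
      = S4 e (fun a b c d => T a a c d b d b c) :=
    (S4_swap24 e _).trans (S4_congr e fun a b c d => by simp only [t12, t23, t34, u12, v12])
  have h15 : S4 e (fun a b c d => T a c c d a b b d)
      = S4 e (fun a b c d => T a a c d b d b c) :=
    ((S4_swap34 e _).trans (S4_swap14 e _)).trans
      (S4_congr e fun a b c d => by simp only [t12, t23, t34, u12, v12])
  have h16 : S4 e (fun a b c d => T a c d d a b b c)
      = S4 e (fun a b c d => T a a c d b d b c) :=
    (S4_swap14 e _).trans (S4_congr e fun a b c d => by simp only [t12, t23, t34, u12, v12])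
  have h17 : S4 e (fun a b c d => T a b b c a d c d)
      = S4 e (fun a b c d => T a a c d b d b c) :=
    ((S4_swap12 e _).trans (S4_swap24 e _)).trans
      (S4_congr e fun a b c d => by simp only [t12, t23, t34, u12, v12])
  have h18 : S4 e (fun a b c d => T a b d d a b c c)
      = S4 e (fun a b c d => T a a b d b d c c) :=
    (S4_swap14 e _).trans (S4_congr e fun a b c d => by simp only [t12, t23, t34, u12, v12])
  have h19 : S4 e (fun a b c d => T a b b d a d c c)
      = S4 e (fun a b c d => T a a b d b d c c) :=
    (S4_swap12 e _).trans (S4_congr e fun a b c d => by simp only [t12, t23, t34, u12, v12])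
  have h20 : S4 e (fun a b c d => T a b c c a b d d)
      = S4 e (fun a b c d => T a a b d b d c c) :=
    ((S4_swap34 e _).trans (S4_swap14 e _)).trans
      (S4_congr e fun a b c d => by simp only [t12, t23, t34, u12, v12])
  have h21 : S4 e (fun a b c d => T b c d d a a b c)
      = S4 e (fun a b c d => T b c c d a a b d) :=
    (S4_swap34 e _).trans (S4_congr e fun a b c d => by simp only [t12, t23, t34, u12, v12])
  have h22 : S4 e (fun a b c d => T b b c d a a c d)
      = S4 e (fun a b c d => T b c c d a a b d) :=
    (S4_swap23 e _).trans (S4_congr e fun a b c d => by simp only [t12, t23, t34, u12, v12])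
  have h23 : S4 e (fun a b c d => T a a c d b b c d)
      = S4 e (fun a b c d => T b c c d a a b d) :=
    ((S4_swap12 e _).trans (S4_swap23 e _)).trans
      (S4_congr e fun a b c d => by simp only [t12, t23, t34, u12, v12])
  have h24 : S4 e (fun a b c d => T a a c c b b d d)
      = S4 e (fun a b c d => T b b d d a a c c) :=
    ((S4_swap12 e _).trans (S4_swap34 e _)).trans
      (S4_congr e fun a b c d => by simp only [t12, t23, t34, u12, v12])
  have h25 : S4 e (fun a b c d => T a a d d b b c c)
      = S4 e (fun a b c d => T b b d d a a c c) :=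
    (S4_swap12 e _).trans (S4_congr e fun a b c d => by simp only [t12, t23, t34, u12, v12])
  have h26 : S4 e (fun a b c d => T b b c c a a d d)
      = S4 e (fun a b c d => T b b d d a a c c) :=
    (S4_swap34 e _).trans (S4_congr e fun a b c d => by simp only [t12, t23, t34, u12, v12])
  have hf : (fun a b c d => riemProd T a b c d a b c d
      - (4 : ℝ) • riemProd T a b a d c b c d + riemProd T a b a b c d c d)
      = (-3 : ℝ) • (fun a b c d => T a a c c b d b d) + (1 : ℝ) • (fun a b c d => T b b d d a c a c)
      + (1 : ℝ) • (fun a b c d => T a a d d b c b c) + (1 : ℝ) • (fun a b c d => T b b c c a d a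
      d) + (1 : ℝ) • (fun a b c d => T a b c d b d a c) + (1 : ℝ) • (fun a b c d => T a b c d a c
      b d) + (1 : ℝ) • (fun a b c d => T a b c d b c a d) + (-3 : ℝ) • (fun a b c d => T a b c d a
      d b c) + (3 : ℝ) • (fun a b c d => T a a c d b d b c) + (-1 : ℝ) • (fun a b c d => T a b c c
      b d a d) + (-1 : ℝ) • (fun a b c d => T a b d d a c b c) + (-1 : ℝ) • (fun a b c d => T b b
      c d a c a d) + (-1 : ℝ) • (fun a b c d => T a a c d b c b d) + (-1 : ℝ) • (fun a b c d => T
      a b d d b c a c) + (3 : ℝ) • (fun a b c d => T a b c c a d b d) + (-1 : ℝ) • (fun a b c d =>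
      T b b c d a d a c) + (4 : ℝ) • (fun a b c d => T a a b c b d c d) + (4 : ℝ) • (fun a b c d
      => T a c c d a b b d) + (-4 : ℝ) • (fun a b c d => T a c d d a b b c) + (-4 : ℝ) • (fun a b
      c d => T a b b c a d c d) + (-4 : ℝ) • (fun a b c d => T a a b d b d c c) + (2 : ℝ) • (fun a
      b c d => T a b d d a b c c) + (4 : ℝ) • (fun a b c d => T a b b d a d c c) + (-2 : ℝ) • (fun
      a b c d => T a b c c a b d d) + (-4 : ℝ) • (fun a b c d => T b c c d a a b d) + (4 : ℝ) •
      (fun a b c d => T b c d d a a b c) + (2 : ℝ) • (fun a b c d => T b b c d a a c d) + (-2 : ℝ)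
      • (fun a b c d => T a a c d b b c d) + (-3 : ℝ) • (fun a b c d => T b b d d a a c c) + (1 :
      ℝ) • (fun a b c d => T a a c c b b d d) + (1 : ℝ) • (fun a b c d => T a a d d b b c c) + (1
      : ℝ) • (fun a b c d => T b b c c a a d d) := by
    funext a b c d
    simp only [riemProd, Pi.add_apply, Pi.smul_apply, t12, t23, t34, u12, v12]
    module
  rw [hf]
  simp only [map_add, map_smul, h1, h2, h3, h4, h5, h6, h7, h8, h9, h10, h11, h12, h13, h14, h15,
    h16, h17, h18, h19, h20, h21, h22, h23, h24, h25, h26]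
  module

end

end

section

section

variable {A : Type*} [CommRing A] [Algebra ℝ A] {D : Fin 4 → Derivation ℝ A A}

/-- Minus twice the linearised Riemann tensor of a tensor field `u`. -/
def linRiem (D : Fin 4 → Derivation ℝ A A) (u : Fin 4 → Fin 4 → A) (a b c d : Fin 4) : A :=
  D a (D c (u b d)) + D b (D d (u a c)) - D a (D d (u b c)) - D b (D c (u a d))

theorem deriv_mem_exact {I : Ideal A} (a : Fin 4) {f : A} (hf : f ∈ I) : D a f ∈ Exact D I := by
  refine ⟨Pi.single a f, fun b => ?_, ?_⟩
  · by_cases h : b = a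
    · subst h; simpa using hf
    · rw [Pi.single_eq_of_ne h]; exact I.zero_mem
  · rw [Finset.sum_eq_single a (fun b _ h => by rw [Pi.single_eq_of_ne h, map_zero]) (by simp),
      Pi.single_eq_same]

/-- The linearised Gauss–Bonnet theorem: the bilinear Gauss–Bonnet density is a total derivative.
Modulo exact elements a derivative of one factor may be exchanged with one of the other. -/
theorem gaussBonnet_exact (comm : ∀ a b x, D a (D b x) = D b (D a x)) (u v : Fin 4 → Fin 4 → A)
    (hu : ∀ a b, u a b = u b a) (hv : ∀ a b, v a b = v b a) {I : Ideal A}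
    (hD : ∀ a x, x ∈ I → D a x ∈ I) (hI : ∀ a b, u a b ∈ I) (e : Fin 4 → ℝ) :
    S4 e (fun a b c d => linRiem D u a b c d * linRiem D v a b c d
      - (4 : ℝ) • (linRiem D u a b a d * linRiem D v c b c d)
      + linRiem D u a b a b * linRiem D v c d c d) ∈ Exact D I := by
  let π := (Exact D I).mkQ
  let T : Fin 4 → Fin 4 → Fin 4 → Fin 4 → Fin 4 → Fin 4 → Fin 4 → Fin 4 → A ⧸ Exact D I :=
    fun a b c d i j k l => π (D a (D b (u i j)) * D c (D d (v k l)))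
  have hprod : ∀ a b c d p q r s, π (linRiem D u a b c d * linRiem D v p q r s)
      = riemProd T a b c d p q r s := by
    intro a b c d p q r s
    simp only [linRiem, riemProd, T, add_mul, mul_add, sub_mul, mul_sub, map_add, map_sub]
    abel
  have h := S4_gaussBonnet e T (fun a b c d i j k l => by simp only [T, comm a b])
    (fun a b c d i j k l => by
      simp only [T, π]
      rw [Submodule.mkQ_apply, Submodule.mkQ_apply, Submodule.Quotient.eq]
      have h1 := (Exact D I).sub_mem
        (deriv_mem_exact (D := D) (I := I) b
          (I.mul_mem_right (D c (D d (v k l))) (hD a _ (hI i j))))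
        (deriv_mem_exact (D := D) (I := I) c
          (I.mul_mem_right (D b (D d (v k l))) (hD a _ (hI i j))))
      convert h1 using 1
      simp only [Derivation.leibniz, smul_eq_mul, comm b a, comm c a, comm c b]
      ring)
    (fun a b c d i j k l => by simp only [T, comm c d])
    (fun a b c d i j k l => by simp only [T, hu i j])
    (fun a b c d i j k l => by simp only [T, hv k l])
  rw [← Submodule.Quotient.mk_eq_zero, ← Submodule.mkQ_apply, ← h]
  simp only [S4_apply, map_sum, map_smul, map_add, map_sub]
  exact Finset.sum_congr rfl fun a _ => Finset.sum_congr rfl fun b _ => Finset.sum_congr rfl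
    fun c _ => Finset.sum_congr rfl fun d _ => by rw [← hprod, ← hprod, ← hprod]

end

end

section

/-! ### The square of the linearised Weyl tensor -/

/-- The diagonal entries of the Minkowski metric. -/
def mdiag (a : Fin 4) : ℝ := mink a a

theorem mink_eq (a b : Fin 4) : mink a b = if a = b then mdiag a else 0 := by
  by_cases h : a = b
  · subst h; rw [if_pos rfl, mdiag]
  · rw [if_neg h, mink, Matrix.diagonal_apply_ne _ h]

theorem mdiag_mul_self (a : Fin 4) : mdiag a * mdiag a = 1 := by
  fin_cases a <;> simp [mdiag, mink]

/-- The `η`-contraction `X_{ab} Y^{ba}`. -/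
def inn (X Y : Fin 4 → Fin 4 → ℝ) : ℝ := ∑ b, ∑ d, mdiag b * mdiag d * (X b d * Y d b)

/-- The `η`-trace. -/
def mtr (X : Fin 4 → Fin 4 → ℝ) : ℝ := ∑ a, mdiag a * X a a

theorem inn_comm (X Y : Fin 4 → Fin 4 → ℝ) : inn X Y = inn Y X := by
  simp only [inn]
  rw [Finset.sum_comm]
  exact Finset.sum_congr rfl fun a _ => Finset.sum_congr rfl fun b _ => by ring

theorem inn_mink (X : Fin 4 → Fin 4 → ℝ) (c : ℝ) : inn (fun a b => c * mink a b) X = c * mtr X := by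
  simp only [inn, mtr, mink_eq, Finset.mul_sum]
  refine Finset.sum_congr rfl fun a _ => ?_
  rw [Finset.sum_eq_single a (fun b _ h => by rw [if_neg (Ne.symm h)]; ring) (by simp), if_pos rfl]
  linear_combination (c * mdiag a * X a a) * mdiag_mul_self a

theorem inn_add (X Y Z : Fin 4 → Fin 4 → ℝ) :
    inn (fun a b => X a b + Y a b) Z = inn X Z + inn Y Z := by
  simp only [inn, add_mul, mul_add, Finset.sum_add_distrib]

theorem inn_mul (X Z : Fin 4 → Fin 4 → ℝ) (c : ℝ) :
    inn (fun a b => c * X a b) Z = c * inn X Z := by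
  simp only [inn, Finset.mul_sum]
  exact Finset.sum_congr rfl fun a _ => Finset.sum_congr rfl fun b _ => by ring

/-- The tensor `η ∧ K` subtracted from the Riemann tensor in the Weyl tensor. -/
def minkWedge (K : Fin 4 → Fin 4 → ℝ) (a b c d : Fin 4) : ℝ :=
  mink a c * K d b - mink a d * K c b - mink b c * K d a + mink b d * K c a

theorem S4_mink (f : Fin 4 → Fin 4 → Fin 4 → Fin 4 → ℝ) :
    S4 mdiag (fun a b c d => mink a c * f a b c d)
      = ∑ b, ∑ d, mdiag b * mdiag d * ∑ a, mdiag a * f a b a d := by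
  rw [S4_apply, Finset.sum_comm]
  refine Finset.sum_congr rfl fun b _ => ?_
  have : ∀ a, ∑ c, ∑ d, (mdiag a * mdiag b * mdiag c * mdiag d) • (mink a c * f a b c d)
      = ∑ d, mdiag a * mdiag b * mdiag d * f a b a d := fun a => by
    rw [Finset.sum_eq_single a (fun c _ h => by simp [mink_eq, Ne.symm h]) (by simp)]
    refine Finset.sum_congr rfl fun d _ => ?_
    rw [mink_eq, if_pos rfl, smul_eq_mul]
    linear_combination (mdiag a * mdiag b * mdiag d * f a b a d) * mdiag_mul_self a
  simp only [this]
  rw [Finset.sum_comm]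
  simp only [Finset.mul_sum]
  exact Finset.sum_congr rfl fun a _ => Finset.sum_congr rfl fun b _ => by ring

theorem S4_minkWedge (R : Fin 4 → Fin 4 → Fin 4 → Fin 4 → ℝ)
    (h12 : ∀ a b c d, R a b c d = -R b a c d) (h34 : ∀ a b c d, R a b c d = -R a b d c)
    (K : Fin 4 → Fin 4 → ℝ) : S4 mdiag (fun a b c d => R a b c d * minkWedge K a b c d)
      = 4 * inn (fun b d => ∑ a, mdiag a * R a b a d) K := by
  have h0 : S4 mdiag (fun a b c d => mink a c * (R a b c d * K d b))
      = inn (fun b d => ∑ a, mdiag a * R a b a d) K := by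
    rw [S4_mink, inn]
    refine Finset.sum_congr rfl fun b _ => Finset.sum_congr rfl fun d _ => ?_
    rw [Finset.sum_mul]
    congr 1
    exact Finset.sum_congr rfl fun a _ => by ring
  have h1 : S4 mdiag (fun a b c d => -(mink a d * (R a b c d * K c b)))
      = S4 mdiag (fun a b c d => mink a c * (R a b c d * K d b)) :=
    (S4_swap34 _ _).trans (S4_congr _ fun a b c d => by rw [h34 a b d c]; ring)
  have h2 : S4 mdiag (fun a b c d => -(mink b c * (R a b c d * K d a)))
      = S4 mdiag (fun a b c d => mink a c * (R a b c d * K d b)) :=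
    (S4_swap12 _ _).trans (S4_congr _ fun a b c d => by rw [h12 b a c d]; ring)
  have h3 : S4 mdiag (fun a b c d => mink b d * (R a b c d * K c a))
      = S4 mdiag (fun a b c d => mink a c * (R a b c d * K d b)) :=
    ((S4_swap12 _ _).trans (S4_swap34 _ _)).trans (S4_congr _ fun a b c d => by
      rw [h12 b a d c, h34 a b d c]; ring)
  have h4 : (fun a b c d => R a b c d * minkWedge K a b c d)
      = (fun a b c d => mink a c * (R a b c d * K d b))
      + (fun a b c d => -(mink a d * (R a b c d * K c b)))
      + (fun a b c d => -(mink b c * (R a b c d * K d a)))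
      + fun a b c d => mink b d * (R a b c d * K c a) := by
    funext a b c d
    simp only [minkWedge, Pi.add_apply]
    ring
  rw [h4, map_add, map_add, map_add, h1, h2, h3, h0]
  ring

theorem minkWedge_trace (K : Fin 4 → Fin 4 → ℝ) (hK : ∀ a b, K a b = K b a) (b d : Fin 4) :
    ∑ a, mdiag a * minkWedge K a b a d = 2 * K b d + mtr K * mink b d := by
  have h0 : ∀ f : Fin 4 → ℝ, ∀ d, ∑ a, mdiag a * (mink a d * f a) = f d := fun f d => by
    rw [Finset.sum_eq_single d (fun c _ h => by simp [mink_eq, h]) (by simp), mink_eq, if_pos rfl,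
      ← mul_assoc, mdiag_mul_self, one_mul]
  have h1 : ∀ a, mdiag a * minkWedge K a b a d = K b d - mdiag a * (mink a d * K a b)
      - mdiag a * (mink a b * K d a) + mink b d * (mdiag a * K a a) := fun a => by
    have : mink b a = mink a b := mink_isSymm.apply a b
    rw [minkWedge, this, hK b d]
    have h2 : mdiag a * mink a a = 1 := mdiag_mul_self a
    linear_combination K d b * h2
  simp only [h1, Finset.sum_add_distrib, Finset.sum_sub_distrib, h0, ← Finset.mul_sum]
  rw [hK d b, mtr]
  simp
  ring

/-- The product of two Weyl tensors is the Gauss–Bonnet density plus a quadratic expression in the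
Schouten tensors. Repeated lower indices are contracted with `η`, which is diagonal. -/
theorem S4_weyl (R R' : Fin 4 → Fin 4 → Fin 4 → Fin 4 → ℝ) (K K' : Fin 4 → Fin 4 → ℝ)
    (h12 : ∀ a b c d, R a b c d = -R b a c d) (h34 : ∀ a b c d, R a b c d = -R a b d c)
    (h12' : ∀ a b c d, R' a b c d = -R' b a c d) (h34' : ∀ a b c d, R' a b c d = -R' a b d c)
    (hK : ∀ a b, K a b = K b a) (hK' : ∀ a b, K' a b = K' b a)
    (hR : ∀ b d, ∑ a, mdiag a * R a b a d = 2 * K b d + mtr K * mink b d)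
    (hR' : ∀ b d, ∑ a, mdiag a * R' a b a d = 2 * K' b d + mtr K' * mink b d) :
    S4 mdiag (fun a b c d => (R a b c d - minkWedge K a b c d)
        * (R' a b c d - minkWedge K' a b c d))
      = S4 mdiag (fun a b c d => R a b c d * R' a b c d - 4 * (R a b a d * R' c b c d)
        + R a b a b * R' c d c d) + 8 * (inn K K' - mtr K * mtr K') := by
  have hsplit : (fun a b c d => (R a b c d - minkWedge K a b c d)
        * (R' a b c d - minkWedge K' a b c d))
      = (fun a b c d => R a b c d * R' a b c d) - (fun a b c d => R a b c d * minkWedge K' a b c d)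
      - (fun a b c d => R' a b c d * minkWedge K a b c d)
      + fun a b c d => minkWedge K a b c d * minkWedge K' a b c d := by
    funext a b c d
    simp only [Pi.add_apply, Pi.sub_apply]
    ring
  have hsplit' : (fun a b c d => R a b c d * R' a b c d - 4 * (R a b a d * R' c b c d)
        + R a b a b * R' c d c d)
      = (fun a b c d => R a b c d * R' a b c d)
      - (4 : ℝ) • (fun a b c d => R a b a d * R' c b c d)
      + fun a b c d => R a b a b * R' c d c d := by
    funext a b c d
    simp only [Pi.add_apply, Pi.sub_apply, Pi.smul_apply, smul_eq_mul]
  have hric : S4 mdiag (fun a b c d => R a b a d * R' c b c d)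
      = inn (fun b d => 2 * K b d + mtr K * mink b d) fun b d => 2 * K' b d + mtr K' * mink b d := by
    have h1 : ∀ b d, 2 * K' d b + mtr K' * mink d b = ∑ c, mdiag c * R' c b c d := fun b d => by
      rw [hR', hK' d b, mink_isSymm.apply b d]
    simp only [inn, h1, ← hR]
    rw [S4_apply, Finset.sum_comm]
    refine Finset.sum_congr rfl fun b _ => ?_
    rw [sum_comm21]
    refine Finset.sum_congr rfl fun d _ => ?_
    rw [Finset.sum_mul_sum, Finset.mul_sum]
    refine Finset.sum_congr rfl fun a _ => ?_
    rw [Finset.mul_sum]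
    exact Finset.sum_congr rfl fun c _ => by rw [smul_eq_mul]; ring
  have hm : ∀ K : Fin 4 → Fin 4 → ℝ,
      mtr (fun b d => 2 * K b d + mtr K * mink b d) = 6 * mtr K := fun K => by
    have h1 : ∀ a, mdiag a * (2 * K a a + mtr K * mink a a) = 2 * (mdiag a * K a a) + mtr K :=
      fun a => by
        have h2 : mdiag a * mink a a = 1 := mdiag_mul_self a
        linear_combination mtr K * h2
    have h2 : mtr (fun b d => 2 * K b d + mtr K * mink b d)
        = ∑ a, mdiag a * (2 * K a a + mtr K * mink a a) := rfl
    rw [h2]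
    simp only [h1, Finset.sum_add_distrib, ← Finset.mul_sum]
    rw [← mtr]
    simp
    ring
  have hsc : S4 mdiag (fun a b c d => R a b a b * R' c d c d) = (6 * mtr K) * (6 * mtr K') := by
    have h1 : ∀ K : Fin 4 → Fin 4 → ℝ, ∀ R : Fin 4 → Fin 4 → Fin 4 → Fin 4 → ℝ,
        (∀ b d, ∑ a, mdiag a * R a b a d = 2 * K b d + mtr K * mink b d) →
        6 * mtr K = ∑ a, ∑ b, mdiag a * mdiag b * R a b a b := fun K R hR => by
      rw [← hm, mtr, Finset.sum_comm]
      refine Finset.sum_congr rfl fun b _ => ?_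
      rw [← hR, Finset.mul_sum]
      exact Finset.sum_congr rfl fun a _ => by ring
    rw [h1 K R hR, h1 K' R' hR', S4_apply, Finset.sum_mul]
    refine Finset.sum_congr rfl fun a _ => ?_
    rw [Finset.sum_mul]
    refine Finset.sum_congr rfl fun b _ => ?_
    rw [Finset.mul_sum]
    refine Finset.sum_congr rfl fun c _ => ?_
    rw [Finset.mul_sum]
    exact Finset.sum_congr rfl fun d _ => by rw [smul_eq_mul]; ring
  have hp : ∀ K K' : Fin 4 → Fin 4 → ℝ, inn (fun b d => 2 * K b d + mtr K * mink b d) K'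
      = 2 * inn K K' + mtr K * mtr K' := fun K K' => by
    rw [inn_add, inn_mul, inn_mink]
  have hpp : inn (fun b d => 2 * K b d + mtr K * mink b d)
      (fun b d => 2 * K' b d + mtr K' * mink b d)
      = 2 * (2 * inn K K' + mtr K * mtr K') + mtr K * (6 * mtr K') := by
    rw [hp, hm, inn_comm, hp, inn_comm K' K]
    ring
  rw [hsplit, hsplit', map_add, map_sub, map_sub, map_add, map_sub, map_smul, S4_minkWedge R h12 h34,
    S4_minkWedge R' h12' h34', S4_minkWedge (minkWedge K) (fun a b c d => by
      simp only [minkWedge]; ring) (fun a b c d => by simp only [minkWedge]; ring), hric, hsc]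
  simp only [minkWedge_trace K hK, hR, hR', smul_eq_mul]
  rw [hpp, hp K K', hp K' K, inn_comm K' K]
  ring

end

section

/-! ### The linearised Weyl action -/

section

variable {A : Type*} [CommRing A] [Algebra ℝ A] {D : Fin 4 → Derivation ℝ A A}

/-- The linearised Ricci tensor of a tensor field `u`. -/
def linRic (D : Fin 4 → Derivation ℝ A A) (u : Fin 4 → Fin 4 → A) (a b : Fin 4) : A :=
  ∑ c, mdiag c • ((-(1 / 2) : ℝ) • linRiem D u c a c b)

/-- The linearised Schouten tensor of a tensor field `u`. -/
def linSch (D : Fin 4 → Derivation ℝ A A) (u : Fin 4 → Fin 4 → A) (a b : Fin 4) : A :=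
  (1 / 2 : ℝ) • (linRic D u a b - (1 / 6 : ℝ) • (mink a b • ∑ c, mdiag c • linRic D u c c))

/-- The density `K_{ab} K'^{ab} - κ κ'` of two linearised Schouten tensors. -/
def schPair (D : Fin 4 → Derivation ℝ A A) (u v : Fin 4 → Fin 4 → A) : A :=
  ∑ a, ∑ b, (mdiag a * mdiag b) • (linSch D u a b * linSch D v b a)
    - (∑ a, mdiag a • linSch D u a a) * ∑ a, mdiag a • linSch D v a a

theorem linSch_mem {I : Ideal A} (hD : ∀ a x, x ∈ I → D a x ∈ I) {u : Fin 4 → Fin 4 → A}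
    (hI : ∀ a b, u a b ∈ I) (a b : Fin 4) : linSch D u a b ∈ I := by
  have h0 : ∀ (r : ℝ) (x : A), x ∈ I → r • x ∈ I := fun r x hx =>
    Submodule.smul_of_tower_mem I r hx
  have h1 : ∀ a b c d, linRiem D u a b c d ∈ I := fun a b c d =>
    I.sub_mem (I.sub_mem (I.add_mem (hD _ _ (hD _ _ (hI _ _))) (hD _ _ (hD _ _ (hI _ _))))
      (hD _ _ (hD _ _ (hI _ _)))) (hD _ _ (hD _ _ (hI _ _)))
  have h2 : ∀ a b, linRic D u a b ∈ I := fun a b => I.sum_mem fun c _ => h0 _ _ (h0 _ _ (h1 _ _ _ _))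
  exact h0 _ _ (I.sub_mem (h2 a b) (h0 _ _ (h0 _ _ (I.sum_mem fun c _ => h0 _ _ (h2 c c)))))

theorem schPair_mem {I : Ideal A} (hD : ∀ a x, x ∈ I → D a x ∈ I) {u v : Fin 4 → Fin 4 → A}
    (hI : ∀ a b, u a b ∈ I) : schPair D u v ∈ I :=
  I.sub_mem (I.sum_mem fun a _ => I.sum_mem fun b _ => Submodule.smul_of_tower_mem I _
    (I.mul_mem_right _ (linSch_mem hD hI a b)))
    (I.mul_mem_right _ (I.sum_mem fun a _ => Submodule.smul_of_tower_mem I _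
      (linSch_mem hD hI a a)))

theorem linRic_symm (comm : ∀ a b x, D a (D b x) = D b (D a x)) {u : Fin 4 → Fin 4 → A}
    (hu : ∀ a b, u a b = u b a) (a b : Fin 4) : linRic D u a b = linRic D u b a := by
  refine Finset.sum_congr rfl fun c _ => ?_
  congr 2
  rw [linRiem, linRiem, comm a b, hu a b, comm c b, comm a c, hu a c, hu c b]
  ring

end

theorem sdir_comm {E : Type*} [NormedAddCommGroup E] [NormedSpace ℝ E] (a b : Fin 4)
    (x : SmoothFun (E × Spacetime)) : sdir E a (sdir E b x) = sdir E b (sdir E a x) :=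
  dir_comm _ _ x

section

variable {h h' : TensorField} (hs : IsSymmField h) (hs' : IsSymmField h')

theorem linRiemann_eq_slice (p : ℝ × ℝ) (a b c d : Fin 4) : linRiemann h a b c d
    = slice p ((-(1 / 2) : ℝ) • linRiem (sdir (ℝ × ℝ)) (liftM h hs) a b c d) := by
  have h1 : ∀ a b c d, pd a (pd c fun y => h y b d)
      = slice p (sdir (ℝ × ℝ) a (sdir (ℝ × ℝ) c (liftM h hs b d))) := fun a b c d => by
    rw [← pd_slice, ← pd_slice]; rfl
  ext x
  simp only [linRiemann, h1, linRiem, slice, map_smul, map_add, map_sub, smul_eq_mul]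

theorem linRicci_eq_slice (p : ℝ × ℝ) (a b : Fin 4) : linRicci h a b
    = slice p (linRic (sdir (ℝ × ℝ)) (liftM h hs) a b) := by
  ext x
  simp only [linRicci, linRiemann_eq_slice hs p, linRic, slice, map_sum]
  refine Finset.sum_congr rfl fun c _ => ?_
  rw [Finset.sum_eq_single c (fun d _ hd => by rw [mink_eq, if_neg (Ne.symm hd), zero_mul])
    (by simp), map_smul _ (mdiag c), mink_eq, if_pos rfl, smul_eq_mul]

theorem linScalar_eq_slice (p : ℝ × ℝ) : linScalar h
    = slice p (∑ c, mdiag c • linRic (sdir (ℝ × ℝ)) (liftM h hs) c c) := by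
  ext x
  simp only [linScalar, linRicci_eq_slice hs p, slice, map_sum]
  refine Finset.sum_congr rfl fun c _ => ?_
  rw [Finset.sum_eq_single c (fun d _ hd => by rw [mink_eq, if_neg (Ne.symm hd), zero_mul])
    (by simp), map_smul _ (mdiag c), mink_eq, if_pos rfl, smul_eq_mul]

theorem linSchouten_eq_slice (p : ℝ × ℝ) (a b : Fin 4) : linSchouten h a b
    = slice p (linSch (sdir (ℝ × ℝ)) (liftM h hs) a b) := by
  ext x
  simp only [linSchouten, linRicci_eq_slice hs p, linScalar_eq_slice hs p, linSch, slice, map_smul,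
    map_sub, smul_eq_mul, mul_assoc]

theorem linRicci_symm (hs : IsSymmField h) (a b : Fin 4) : linRicci h a b = linRicci h b a := by
  have hu : ∀ a b, liftM h hs a b = liftM h hs b a := fun a b => (liftM_isSymm h hs).apply b a
  have key : linRic (sdir (ℝ × ℝ)) (liftM h hs) a b = linRic (sdir (ℝ × ℝ)) (liftM h hs) b a :=
    linRic_symm (D := sdir (ℝ × ℝ)) (u := liftM h hs) sdir_comm hu a b
  exact (linRicci_eq_slice hs 0 a b).trans
    ((congrArg (slice (0 : ℝ × ℝ)) key).trans (linRicci_eq_slice hs 0 b a).symm)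

theorem linSchouten_symm (hs : IsSymmField h) (a b : Fin 4) (x : Spacetime) :
    linSchouten h a b x = linSchouten h b a x := by
  rw [linSchouten, linSchouten, linRicci_symm hs a b, mink_isSymm.apply b a]

theorem linRicci_eq_linSchouten (x : Spacetime) (a b : Fin 4) :
    ∑ c, mdiag c * linRiemann h c a c b x = 2 * linSchouten h a b x
      + mtr (fun a b => linSchouten h a b x) * mink a b := by
  have h1 : ∀ a b, ∑ c, mdiag c * linRiemann h c a c b x = linRicci h a b x := fun a b => by
    refine Finset.sum_congr rfl fun c _ => ?_
    rw [Finset.sum_eq_single c (fun d _ hd => by rw [mink_eq, if_neg (Ne.symm hd), zero_mul])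
      (by simp), mink_eq, if_pos rfl]
  have h2 : linScalar h x = ∑ a, mdiag a * linRicci h a a x := by
    refine Finset.sum_congr rfl fun c _ => ?_
    rw [Finset.sum_eq_single c (fun d _ hd => by rw [mink_eq, if_neg (Ne.symm hd), zero_mul])
      (by simp), mink_eq, if_pos rfl]
  have h3 : mtr (fun a b => linSchouten h a b x) = (1 / 6) * linScalar h x := by
    have h4 : ∀ a, mdiag a * linSchouten h a a x
        = (1 / 2) * (mdiag a * linRicci h a a x) - (1 / 12) * linScalar h x := fun a => by
      have h5 : mdiag a * mink a a = 1 := mdiag_mul_self a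
      rw [linSchouten]
      linear_combination (-(1 / 12) * linScalar h x) * h5
    simp only [mtr, h4, Finset.sum_sub_distrib, ← Finset.mul_sum, ← h2]
    simp
    ring
  rw [h1, h3, linSchouten]
  ring

/-- The Gauss–Bonnet density of two linearised Riemann tensors. -/
def gbDensity {A : Type*} [CommRing A] [Algebra ℝ A] (D : Fin 4 → Derivation ℝ A A)
    (u v : Fin 4 → Fin 4 → A) : A :=
  S4 mdiag (fun a b c d => linRiem D u a b c d * linRiem D v a b c d
      - (4 : ℝ) • (linRiem D u a b a d * linRiem D v c b c d)
      + linRiem D u a b a b * linRiem D v c d c d)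

theorem gbDensity_mem {A : Type*} [CommRing A] [Algebra ℝ A] {D : Fin 4 → Derivation ℝ A A}
    {I : Ideal A} (hD : ∀ a x, x ∈ I → D a x ∈ I) {u v : Fin 4 → Fin 4 → A}
    (hI : ∀ a b, u a b ∈ I) : gbDensity D u v ∈ I := by
  have h3 : ∀ a b c d, linRiem D u a b c d ∈ I := fun a b c d =>
    I.sub_mem (I.sub_mem (I.add_mem (hD _ _ (hD _ _ (hI _ _))) (hD _ _ (hD _ _ (hI _ _))))
      (hD _ _ (hD _ _ (hI _ _)))) (hD _ _ (hD _ _ (hI _ _)))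
  rw [gbDensity, S4_apply]
  exact I.sum_mem fun a _ => I.sum_mem fun b _ => I.sum_mem fun c _ => I.sum_mem fun d _ =>
    Submodule.smul_of_tower_mem I _ (I.add_mem (I.sub_mem (I.mul_mem_right _ (h3 _ _ _ _))
      (Submodule.smul_of_tower_mem I _ (I.mul_mem_right _ (h3 _ _ _ _))))
      (I.mul_mem_right _ (h3 _ _ _ _)))

theorem S4_linRiemann_eq_slice (p : ℝ × ℝ) (x : Spacetime) :
    S4 mdiag (fun a b c d => linRiemann h a b c d x * linRiemann h' a b c d x
      - 4 * (linRiemann h a b a d x * linRiemann h' c b c d x)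
      + linRiemann h a b a b x * linRiemann h' c d c d x)
    = (1 / 4) * slice p (gbDensity (sdir (ℝ × ℝ)) (liftM h hs) (liftM h' hs')) x := by
  have h1 : ∀ a b c d, linRiemann h a b c d x
      = -(1 / 2) * ev (p, x) (linRiem (sdir (ℝ × ℝ)) (liftM h hs) a b c d) := fun a b c d => by
    rw [linRiemann_eq_slice hs p, slice, map_smul, smul_eq_mul]
  have h2 : ∀ a b c d, linRiemann h' a b c d x
      = -(1 / 2) * ev (p, x) (linRiem (sdir (ℝ × ℝ)) (liftM h' hs') a b c d) := fun a b c d => by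
    rw [linRiemann_eq_slice hs' p, slice, map_smul, smul_eq_mul]
  have h3 : slice p (gbDensity (sdir (ℝ × ℝ)) (liftM h hs) (liftM h' hs')) x
      = S4 mdiag fun a b c d => ev (p, x) (linRiem (sdir (ℝ × ℝ)) (liftM h hs) a b c d
        * linRiem (sdir (ℝ × ℝ)) (liftM h' hs') a b c d
      - (4 : ℝ) • (linRiem (sdir (ℝ × ℝ)) (liftM h hs) a b a d
        * linRiem (sdir (ℝ × ℝ)) (liftM h' hs') c b c d)
      + linRiem (sdir (ℝ × ℝ)) (liftM h hs) a b a b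
        * linRiem (sdir (ℝ × ℝ)) (liftM h' hs') c d c d) := by
    simp only [slice, gbDensity, S4_apply, map_sum, map_smul]
  rw [h3, ← smul_eq_mul, ← map_smul]
  refine S4_congr _ fun a b c d => ?_
  simp only [h1, h2, Pi.smul_apply, map_add, map_sub, map_mul, map_smul, smul_eq_mul]
  ring

theorem inn_linSchouten_eq_slice (p : ℝ × ℝ) (x : Spacetime) :
    inn (fun a b => linSchouten h a b x) (fun a b => linSchouten h' a b x)
      - mtr (fun a b => linSchouten h a b x) * mtr (fun a b => linSchouten h' a b x)
    = slice p (schPair (sdir (ℝ × ℝ)) (liftM h hs) (liftM h' hs')) x := by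
  simp only [linSchouten_eq_slice hs p, linSchouten_eq_slice hs' p, inn, mtr, schPair, slice,
    map_sum, map_smul, map_sub, map_mul, smul_eq_mul]

theorem weylContract_eq_slice (p : ℝ × ℝ) (x : Spacetime) : weylContract h h' x
    = (1 / 4) * slice p (gbDensity (sdir (ℝ × ℝ)) (liftM h hs) (liftM h' hs')) x
      + 8 * slice p (schPair (sdir (ℝ × ℝ)) (liftM h hs) (liftM h' hs')) x := by
  have h12 : ∀ h : TensorField, ∀ a b c d, linRiemann h a b c d x = -linRiemann h b a c d x :=
    fun h a b c d => by simp only [linRiemann]; ring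
  have h34 : ∀ h : TensorField, ∀ a b c d, linRiemann h a b c d x = -linRiemann h a b d c x :=
    fun h a b c d => by simp only [linRiemann]; ring
  have key := S4_weyl (fun a b c d => linRiemann h a b c d x) (fun a b c d => linRiemann h' a b c d x)
    (fun a b => linSchouten h a b x) (fun a b => linSchouten h' a b x) (h12 h) (h34 h) (h12 h')
    (h34 h') (fun a b => linSchouten_symm hs a b x) (fun a b => linSchouten_symm hs' a b x)
    (linRicci_eq_linSchouten x) (linRicci_eq_linSchouten x)
  rw [S4_linRiemann_eq_slice hs hs' p, inn_linSchouten_eq_slice hs hs' p] at key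
  exact key

/-- The integrated product of two linearised Weyl tensors depends only on the linearised Schouten
tensors, by the linearised Gauss–Bonnet theorem. -/
theorem integral_weylContract (hc : HasCompactSupport h) (p : ℝ × ℝ) :
    ∫ x, weylContract h h' x
      = 8 * ∫ x, slice p (schPair (sdir (ℝ × ℝ)) (liftM h hs) (liftM h' hs')) x := by
  have hK : IsCompact (tsupport h) := hc.isCompact
  have hD : ∀ a x, x ∈ vanOff (ℝ × ℝ) (tsupport h) →
      sdir (ℝ × ℝ) a x ∈ vanOff (ℝ × ℝ) (tsupport h) := fun a x hx =>
    dir_mem_vanOff hK.isClosed _ hx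
  have hI : ∀ a b, liftM h hs a b ∈ vanOff (ℝ × ℝ) (tsupport h) := fun a b p x hx => by
    change h x a b = 0
    rw [image_eq_zero_of_notMem_tsupport hx]; rfl
  have hu : ∀ a b, liftM h hs a b = liftM h hs b a := fun a b => (liftM_isSymm h hs).apply b a
  have hv : ∀ a b, liftM h' hs' a b = liftM h' hs' b a :=
    fun a b => (liftM_isSymm h' hs').apply b a
  have hGB : gbDensity (sdir (ℝ × ℝ)) (liftM h hs) (liftM h' hs')
      ∈ Exact (sdir (ℝ × ℝ)) (vanOff (ℝ × ℝ) (tsupport h)) :=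
    gaussBonnet_exact (D := sdir (ℝ × ℝ)) (I := vanOff (ℝ × ℝ) (tsupport h)) sdir_comm
      (liftM h hs) (liftM h' hs') hu hv hD hI mdiag
  have h1 := slice_integrable hK (gbDensity_mem (D := sdir (ℝ × ℝ)) (u := liftM h hs)
    (v := liftM h' hs') hD hI) p
  have h2 := slice_integrable hK (schPair_mem (D := sdir (ℝ × ℝ)) (u := liftM h hs)
    (v := liftM h' hs') hD hI) p
  simp only [weylContract_eq_slice hs hs' p]
  rw [integral_add (h1.const_mul _) (h2.const_mul _), integral_const_mul, integral_const_mul,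
    integral_exact hK hGB, mul_zero, zero_add]

end

end

section

/-! ### Linearisation at the flat metric -/

section

variable {A : Type*} [CommRing A] [Algebra ℝ A] {D : Fin 4 → Derivation ℝ A A} (S : Geom D)
  {ψ : A →ₐ[ℝ] A}

theorem alg_sum_mdiag (a : Fin 4) (f : Fin 4 → A) :
    ∑ e, algebraMap ℝ A (mink a e) * f e = mdiag a • f a := by
  rw [Finset.sum_eq_single a (fun d _ hd => by rw [mink_eq, if_neg (Ne.symm hd), map_zero, zero_mul])
    (by simp), mink_eq, if_pos rfl, Algebra.smul_def]

/-- The Schouten tensor is determined by the Ricci tensor. -/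
theorem eq_schouten_of_ricci {r k : Fin 4 → Fin 4 → A} (h : ∀ a b, r a b = (2 : ℝ) • k a b
      + mink a b • ∑ c, mdiag c • k c c) (a b : Fin 4) :
    k a b = (1 / 2 : ℝ) • (r a b - (1 / 6 : ℝ) • (mink a b • ∑ c, mdiag c • r c c)) := by
  have h1 : ∑ c, mdiag c • r c c = (6 : ℝ) • ∑ c, mdiag c • k c c := by
    have h2 : ∀ c, mdiag c • r c c = (2 : ℝ) • (mdiag c • k c c) + ∑ c, mdiag c • k c c := fun c => by
      rw [h, smul_add, smul_smul _ (mink c c), show mdiag c * mink c c = 1 from mdiag_mul_self c,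
        one_smul, smul_comm]
    rw [Finset.sum_congr rfl fun c _ => h2 c, Finset.sum_add_distrib, ← Finset.smul_sum,
      Finset.sum_const, Finset.card_univ, Fintype.card_fin]
    module
  rw [h1, h]
  module

theorem Geom.flat_inv (hflat : ∀ a b, ψ (S.g a b) = algebraMap ℝ A (mink a b)) (a b : Fin 4) :
    ψ (S.G a b) = algebraMap ℝ A (mink a b) := by
  have h := congrArg ψ (S.gG a b)
  simp only [map_sum, map_mul, hflat, alg_sum_mdiag, apply_ite ψ, map_one, map_zero] at h
  have h2 := congrArg (fun y => mdiag a • y) h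
  simp only [smul_smul, mdiag_mul_self, one_smul] at h2
  rw [h2, mink_eq]
  split_ifs
  · rw [Algebra.algebraMap_eq_smul_one]
  · rw [smul_zero, map_zero]

theorem Geom.flat_christoffel (hΓ : ∀ a b c, S.Γ a b c = (1 / 2 : ℝ) • ∑ d, S.G a d *
      (D b (S.g d c) + D c (S.g d b) - D d (S.g b c)))
    (hψ : ∀ a x, ψ (D a x) = D a (ψ x))
    (hflat : ∀ a b, ψ (S.g a b) = algebraMap ℝ A (mink a b)) (a b c : Fin 4) :
    ψ (S.Γ a b c) = 0 := by
  simp only [hΓ, map_smul, map_sum, map_mul, map_add, map_sub, hψ, hflat, Derivation.map_algebraMap]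
  simp

/-- The background `ψ g = η` has no curvature. Here `ψ` evaluates the parameters of a family of
metrics. -/
theorem Geom.flat_schouten (hΓ : ∀ a b c, S.Γ a b c = (1 / 2 : ℝ) • ∑ d, S.G a d *
      (D b (S.g d c) + D c (S.g d b) - D d (S.g b c)))
    (hψ : ∀ a x, ψ (D a x) = D a (ψ x))
    (hflat : ∀ a b, ψ (S.g a b) = algebraMap ℝ A (mink a b)) (a b : Fin 4) :
    ψ (S.K a b) = 0 := by
  have hric : ∀ a b, ψ (ricD D S.Γ a b) = 0 := fun a b => by
    simp only [ricD, riemD, map_sum, map_sub, map_add, map_mul, hψ, S.flat_christoffel hΓ hψ hflat]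
    simp
  have h := eq_schouten_of_ricci (r := fun a b => ψ (ricD D S.Γ a b)) (k := fun a b => ψ (S.K a b))
    (fun a b => by
      rw [S.schout, map_add, map_mul, map_mul, map_ofNat, hflat, two_smul, two_mul,
        Algebra.smul_def, mul_comm (algebraMap _ _ _)]
      simp only [tr2, map_sum, map_mul, S.flat_inv hflat, alg_sum_mdiag]) a b
  rw [h]
  simp [hric]

/-- The first variation of the Christoffel symbols at the flat metric. -/
theorem Geom.flat_deriv_christoffel (δ : Derivation ℝ A A) (hδ : ∀ a x, δ (D a x) = D a (δ x))
    (hΓ : ∀ a b c, S.Γ a b c = (1 / 2 : ℝ) • ∑ d, S.G a d *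
      (D b (S.g d c) + D c (S.g d b) - D d (S.g b c)))
    (hψ : ∀ a x, ψ (D a x) = D a (ψ x))
    (hflat : ∀ a b, ψ (S.g a b) = algebraMap ℝ A (mink a b)) (a b c : Fin 4) :
    ψ (δ (S.Γ a b c)) = (mdiag a * (1 / 2) : ℝ) • (D b (ψ (δ (S.g a c))) + D c (ψ (δ (S.g a b)))
      - D a (ψ (δ (S.g b c)))) := by
  rw [hΓ, δ.map_smul, map_smul]
  simp only [map_sum, map_mul, map_add, map_sub, Derivation.leibniz, smul_eq_mul, hδ,
    hψ, hflat, Derivation.map_algebraMap, S.flat_inv hflat]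
  simp only [add_zero, sub_zero, zero_mul, alg_sum_mdiag, smul_smul]
  rw [mul_comm]

theorem Geom.flat_deriv_schouten (δ : Derivation ℝ A A) (hδ : ∀ a x, δ (D a x) = D a (δ x))
    (hΓ : ∀ a b c, S.Γ a b c = (1 / 2 : ℝ) • ∑ d, S.G a d *
      (D b (S.g d c) + D c (S.g d b) - D d (S.g b c)))
    (hψ : ∀ a x, ψ (D a x) = D a (ψ x))
    (hflat : ∀ a b, ψ (S.g a b) = algebraMap ℝ A (mink a b)) (a b : Fin 4) :
    ψ (δ (S.K a b)) = linSch D (fun a b => ψ (δ (S.g a b))) a b := by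
  have hric : ∀ a b, ψ (δ (ricD D S.Γ a b)) = linRic D (fun a b => ψ (δ (S.g a b))) a b :=
    fun a b => by
      simp only [ricD, riemD, map_sum, map_sub, map_add, Derivation.leibniz, smul_eq_mul,
        map_mul, hδ, hψ, S.flat_christoffel hΓ hψ hflat, S.flat_deriv_christoffel δ hδ hΓ hψ hflat]
      refine Finset.sum_congr rfl fun c _ => ?_
      simp only [linRiem, Derivation.map_smul, map_add, map_sub, S.comm b c, S.comm c a, S.comm b a,
        S.g_symm c a]
      simp only [zero_mul, add_zero, Finset.sum_const_zero]
      module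
  refine eq_schouten_of_ricci (k := fun a b => ψ (δ (S.K a b))) (fun a b => ?_) a b
  rw [← hric, S.schout, map_add, Derivation.leibniz, Derivation.leibniz, Geom.D_ofNat]
  change ψ (_ + (S.κ • _ + _ • δ S.κ)) = _
  rw [S.deriv_κ]
  simp only [smul_eq_mul, map_add, map_mul, map_sub, map_zero, map_ofNat, tr2, map_sum, up2,
    S.flat_inv hflat, alg_sum_mdiag, S.flat_schouten hΓ hψ hflat, hflat, Geom.κ]
  simp [Algebra.smul_def, map_ofNat]

/-- The second variation of the Weyl density at the flat metric. -/
theorem Geom.flat_deriv_deriv_lag (δ δ' : Derivation ℝ A A) (hs : ψ S.s = 1)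
    (hflat : ∀ a b, ψ (S.g a b) = algebraMap ℝ A (mink a b)) (hK : ∀ a b, ψ (S.K a b) = 0) :
    ψ (δ (4 * δ' S.lag)) = 8 * (∑ a, ∑ b, (mdiag a * mdiag b) •
      (ψ (δ (S.K a b)) * ψ (δ' (S.K b a)))
      - (∑ a, mdiag a • ψ (δ (S.K a a))) * ∑ a, mdiag a • ψ (δ' (S.K a a))) := by
  have hκ : ψ S.κ = 0 := by simp [Geom.κ, tr2, hK]
  have hKK : ∀ a b, ψ (S.KK a b) = 0 := fun a b => by simp [Geom.KK, hK]
  have hn : ψ S.normK = 0 := by simp [Geom.normK, tr2, hK]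
  have hdκ : ∀ δ : Derivation ℝ A A, ψ (δ S.κ) = ∑ a, mdiag a • ψ (δ (S.K a a)) := fun δ => by
    rw [S.deriv_κ, map_sub]
    simp only [tr2, map_sum, map_mul, S.flat_inv hflat, alg_sum_mdiag, hK]
    simp
  have hdn : ∀ δ : Derivation ℝ A A, ψ (δ S.normK) = 0 := fun δ => by
    simp [S.deriv_normK, tr2, up2, hK, hKK]
  have hdKK : ∀ a b, ψ (δ (S.KK a b)) = 0 := fun a b => by
    simp [Geom.KK, Derivation.leibniz, hK]
  have h2 : ∀ x : A, ψ (δ (2 * x)) = 2 * ψ (δ x) := fun x => by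
    rw [Derivation.leibniz, Geom.D_two, smul_zero, add_zero, smul_eq_mul, map_mul, map_ofNat]
  have hddn : ψ (δ (δ' S.normK)) = 2 * ∑ a, ∑ b, (mdiag a * mdiag b) •
      (ψ (δ (S.K a b)) * ψ (δ' (S.K b a))) := by
    rw [S.deriv_normK, map_sub, map_sub, h2, h2]
    simp only [tr2, up2, map_sum, Derivation.leibniz, smul_eq_mul, map_add, map_mul, hK, hKK, hdKK,
      S.flat_inv hflat]
    simp only [mul_zero, zero_mul, add_zero, zero_add, sub_zero, Finset.sum_const_zero]
    simp only [mul_assoc, ← Finset.mul_sum, alg_sum_mdiag]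
    refine congrArg (2 * ·) (Finset.sum_congr rfl fun a _ => Finset.sum_congr rfl fun b _ => ?_)
    rw [S.K_symm b a, smul_smul, mul_smul_comm, mul_comm (ψ _)]
  have hlag : ψ (δ (δ' S.lag)) = ψ (δ (δ' S.normK)) - 2 * (ψ (δ S.κ) * ψ (δ' S.κ)) := by
    simp only [Geom.lag, sq, Derivation.leibniz, smul_eq_mul, map_add, map_sub, map_mul, hs, hκ, hn,
      hdn]
    ring
  rw [Derivation.leibniz, Geom.D_ofNat, smul_zero, add_zero, smul_eq_mul, map_mul, map_ofNat, hlag,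
    hddn, hdκ, hdκ]
  ring

end

/-! ### The free limit of the action -/

theorem bach_const (m : Matrix (Fin 4) (Fin 4) ℝ) (a b : Fin 4) : bach (fun _ => m) a b = 0 := by
  have h1 : ∀ a b c, christoffel (fun _ => m) a b c = 0 := fun a b c => by
    ext x; simp [christoffel, pd]
  have hpd : ∀ a, pd a 0 = 0 := fun a => by ext x; simp [pd]
  have h2 : ∀ a b c d, riemann (fun _ => m) a b c d = 0 := fun a b c d => by
    ext x; simp [riemann, h1, hpd]
  have h3 : ∀ a b, schouten (fun _ => m) a b = 0 := fun a b => by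
    ext x; simp [schouten, ricci, scalarCurv, h2]
  have h4 : ∀ a b c, cotton (fun _ => m) a b c = 0 := fun a b c => by
    ext x; simp [cotton, cov2, h1, h3, hpd]
  ext x
  simp [bach, bachLow, cov3, h1, h3, h4, hpd]

theorem weylContract_comm (h h' : TensorField) : weylContract h h' = weylContract h' h := by
  ext x
  simp only [weylContract, mul_comm (linWeyl h _ _ _ _ x)]

theorem isSymmField_mink : IsSymmField fun _ => mink where
  smooth _ _ := contDiff_const
  symm _ := mink_isSymm

section

variable {h h' : TensorField} (hs : IsSymmField h) (hs' : IsSymmField h')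

/-- The two-parameter family of metrics `η + s h + t h'`. -/
def planeM : Matrix (Fin 4) (Fin 4) (SmoothFun ((ℝ × ℝ) × Spacetime)) :=
  Matrix.of fun a b => liftM _ isSymmField_mink a b + parS * liftM h hs a b + parT * liftM h' hs' a b

theorem planeM_isSymm : (planeM hs hs').IsSymm := Matrix.IsSymm.ext fun a b => by
  simp only [planeM, Matrix.of_apply, (liftM_isSymm _ isSymmField_mink).apply a b,
    (liftM_isSymm h hs).apply a b, (liftM_isSymm h' hs').apply a b]

theorem dS_planeM (a b : Fin 4) : dS (planeM hs hs' a b) = liftM h hs a b := by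
  simp [planeM, dS_liftM, dS_parS, dS_parT]

theorem dT_planeM (a b : Fin 4) : dT (planeM hs hs' a b) = liftM h' hs' a b := by
  simp [planeM, dT_liftM, dT_parS, dT_parT]

theorem slice_planeM (p : ℝ × ℝ) (a b : Fin 4) (x : Spacetime) :
    slice p (planeM hs hs' a b) x = mink a b + p.1 * h x a b + p.2 * h' x a b := rfl

theorem flat_second_variation {r : ℝ} (hr : 0 < r)
    (hdet : ∀ z, ev z ((planeM hs hs').map (reparam r)).det < 0)
    (hM : ((planeM hs hs').map (reparam r)).IsSymm) :
    slice (0, 0) (dS (4 * dT (geomOf ((planeM hs hs').map (reparam r)) hM hdet).lag))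
      = slice (0, 0) (8 * schPair (sdir (ℝ × ℝ)) (liftM h hs) (liftM h' hs')) := by
  have hflat : ∀ a b, freeze (0, 0) ((geomOf ((planeM hs hs').map (reparam r)) hM hdet).g a b)
      = algebraMap ℝ _ (mink a b) := fun a b => ev_ext fun z => by
    change slice (0, 0) (reparam r (planeM hs hs' a b)) z.2 = mink a b
    rw [slice_reparam, slice_planeM]
    simp [damp_zero]
  have hu : (fun a b => freeze (0, 0) (dS ((geomOf ((planeM hs hs').map (reparam r)) hM hdet).g a b)))
      = liftM h hs := by
    ext a b : 2
    refine ev_ext fun z => ?_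
    change slice (0, 0) (dS (reparam r (planeM hs hs' a b))) z.2 = h z.2 a b
    rw [slice_dS_reparam hr, dS_planeM, zero_div, Real.cos_zero, mul_one]
    rfl
  have hv : (fun a b => freeze (0, 0) (dT ((geomOf ((planeM hs hs').map (reparam r)) hM hdet).g a b)))
      = liftM h' hs' := by
    ext a b : 2
    refine ev_ext fun z => ?_
    change slice (0, 0) (dT (reparam r (planeM hs hs' a b))) z.2 = h' z.2 a b
    rw [slice_dT_reparam hr, dT_planeM, zero_div, Real.cos_zero, mul_one]
    rfl
  have hΓ : ∀ a b c, (geomOf ((planeM hs hs').map (reparam r)) hM hdet).Γ a b c = (1 / 2 : ℝ) •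
      ∑ d, (geomOf ((planeM hs hs').map (reparam r)) hM hdet).G a d *
      (sdir (ℝ × ℝ) b ((geomOf ((planeM hs hs').map (reparam r)) hM hdet).g d c)
        + sdir (ℝ × ℝ) c ((geomOf ((planeM hs hs').map (reparam r)) hM hdet).g d b)
        - sdir (ℝ × ℝ) d ((geomOf ((planeM hs hs').map (reparam r)) hM hdet).g b c)) :=
    fun _ _ _ => rfl
  have hvol : freeze (0, 0) (geomOf ((planeM hs hs').map (reparam r)) hM hdet).s = 1 :=
    ev_ext fun z => by
      have h1 : ((planeM hs hs').map (reparam r)).map (ev ((0, 0), z.2)) = mink := by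
        ext a b
        exact congrArg (ev z) (hflat a b)
      change Real.sqrt (-ev ((0, 0), z.2) ((planeM hs hs').map (reparam r)).det) = 1
      rw [ev_det, h1, mink_det, neg_neg, Real.sqrt_one]
  generalize geomOf ((planeM hs hs').map (reparam r)) hM hdet = S at *
  have key := S.flat_deriv_deriv_lag dS dT hvol hflat
    (S.flat_schouten hΓ (freeze_sdir (0, 0)) hflat)
  have hS : ∀ a b, freeze (0, 0) (dS (S.K a b)) = linSch (sdir (ℝ × ℝ)) (liftM h hs) a b :=
    fun a b => by
      rw [← hu]
      exact S.flat_deriv_schouten dS (fun a x => dir_comm _ _ x) hΓ (freeze_sdir (0, 0)) hflat a b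
  have hT : ∀ a b, freeze (0, 0) (dT (S.K a b)) = linSch (sdir (ℝ × ℝ)) (liftM h' hs') a b :=
    fun a b => by
      rw [← hv]
      exact S.flat_deriv_schouten dT (fun a x => dir_comm _ _ x) hΓ (freeze_sdir (0, 0)) hflat a b
  simp only [hS, hT] at key
  have key' := congrArg (slice ((0, 0) : ℝ × ℝ)) key
  rwa [slice_freeze] at key'

/-- The derivative at the flat metric of the action of the interacting theory. -/
theorem hasDerivAt_integral_bachLag_flat {h h' : TensorField} (hs : IsSymmField h)
    (hs' : IsSymmField h') (hc : HasCompactSupport h) (hc' : HasCompactSupport h') :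
    HasDerivAt (fun ε : ℝ => ∫ x, bachLag (fun x => mink + ε • h x) h' x)
      (∫ x, weylContract h h' x) 0 := by
  have hK : IsCompact (tsupport h ∪ tsupport h') := hc.isCompact.union hc'.isCompact
  have hout : ∀ a b (p : ℝ × ℝ), ∀ x ∉ tsupport h ∪ tsupport h',
      slice p (planeM hs hs' a b) x = slice 0 (planeM hs hs' a b) x := fun a b p x hx => by
    rw [slice_planeM, slice_planeM, image_eq_zero_of_notMem_tsupport fun hh => hx (Or.inl hh),
      image_eq_zero_of_notMem_tsupport fun hh => hx (Or.inr hh)]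
    simp
  obtain ⟨r, hr, hdet⟩ := exists_reparam_det (N := planeM hs hs') hK (fun x => by
    have : fieldAt (planeM hs hs') 0 x = mink := by
      ext a b
      change slice 0 (planeM hs hs' a b) x = _
      rw [slice_planeM]; simp
    rw [this, mink_det]; norm_num) hout
  have key := (hasDerivAt_bachLag_deformation (planeM_isSymm hs hs') hK hout hr hdet).2
  rw [flat_second_variation hs hs' hr hdet] at key
  have h1 : ∀ ε : ℝ, fieldAt (planeM hs hs') (ε, 0) = fun x => mink + ε • h x := fun ε => by
    ext x a b
    change slice (ε, 0) (planeM hs hs' a b) x = _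
    rw [slice_planeM]; simp
  have h2 : ∀ ε : ℝ, fieldAt ((planeM hs hs').map dT) (ε, 0) = h' := fun ε => by
    ext x a b
    change slice (ε, 0) (dT (planeM hs hs' a b)) x = _
    rw [dT_planeM]; rfl
  simp only [h1, h2] at key
  have h3 : ∫ x, slice ((0, 0) : ℝ × ℝ) (8 * schPair (sdir (ℝ × ℝ)) (liftM h hs) (liftM h' hs')) x
      = ∫ x, weylContract h h' x := by
    rw [integral_weylContract hs hs' hc (0, 0), ← integral_const_mul]
    refine integral_congr_ae (ae_of_all _ fun x => ?_)
    simp only [slice, map_mul, map_ofNat]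
  rwa [h3] at key

end

theorem tendsto_action {h : Fin 2 → TensorField} (hs : ∀ a, IsSymmField (h a))
    (hc : ∀ a, HasCompactSupport (h a)) :
    Tendsto (fun α : ℝ => α⁻¹ * action α Set.univ h) (𝓝[≠] 0)
      (𝓝 (∫ x, weylContract (h 0) (h 1) x)) := by
  have h1 := hasDerivAt_iff_tendsto_slope.1
    (hasDerivAt_integral_bachLag_flat (hs 0) (hs 1) (hc 0) (hc 1))
  refine h1.congr fun α => ?_
  have h2 : ∫ x, bachLag (fun x => mink + (0 : ℝ) • h 0 x) (h 1) x = 0 := by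
    simp [bachLag, bach_const]
  rw [slope_def_field, h2, sub_zero, sub_zero, action, Measure.restrict_univ, div_eq_inv_mul]
  rfl

theorem freeAction_internalMetric (h : Fin 2 → TensorField) :
    freeAction internalMetric h = ∫ x, weylContract (h 0) (h 1) x := by
  simp only [freeAction, internalMetric, Fin.sum_univ_two, weylContract_comm (h 1) (h 0)]
  simp
  ring

end

section

/-! ### Constant rescalings and traces -/

section

theorem pd_const_mul (s : ℝ) (f : ScalarField) (a : Fin 4) :
    pd a (fun y => s * f y) = fun x => s * pd a f x := by
  ext x
  exact congrArg (fun L => L x (Pi.single a 1)) (fderiv_const_smul_field (𝕜 := ℝ) (f := f) s)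

theorem sqrt_neg_det_smul (s : ℝ) (m : Matrix (Fin 4) (Fin 4) ℝ) :
    Real.sqrt (-(s • m).det) = s ^ 2 * Real.sqrt (-m.det) := by
  rw [Matrix.det_smul, Fintype.card_fin, ← mul_neg, Real.sqrt_mul (by positivity),
    show s ^ 4 = (s ^ 2) ^ 2 by ring, Real.sqrt_sq (by positivity)]

theorem bach_smul {s : ℝ} (hs : s ≠ 0) {g : TensorField} (hdet : ∀ x, (g x).det < 0) (a b : Fin 4)
    (x : Spacetime) : bach (fun x => s • g x) a b x = s⁻¹ ^ 3 * bach g a b x := by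
  have h0 : ∀ a b x, inv (fun x => s • g x) a b x = s⁻¹ * inv g a b x := fun a b x => by
    rw [inv, inv]
    have := Matrix.inv_smul' (g x) (Units.mk0 s hs) (isUnit_iff_ne_zero.2 (hdet x).ne)
    exact congrFun (congrFun this a) b
  have h1 : ∀ a b c, christoffel (fun x => s • g x) a b c = christoffel g a b c := fun a b c => by
    ext x
    simp only [christoffel, h0, Matrix.smul_apply, smul_eq_mul, pd_const_mul]
    congr 1
    refine Finset.sum_congr rfl fun d _ => ?_
    field_simp
  have h2 : ∀ a b, ricci (fun x => s • g x) a b = ricci g a b := fun a b => by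
    ext x
    simp only [ricci, riemann, h1]
  have h2' : ∀ a b c d, riemann (fun x => s • g x) a b c d = riemann g a b c d := fun a b c d => by
    ext x
    simp only [riemann, h1]
  have h3 : ∀ a b, schouten (fun x => s • g x) a b = schouten g a b := fun a b => by
    ext x
    have : scalarCurv (fun x => s • g x) x = s⁻¹ * scalarCurv g x := by
      simp only [scalarCurv, h0, h2, Finset.mul_sum, mul_assoc]
    rw [schouten, schouten, this, h2, Matrix.smul_apply, smul_eq_mul]
    field_simp
  have h3' : schouten (fun x => s • g x) = schouten g := by ext a b : 2; exact h3 a b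
  have h4 : cotton (fun x => s • g x) = cotton g := by
    ext a b c x
    simp only [cotton, cov2, h3', h1]
  have h5 : ∀ a b c d x, weylLow (fun x => s • g x) a b c d x = s * weylLow g a b c d x :=
    fun a b c d x => by
      have h6 : ∀ a, weyl (fun x => s • g x) a b c d x = weyl g a b c d x := fun a => by
        have h7 : ∀ d, ∑ e, inv (fun x => s • g x) a e x * schouten g d e x
            = s⁻¹ * ∑ e, inv g a e x * schouten g d e x := fun d => by
          simp only [h0, mul_assoc, Finset.mul_sum]
        simp only [weyl, h2', h3', h7, Matrix.smul_apply, smul_eq_mul]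
        field_simp
      simp only [weylLow, h6, Matrix.smul_apply, smul_eq_mul, Finset.mul_sum, mul_assoc]
  have h8 : ∀ a b, bachLow (fun x => s • g x) a b x = s⁻¹ * bachLow g a b x := fun a b => by
    have h9 : ∀ c d p q, inv (fun x => s • g x) c p x * inv (fun x => s • g x) d q x
        * schouten g p q x * weylLow (fun x => s • g x) a c b d x
        = s⁻¹ * (inv g c p x * inv g d q x * schouten g p q x * weylLow g a c b d x) :=
      fun c d p q => by
        rw [h0, h0, h5]; field_simp
    have h10 : ∀ c d, inv (fun x => s • g x) c d x * cov3 (fun x => s • g x) (cotton g) d a b c x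
        = s⁻¹ * (inv g c d x * cov3 g (cotton g) d a b c x) := fun c d => by
      rw [h0, mul_assoc]
      simp only [cov3, h1]
    simp only [bachLow, h3', h4, h9, h10, ← Finset.mul_sum]
    ring
  simp only [bach, h0, h8, Finset.mul_sum]
  refine Finset.sum_congr rfl fun p _ => Finset.sum_congr rfl fun q _ => ?_
  ring

/-- Conformal weight of the Bach Lagrangian under constant rescalings of the metric. -/
theorem bachLag_smul {s : ℝ} (hs : s ≠ 0) {g : TensorField} (hdet : ∀ x, (g x).det < 0)
    (t : TensorField) (x : Spacetime) : bachLag (fun x => s • g x) t x = s⁻¹ * bachLag g t x := by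
  have h : ∀ a b, t x a b * (s⁻¹ ^ 3 * bach g a b x) = s⁻¹ ^ 3 * (t x a b * bach g a b x) :=
    fun a b => by ring
  simp only [bachLag, sqrt_neg_det_smul, bach_smul hs hdet, h, ← Finset.mul_sum]
  field_simp

theorem bachLag_linear (g : TensorField) {t t₁ t₂ : TensorField} {x : Spacetime} {p q : ℝ}
    (ht : t x = p • t₁ x + q • t₂ x) :
    bachLag g t x = p * bachLag g t₁ x + q * bachLag g t₂ x := by
  simp only [bachLag, ht, Matrix.add_apply, Matrix.smul_apply, smul_eq_mul, add_mul,
    Finset.sum_add_distrib, mul_assoc, ← Finset.mul_sum]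
  ring

/-- The Bach tensor is trace free. -/
theorem bachLag_self {g : TensorField} (hg : IsSymmField g) (hdet : ∀ x, (g x).det < 0)
    (x : Spacetime) : bachLag g g x = 0 := by
  have hM : ∀ z, ev z (liftM g hg).det < 0 := fun z => by rw [ev_liftM_det]; exact hdet z.2
  have h := bachLag_fieldAt (liftM_isSymm g hg) hM 0 (liftM g hg)
  have h1 : ∀ S : Geom (sdir (ℝ × ℝ)), S.s * tr2 (up2 S.G S.g) S.bac = 0 := fun S => by
    have h2 : tr2 (up2 S.G S.g) S.bac = ∑ a, ∑ b, S.G a b * S.bac a b := by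
      simp only [tr2, S.up2_g]
    rw [h2, S.bac_trace, mul_zero]
  have h3 := h1 (geomOf (liftM g hg) (liftM_isSymm g hg) hM)
  have h4 : fieldAt (liftM g hg) (0 : ℝ × ℝ) = g := rfl
  rw [h4] at h
  rw [h]
  exact (congrArg (fun f => slice (0 : ℝ × ℝ) f x) h3).trans rfl

/-- A compactly supported deformation of a metric is a metric if it is small. -/
theorem eventually_det_neg {g k : TensorField} (hg : IsSymmField g) (hk : IsSymmField k)
    (hdet : ∀ x, (g x).det < 0) (hc : HasCompactSupport k) :
    ∀ᶠ ε : ℝ in 𝓝 0, ∀ x, (g x + ε • k x).det < 0 := by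
  have hs : ∀ p a b x, slice p (lineM hg hk a b) x = g x a b + p.2 * k x a b := fun p a b x => rfl
  obtain ⟨r, hr, h⟩ := exists_reparam_det (N := lineM hg hk) hc.isCompact
    (fun x => by
      have : fieldAt (lineM hg hk) 0 x = g x := by
        ext a b
        change slice 0 (lineM hg hk a b) x = _
        rw [hs]; simp
      rw [this]; exact hdet x)
    (fun a b p x hx => by rw [hs, hs, image_eq_zero_of_notMem_tsupport hx]; simp)
  filter_upwards [Metric.closedBall_mem_nhds (0 : ℝ) hr] with ε hε x
  have h1 := h ((0, r * Real.arcsin (ε / r)), x)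
  rw [ev_det] at h1
  convert h1 using 2
  ext a b
  change g x a b + ε * k x a b = slice (0, r * Real.arcsin (ε / r)) (reparam r (lineM hg hk a b)) x
  rw [slice_reparam, hs, damp_arcsin hr (by simpa using hε)]

end

end

section

/-! ### A field with nonvanishing linearised Weyl action -/

section

/-- The perturbation `h_{00} = f`, with all other components zero. -/
def lapse (f : ScalarField) : TensorField := fun x => Matrix.single 0 0 (f x)

theorem lapse_apply (f : ScalarField) (x : Spacetime) (a b : Fin 4) :
    lapse f x a b = if a = 0 ∧ b = 0 then f x else 0 := by
  simp only [lapse, Matrix.single_apply, eq_comm]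

theorem lapse_isSymmField {f : ScalarField} (hf : ContDiff ℝ ∞ f) : IsSymmField (lapse f) where
  smooth a b := by
    simp only [lapse_apply]
    split_ifs
    · exact hf
    · exact contDiff_const
  symm x := Matrix.IsSymm.ext fun a b => by simp only [lapse_apply, and_comm]

theorem pd_pd_lapse (f : ScalarField) (x : Spacetime) (a c b d : Fin 4) :
    pd a (pd c fun y => lapse f y b d) x = if b = 0 ∧ d = 0 then pd a (pd c f) x else 0 := by
  simp only [lapse_apply]
  split_ifs
  · rfl
  · have : pd c (fun _ => 0) = fun _ => 0 := by ext y; simp [pd]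
    rw [this]
    simp [pd]

theorem pd_comm {f : ScalarField} (hf : ContDiff ℝ ∞ f) (a b : Fin 4) :
    pd a (pd b f) = pd b (pd a f) := by
  have h : ∀ a b, pd a (pd b f) = slice 0 (sdir (ℝ × ℝ) a (sdir (ℝ × ℝ) b (lift f hf))) :=
    fun a b => by rw [← pd_slice, ← pd_slice]; rfl
  rw [h, h, sdir_comm]

/-- For `h_{00} = f` the quadratic invariant of the Schouten tensor is the square of the trace-free
part of the spatial Hessian of `f`. -/
theorem inn_linSchouten_lapse {f : ScalarField} (hf : ContDiff ℝ ∞ f) (x : Spacetime) :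
    inn (fun a b => linSchouten (lapse f) a b x) (fun a b => linSchouten (lapse f) a b x)
      - mtr (fun a b => linSchouten (lapse f) a b x) * mtr (fun a b => linSchouten (lapse f) a b x)
    = (1 / 16) * (2 * (pd 1 (pd 2 f) x ^ 2 + pd 1 (pd 3 f) x ^ 2 + pd 2 (pd 3 f) x ^ 2)
      + (1 / 3) * ((pd 1 (pd 1 f) x - pd 2 (pd 2 f) x) ^ 2
        + (pd 2 (pd 2 f) x - pd 3 (pd 3 f) x) ^ 2 + (pd 1 (pd 1 f) x - pd 3 (pd 3 f) x) ^ 2)) := by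
  have hm : ∀ a b, mink a b = if a = b then if a = 0 then -1 else 1 else 0 := by
    intro a b
    fin_cases a <;> fin_cases b <;> simp [mink]
  have hr : ∀ a b, linRicci (lapse f) a b x = ∑ c, mink c c * linRiemann (lapse f) c a c b x :=
    fun a b => Finset.sum_congr rfl fun c _ => by
      rw [Finset.sum_eq_single c (fun d _ hd => by rw [mink_eq, if_neg (Ne.symm hd), zero_mul])
        (by simp)]
  have e := fun a b => congrFun (pd_comm hf a b) x
  have h00 : linRicci (lapse f) 0 0 x
      = -(1 / 2) * (pd 1 (pd 1 f) x + pd 2 (pd 2 f) x + pd 3 (pd 3 f) x) := by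
    simp [hr, Fin.sum_univ_four, linRiemann, pd_pd_lapse, hm]
    ring
  have h0i : ∀ i, i ≠ 0 → linRicci (lapse f) 0 i x = 0 := fun i hi => by
    simp [hr, Fin.sum_univ_four, linRiemann, pd_pd_lapse, hm, hi]
  have hi0 : ∀ i, i ≠ 0 → linRicci (lapse f) i 0 x = 0 := fun i hi => by
    simp [hr, Fin.sum_univ_four, linRiemann, pd_pd_lapse, hm, hi]
  have hij : ∀ i j, i ≠ 0 → j ≠ 0 → linRicci (lapse f) i j x = (1 / 2) * pd i (pd j f) x :=
    fun i j hi hj => by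
      simp [hr, linRiemann, pd_pd_lapse, hm, hi, hj]
  have hsc : linScalar (lapse f) x = pd 1 (pd 1 f) x + pd 2 (pd 2 f) x + pd 3 (pd 3 f) x := by
    have : linScalar (lapse f) x = ∑ c, mink c c * linRicci (lapse f) c c x :=
      Finset.sum_congr rfl fun c _ => by
        rw [Finset.sum_eq_single c (fun d _ hd => by rw [mink_eq, if_neg (Ne.symm hd), zero_mul])
          (by simp)]
    rw [this]
    simp [Fin.sum_univ_four, hm, h00, hij]
    ring
  simp [inn, mtr, mdiag, linSchouten, Fin.sum_univ_four, hsc, hm, h00, h0i, hi0, hij]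
  rw [e 2 1, e 3 1, e 3 2]
  ring

/-- For `h_{00} = f` with `f = x¹ x²` near the origin the Weyl tensor does not vanish there, and
the integrand is nonnegative everywhere. -/
theorem exists_weylContract_ne_zero : ∃ v : TensorField, IsSymmField v ∧ HasCompactSupport v ∧
    ∫ x, weylContract v v x ≠ 0 := by
  obtain ⟨K, χ, hK, -, hχ, h1, h0⟩ := exists_cutoff (isCompact_singleton (x := (0 : Spacetime)))
  have hf : ContDiff ℝ ∞ fun x : Spacetime => χ x * (x 1 * x 2) :=
    hχ.mul ((contDiff_apply ℝ ℝ 1).mul (contDiff_apply ℝ ℝ 2))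
  have hv := lapse_isSymmField hf
  have hvK : ∀ x ∉ K, lapse (fun x : Spacetime => χ x * (x 1 * x 2)) x = 0 := fun x hx => by
    ext a b
    simp [lapse_apply, h0 x hx]
  refine ⟨_, hv, HasCompactSupport.intro hK hvK, ?_⟩
  rw [integral_weylContract hv hv (HasCompactSupport.intro hK hvK) 0]
  refine mul_ne_zero (by norm_num) (ne_of_gt ?_)
  have hsl := fun x => (inn_linSchouten_eq_slice hv hv 0 x).symm.trans (inn_linSchouten_lapse hf x)
  refine Continuous.integral_pos_of_hasCompactSupport_nonneg_nonzero (x := 0)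
    (slice_contDiff _ _).continuous (HasCompactSupport.intro hK fun x hx => ?_) (fun x => ?_) ?_
  · exact schPair_mem (D := sdir (ℝ × ℝ)) (u := liftM _ hv) (v := liftM _ hv)
      (I := vanOff (ℝ × ℝ) K) (fun a x hx => dir_mem_vanOff hK.isClosed _ hx)
      (fun a b p x hx => congrFun (congrFun (hvK x hx) a) b) 0 x hx
  · rw [hsl]
    simp only [Pi.zero_apply]
    positivity
  · rw [hsl]
    have h2 : pd 1 (pd 2 fun x : Spacetime => χ x * (x 1 * x 2)) 0 = 1 := by
      rw [nhdsSet_singleton, eventually_nhds_iff] at h1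
      obtain ⟨O, hO, hOo, h0O⟩ := h1
      have hp : ∀ a b : Fin 4, pd a (fun y : Spacetime => y b) = fun _ => if a = b then 1 else 0 :=
        fun a b => by
          ext x
          have : HasFDerivAt (fun y : Spacetime => y b)
            (ContinuousLinearMap.proj (R := ℝ) (φ := fun _ : Fin 4 => ℝ) b) x :=
            (ContinuousLinearMap.proj (R := ℝ) (φ := fun _ : Fin 4 => ℝ) b).hasFDerivAt
          rw [pd, this.fderiv]
          simp [Pi.single_apply, eq_comm]
      have e1 : Set.EqOn (fun x : Spacetime => χ x * (x 1 * x 2)) (fun x => x 1 * x 2) O :=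
        fun x hx => by simp only [hO x hx, one_mul]
      have e2 : pd 2 (fun x : Spacetime => x 1 * x 2) = fun x => x 1 := by
        ext x
        have d1 : DifferentiableAt ℝ (fun y : Spacetime => y 1) x := differentiableAt_apply 1 x
        have d2 : DifferentiableAt ℝ (fun y : Spacetime => y 2) x := differentiableAt_apply 2 x
        have := congrFun (hp 2 1) x
        have h' := congrFun (hp 2 2) x
        rw [pd] at this h' ⊢
        rw [fderiv_fun_mul d1 d2, add_apply, smul_apply,
          smul_apply, this, h']
        simp
      rw [pd_congr hOo (pd_congr hOo e1 2) 1 h0O, e2, hp]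
      simp
    rw [h2]
    positivity

end

end

section

/-! ### Cross-interactions -/

theorem IsSymmField.add {t t' : TensorField} (ht : IsSymmField t) (ht' : IsSymmField t') :
    IsSymmField fun x => t x + t' x where
  smooth a b := (ht.smooth a b).add (ht'.smooth a b)
  symm x := (ht.symm x).add (ht'.symm x)

theorem IsSymmField.const_smul {t : TensorField} (ht : IsSymmField t) (c : ℝ) :
    IsSymmField fun x => c • t x := ht.smul (χ := fun _ => c) contDiff_const

theorem isSymmField_zero : IsSymmField 0 where
  smooth _ _ := contDiff_const
  symm _ := Matrix.isSymm_zero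

section

variable (α : ℝ) (M : Matrix (Fin 2) (Fin 2) ℝ)

/-- The action of the pair `M u`, as a function of the two components of `u`. -/
def mixAction (u w : TensorField) : ℝ :=
  ∫ x, bachLag (fun x => mink + α • (M 0 0 • u x + M 0 1 • w x))
    (fun x => M 1 0 • u x + M 1 1 • w x) x

theorem mix_apply (u w : TensorField) (a : Fin 2) (x : Spacetime) :
    mix M ![u, w] a x = M a 0 • u x + M a 1 • w x := by
  simp [mix, Fin.sum_univ_two]

theorem action_mix (u w : TensorField) :
    action α Set.univ (mix M ![u, w]) = mixAction α M u w := by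
  rw [action, Measure.restrict_univ, mixAction]
  refine integral_congr_ae (ae_of_all _ fun x => ?_)
  have h1 : metric α (mix M ![u, w]) = fun x => mink + α • (M 0 0 • u x + M 0 1 • w x) := by
    ext x : 1
    rw [metric, mix_apply]
  have h2 : mix M ![u, w] 1 = fun x => M 1 0 • u x + M 1 1 • w x := by
    ext x : 1
    rw [mix_apply]
  change bachLag (metric α (mix M ![u, w])) (mix M ![u, w] 1) x = _
  rw [h1, h2]

variable {α M}

/-- In a decoupled theory the action is additive in the two components. -/
theorem mixAction_add (hd : DecouplesIn α M) {u w : TensorField} (hu : IsSymmField u)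
    (hw : IsSymmField w) (hcu : HasCompactSupport u) (hcw : HasCompactSupport w)
    (h1 : ∀ x, (mink + α • (M 0 0 • u x + M 0 1 • w x)).det < 0)
    (h2 : ∀ x, (mink + α • (M 0 0 • u x)).det < 0) (h3 : ∀ x, (mink + α • (M 0 1 • w x)).det < 0) :
    mixAction α M u w = mixAction α M u 0 + mixAction α M 0 w := by
  obtain ⟨F, G, h⟩ := hd
  have key : ∀ u w : TensorField, IsSymmField u → IsSymmField w → HasCompactSupport u →
      HasCompactSupport w → (∀ x, (mink + α • (M 0 0 • u x + M 0 1 • w x)).det < 0) →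
      mixAction α M u w = F u + G w := fun u w hu hw hcu hcw hdet => by
    rw [← action_mix]
    refine h ![u, w] (fun a => ?_) (fun a => ?_) ⟨fun a => ?_, fun x => ?_⟩
    · fin_cases a <;> assumption
    · fin_cases a <;> assumption
    · have : mix M ![u, w] a = fun x => M a 0 • u x + M a 1 • w x := by
        ext x : 1
        rw [mix_apply]
      rw [this]
      exact (hu.const_smul _).add (hw.const_smul _)
    · rw [metric, mix_apply]
      exact hdet x
  have hz : mixAction α M 0 0 = 0 := by simp [mixAction, bachLag]
  have hc0 : HasCompactSupport (0 : TensorField) := HasCompactSupport.zero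
  have k1 := key u w hu hw hcu hcw h1
  have k2 := key u 0 hu isSymmField_zero hcu hc0 (by simpa using h2)
  have k3 := key 0 w isSymmField_zero hw hc0 hcw (by simpa using h3)
  have k4 := key 0 0 isSymmField_zero isSymmField_zero hc0 hc0 (by simp [mink_det])
  linarith

variable (M) in
/-- The action of two multiples of one field `v` reduces to the one-parameter family `η + ε v`. -/
theorem mixAction_smul (v : TensorField) (p q : ℝ) :
    mixAction α M (fun x => p • v x) (fun x => q • v x) = (M 1 0 * p + M 1 1 * q)
      * ∫ x, bachLag (fun x => mink + (α * (M 0 0 * p + M 0 1 * q)) • v x) v x := by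
  rw [mixAction, ← integral_const_mul]
  have h1 : (fun x => mink + α • (M 0 0 • p • v x + M 0 1 • q • v x))
      = fun x => mink + (α * (M 0 0 * p + M 0 1 * q)) • v x := by
    ext x : 1
    module
  rw [h1]
  refine integral_congr_ae (ae_of_all _ fun x => ?_)
  dsimp only
  rw [bachLag_linear (t₁ := v) (t₂ := v) (p := M 1 0 * p + M 1 1 * q) (q := 0) _ (by module)]
  ring

/-- The action of a conformally flat background, equal to `2 η` where `v` lives, and a field
`ε v`. -/
theorem mixAction_conformal (hα : α ≠ 0) (ha : M 0 0 ≠ 0) {χ : ScalarField} (hχ : ContDiff ℝ ∞ χ)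
    (hχ0 : ∀ x, 0 ≤ χ x) {v : TensorField} (hv : IsSymmField v) {O : Set Spacetime} (hO : IsOpen O)
    (hvO : tsupport v ⊆ O) (hχO : ∀ x ∈ O, χ x = 1) {ε : ℝ}
    (hdet : ∀ x, ((1 + χ x) • mink + (α * M 0 1 * ε) • v x).det < 0)
    (hdet' : ∀ x, (mink + (α * M 0 1 / 2 * ε) • v x).det < 0) :
    mixAction α M (fun x => (χ x / (α * M 0 0)) • mink) (fun x => ε • v x)
      = ε * ((M 1 1 - M 0 1 * M 1 0 / (2 * M 0 0)) / 2)
        * ∫ x, bachLag (fun x => mink + (α * M 0 1 / 2 * ε) • v x) v x := by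
  have h1 : (fun x => mink + α • (M 0 0 • (χ x / (α * M 0 0)) • mink + M 0 1 • ε • v x))
      = fun x => (1 + χ x) • mink + (α * M 0 1 * ε) • v x := by
    ext x : 1
    have : α * M 0 0 * (χ x / (α * M 0 0)) = χ x := by field_simp
    linear_combination (norm := module) congrArg (· • mink) this
  have hg : IsSymmField fun x => (1 + χ x) • mink + (α * M 0 1 * ε) • v x :=
    (isSymmField_mink.smul (contDiff_const.add hχ)).add (hv.const_smul _)
  rw [mixAction, h1, ← integral_const_mul]
  refine integral_congr_ae (ae_of_all _ fun x => ?_)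
  dsimp only
  have hx : (1 + χ x) ≠ 0 := by linarith [hχ0 x]
  -- The multiple of the metric contained in the second field drops out, the Bach tensor being
  -- trace free.
  have h2 : M 1 0 • (χ x / (α * M 0 0)) • mink + M 1 1 • ε • v x
      = (M 1 0 * (χ x / (α * M 0 0)) / (1 + χ x)) • ((1 + χ x) • mink + (α * M 0 1 * ε) • v x)
        + (ε * (M 1 1 - M 0 1 * M 1 0 / M 0 0 * (χ x / (1 + χ x)))) • v x := by
    have e1 : M 1 0 * (χ x / (α * M 0 0)) / (1 + χ x) * (1 + χ x)
        = M 1 0 * (χ x / (α * M 0 0)) := by field_simp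
    have e2 : M 1 0 * (χ x / (α * M 0 0)) / (1 + χ x) * (α * M 0 1 * ε)
        + ε * (M 1 1 - M 0 1 * M 1 0 / M 0 0 * (χ x / (1 + χ x))) = M 1 1 * ε := by
      field_simp; ring
    rw [smul_add, smul_smul _ (1 + χ x), e1, smul_smul _ (α * M 0 1 * ε), add_assoc, ← add_smul, e2,
      smul_smul, smul_smul]
  rw [bachLag_linear _ (t₁ := fun x => (1 + χ x) • mink + (α * M 0 1 * ε) • v x) (t₂ := v) h2,
    bachLag_self hg hdet, mul_zero, zero_add]
  by_cases hxv : x ∈ tsupport v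
  · have hxO := hvO hxv
    have h3 : Set.EqOn (fun x => (1 + χ x) • mink + (α * M 0 1 * ε) • v x)
        (fun x => (2 : ℝ) • (mink + (α * M 0 1 / 2 * ε) • v x)) O := fun y hy => by
      simp only [hχO y hy]
      module
    rw [bachLag_congr hO h3 hxO rfl, bachLag_smul two_ne_zero hdet', hχO x hxO]
    ring
  · have h3 : ∀ g, bachLag g v x = 0 := fun g => by
      simp [bachLag, image_eq_zero_of_notMem_tsupport hxv]
    rw [h3, h3, mul_zero, mul_zero]

theorem eventually_const_mul {P : ℝ → Prop} (h : ∀ᶠ ε in 𝓝 (0 : ℝ), P ε) (c : ℝ) :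
    ∀ᶠ ε in 𝓝 (0 : ℝ), P (c * ε) := by
  have : Tendsto (fun ε : ℝ => c * ε) (𝓝 0) (𝓝 0) := by
    simpa using (continuous_const_mul c).tendsto (0 : ℝ)
  exact this.eventually h

/-- At second order in the fields a decoupled theory has vanishing cross terms. -/
theorem DecouplesIn.quadratic (hα : α ≠ 0) (hd : DecouplesIn α M) :
    M 0 0 * M 1 1 + M 0 1 * M 1 0 = 0 := by
  obtain ⟨v, hv, hc, hq⟩ := exists_weylContract_ne_zero
  have hΦ := hasDerivAt_integral_bachLag_flat hv hv hc hc
  set Φ := fun ε : ℝ => ∫ x, bachLag (fun x => mink + ε • v x) v x with hΦdef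
  set q := ∫ x, weylContract v v x
  have hdet := eventually_det_neg isSymmField_mink hv (fun _ => by rw [mink_det]; norm_num) hc
  have hΦc : ∀ c : ℝ, HasDerivAt (fun ε => Φ (c * ε)) (q * c) 0 := fun c => by
    have := HasDerivAt.comp_of_eq (0 : ℝ) hΦ ((hasDerivAt_id (0 : ℝ)).const_mul c) (by simp)
    rwa [mul_one] at this
  have hΨ := (((hΦc (α * (M 0 0 + M 0 1))).const_mul (M 1 0 + M 1 1)).sub
    ((hΦc (α * M 0 0)).const_mul (M 1 0))).sub ((hΦc (α * M 0 1)).const_mul (M 1 1))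
  have hΦ0 : Φ 0 = 0 := by simp [hΦdef, bachLag, bach_const]
  have hzero : (fun ε => (M 1 0 + M 1 1) * Φ (α * (M 0 0 + M 0 1) * ε) - M 1 0 * Φ (α * M 0 0 * ε)
      - M 1 1 * Φ (α * M 0 1 * ε)) =ᶠ[𝓝 0] fun _ => 0 := by
    filter_upwards [eventually_const_mul hdet (α * (M 0 0 + M 0 1)),
      eventually_const_mul hdet (α * M 0 0), eventually_const_mul hdet (α * M 0 1)] with ε h1 h2 h3
    by_cases hε : ε = 0
    · simp [hε, hΦ0]
    have hcε : HasCompactSupport fun x => ε • v x := hc.smul_left (f := fun _ => ε)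
    have key := mixAction_add hd (hv.const_smul ε) (hv.const_smul ε) hcε hcε
      (fun x => by convert h1 x using 2; module) (fun x => by convert h2 x using 2; module)
      (fun x => by convert h3 x using 2; module)
    have h0 : (0 : TensorField) = fun x => (0 : ℝ) • v x := by ext x : 1; simp
    rw [h0, mixAction_smul, mixAction_smul, mixAction_smul] at key
    have e : ∀ c, ∫ x, bachLag (fun x => mink + c • v x) v x = Φ c := fun _ => rfl
    simp only [e] at key
    rw [show α * (M 0 0 * ε + M 0 1 * ε) = α * (M 0 0 + M 0 1) * ε by ring,
      show α * (M 0 0 * ε + M 0 1 * 0) = α * M 0 0 * ε by ring,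
      show α * (M 0 0 * 0 + M 0 1 * ε) = α * M 0 1 * ε by ring] at key
    apply mul_left_cancel₀ hε
    linear_combination key
  have h := hΨ.unique ((hasDerivAt_const (0 : ℝ) (0 : ℝ)).congr_of_eventuallyEq hzero)
  have h' : (q * α) * (M 0 0 * M 1 1 + M 0 1 * M 1 0) = 0 := by linear_combination h
  exact (mul_eq_zero.1 h').resolve_left (mul_ne_zero hq hα)

/-- On the conformally flat background `2 η` the quadratic action of a decoupled theory agrees with
the one on the background `η`. -/
theorem DecouplesIn.conformal (hα : α ≠ 0) (ha : M 0 0 ≠ 0) (hb : M 0 1 ≠ 0)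
    (hd : DecouplesIn α M) : (M 1 1 - M 0 1 * M 1 0 / (2 * M 0 0)) / 4 = M 1 1 := by
  obtain ⟨v, hv, hc, hq⟩ := exists_weylContract_ne_zero
  have hΦ := hasDerivAt_integral_bachLag_flat hv hv hc hc
  set Φ := fun ε : ℝ => ∫ x, bachLag (fun x => mink + ε • v x) v x with hΦdef
  set q := ∫ x, weylContract v v x
  have e : ∀ c, ∫ x, bachLag (fun x => mink + c • v x) v x = Φ c := fun _ => rfl
  have hdet := eventually_det_neg isSymmField_mink hv (fun _ => by rw [mink_det]; norm_num) hc
  have hΦc : ∀ c : ℝ, HasDerivAt (fun ε => Φ (c * ε)) (q * c) 0 := fun c => by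
    have := HasDerivAt.comp_of_eq (0 : ℝ) hΦ ((hasDerivAt_id (0 : ℝ)).const_mul c) (by simp)
    rwa [mul_one] at this
  have hΦ0 : Φ 0 = 0 := by simp [hΦdef, bachLag, bach_const]
  obtain ⟨K, χ, hK, -, hχ, h1, h0⟩ := exists_cutoff hc.isCompact
  obtain ⟨O, hO, hvO, hχO⟩ := eventually_nhdsSet_iff_exists.1 h1
  -- The square of the cutoff is nonnegative, so that `(1 + χ²) η` is nondegenerate.
  have hχ2 : ContDiff ℝ ∞ fun x => χ x ^ 2 := hχ.pow 2
  have hχO2 : ∀ x ∈ O, χ x ^ 2 = 1 := fun x hx => by rw [hχO x hx, one_pow]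
  have hbg : IsSymmField fun x => (1 + χ x ^ 2) • mink :=
    isSymmField_mink.smul (contDiff_const.add hχ2)
  have hbgdet : ∀ x, ((1 + χ x ^ 2) • mink).det < 0 := fun x => by
    rw [Matrix.det_smul, mink_det]
    have : 0 < (1 + χ x ^ 2) ^ Fintype.card (Fin 4) := by positivity
    linarith
  have hdet2 := eventually_det_neg hbg hv hbgdet hc
  have hu : IsSymmField fun x => (χ x ^ 2 / (α * M 0 0)) • mink :=
    isSymmField_mink.smul (hχ2.div_const _)
  have hcu : HasCompactSupport fun x => (χ x ^ 2 / (α * M 0 0)) • mink :=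
    HasCompactSupport.intro hK fun x hx => by rw [h0 x hx]; simp
  have hbg2 : ∀ x, mink + α • (M 0 0 • (χ x ^ 2 / (α * M 0 0)) • mink) = (1 + χ x ^ 2) • mink :=
    fun x => by
      rw [smul_smul, smul_smul, add_smul, one_smul]
      congr 2
      field_simp
  have hΨ := ((hΦc (α * M 0 1 / 2)).const_mul
    ((M 1 1 - M 0 1 * M 1 0 / (2 * M 0 0)) / 2)).sub ((hΦc (α * M 0 1)).const_mul (M 1 1))
  have hzero : (fun ε => (M 1 1 - M 0 1 * M 1 0 / (2 * M 0 0)) / 2 * Φ (α * M 0 1 / 2 * ε)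
      - M 1 1 * Φ (α * M 0 1 * ε)) =ᶠ[𝓝 0] fun _ => 0 := by
    filter_upwards [eventually_const_mul hdet2 (α * M 0 1),
      eventually_const_mul hdet (α * M 0 1 / 2), eventually_const_mul hdet (α * M 0 1)]
      with ε h1 h2 h3
    by_cases hε : ε = 0
    · simp [hε, hΦ0]
    have hcε : HasCompactSupport fun x => ε • v x := hc.smul_left (f := fun _ => ε)
    have key := mixAction_add hd hu (hv.const_smul ε) hcu hcε
      (fun x => by
        rw [smul_add, ← add_assoc, hbg2]
        convert h1 x using 2; module)
      (fun x => by rw [hbg2]; exact hbgdet x)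
      (fun x => by convert h3 x using 2; module)
    have hz1 : (0 : TensorField) = fun x => (0 : ℝ) • v x := by ext x : 1; simp
    rw [mixAction_conformal hα ha hχ2 (fun x => sq_nonneg _) hv hO hvO hχO2 h1 h2, hz1,
      mixAction_conformal hα ha hχ2 (fun x => sq_nonneg _) hv hO hvO hχO2
        (fun x => by simpa using hbgdet x) (fun x => by simp [mink_det]), mixAction_smul] at key
    simp only [e] at key
    rw [show α * (M 0 0 * 0 + M 0 1 * ε) = α * M 0 1 * ε by ring] at key
    apply mul_left_cancel₀ hε
    linear_combination key
  have h := hΨ.unique ((hasDerivAt_const (0 : ℝ) (0 : ℝ)).congr_of_eventuallyEq hzero)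
  have h' : (q * (α * M 0 1)) * ((M 1 1 - M 0 1 * M 1 0 / (2 * M 0 0)) / 4 - M 1 1) = 0 := by
    linear_combination h
  linarith [(mul_eq_zero.1 h').resolve_left (mul_ne_zero hq (mul_ne_zero hα hb))]

/-- The two relations between the entries of `M` force `M 0 0 * M 1 1 = 0`, hence `det M = 0`. -/
theorem not_decouplesIn (hα : α ≠ 0) (hM : IsUnit M.det) : ¬ DecouplesIn α M := fun hd => by
  have h1 := hd.quadratic hα
  have h2 : M 0 0 * M 1 1 ≠ 0 := fun h => by
    refine hM.ne_zero ?_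
    rw [Matrix.det_fin_two]
    linarith
  have ha : M 0 0 ≠ 0 := left_ne_zero_of_mul h2
  have hb : M 0 1 ≠ 0 := fun h => h2 (by simpa [h] using h1)
  have h3 := hd.conformal hα ha hb
  have h4 : M 0 1 * M 1 0 / (2 * M 0 0) = -(M 1 1 / 2) := by
    rw [div_eq_iff (mul_ne_zero two_ne_zero ha)]
    linear_combination h1
  rw [h4] at h3
  exact right_ne_zero_of_mul h2 (by linarith)

end

end

end WeylGravitons

end

theorem mainTheorem5 :
    -- gauge invariance of the interacting action
    (∀ (α : ℝ) (h : Fin 2 → WeylGravitons.TensorField)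
        (ξ : Fin 2 → WeylGravitons.CovectorField) (φ : Fin 2 → WeylGravitons.ScalarField),
        WeylGravitons.Admissible α h → WeylGravitons.IsGaugeParam ξ φ →
        ∀ U : Set WeylGravitons.Spacetime, MeasurableSet U →
          (∀ a, tsupport (ξ a) ⊆ U ∧ tsupport (φ a) ⊆ U) →
          IntegrableOn (WeylGravitons.lagrangian α h) U →
          (∀ᶠ ε : ℝ in 𝓝 0, IntegrableOn
            (WeylGravitons.lagrangian α (h + ε • WeylGravitons.gaugeVar α h ξ φ)) U) ∧
          HasDerivAt (fun ε : ℝ =>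
            WeylGravitons.action α U (h + ε • WeylGravitons.gaugeVar α h ξ φ)) 0 0) ∧
    -- free limit of the action
    (∀ h : Fin 2 → WeylGravitons.TensorField,
        (∀ a, WeylGravitons.IsSymmField (h a)) → (∀ a, HasCompactSupport (h a)) →
        Tendsto (fun α : ℝ => α⁻¹ * WeylGravitons.action α Set.univ h) (𝓝[≠] 0)
          (𝓝 (WeylGravitons.freeAction WeylGravitons.internalMetric h))) ∧
    -- free limit of the gauge transformations
    (∀ (h : Fin 2 → WeylGravitons.TensorField)
        (ξ : Fin 2 → WeylGravitons.CovectorField) (φ : Fin 2 → WeylGravitons.ScalarField),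
        (∀ a, WeylGravitons.IsSymmField (h a)) → WeylGravitons.IsGaugeParam ξ φ →
        ∀ (a : Fin 2) (x : WeylGravitons.Spacetime) (μ ν : Fin 4),
          Tendsto (fun α : ℝ => WeylGravitons.gaugeVar α h ξ φ a x μ ν) (𝓝 0)
            (𝓝 (WeylGravitons.freeGaugeVar ξ φ a x μ ν))) ∧
    -- genuine cross-interactions: no change of internal basis decouples the two fields
    (∀ α : ℝ, α ≠ 0 → ∀ M : Matrix (Fin 2) (Fin 2) ℝ, IsUnit M.det →
        ¬ WeylGravitons.DecouplesIn α M) := by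
  refine ⟨fun α h ξ φ hh hp U _ hs hi => ?_, fun h hs hc => ?_, fun h ξ φ hs hp a x μ ν => ?_,
    fun α hα M hM => WeylGravitons.not_decouplesIn hα hM⟩
  · exact WeylGravitons.gauge_invariance α h ξ φ hh hp U hs hi
  · rw [WeylGravitons.freeAction_internalMetric]
    exact WeylGravitons.tendsto_action hs hc
  · exact WeylGravitons.tendsto_gaugeVar h ξ φ hs hp a x μ ν
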